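/- **Setting.** A solid isotropic core $r<r_0$ (in-plane bulk modulus $K_0>0$, shear modulus $\mu_0>0$, density $\rho_0>0$) is surrounded by a cylindrically orthotropic shell $r_0\le r\le r_1$ with continuous, radially varying in-plane moduli $C_{11},C_{22},C_{12},C_{66}$ ($C_{11},C_{66}>0$, $C_{11}C_{22}>C_{12}^2$) and density $\rho>0$, and embedded in an infinite isotropic matrix $(K_e,\mu_e,\rho_e)$, all positive. A field of angular harmonic $e^{in\theta}$ and frequency $\omega$ is described by $\mathbf v=(u_r,-iu_\theta,r\sigma_{rr},-ir\sigma_{r\theta})^T$, which is continuous across the interfaces, bounded near $r=0$, and satisfies in each material $r\,\mathbf v'=\mathbf G\mathbf v$, where, with $\gamma=1+C_{12}/C_{11}$ and $C=C_{22}-C_{12}^2/C_{11}$, $$\mathbf G=\begin{pmatrix}1-\gamma&n(\gamma-1)&C_{11}^{-1}&0\\-n&1&0&C_{66}^{-1}\\C-\rho\omega^2r^2&-nC&\gamma-1&n\\-nC&n^2C-\rho\omega^2r^2&n(1-\gamma)&-1\end{pmatrix}$$ ($\omega=0$ is static equilibrium). Static loads in the matrix are the hydrostatic load ($n=0$) $\alpha\frac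 r{r_1}(1,0,2K_e,0)^T$ and the shear load ($n=2$) $\alpha\frac r{r_1}(1,1,2\mu_e,2\mu_e)^T$, $\alpha\in\mathbb C$. For $n=2$ let $\alpha_1\neq0$ and let the static field under the shear load of amplitude $\alpha_1$ be, for $r>r_1$, $$\mathbf v(r)=\alpha_1\tfrac r{r_1}(1,1,2\mu_e,2\mu_e)^T+\alpha_3\tfrac{r_1}r\mathbf v_3+\alpha_4\big(\tfrac{r_1}r\big)^3\mathbf v_4,$$ $\mathbf v_3=\big(\frac1{2\mu_e},\frac{2-\gamma_e}{4\mu_e},-\gamma_e,\frac{\gamma_e}2\big)^T$, $\mathbf v_4=\big(\frac1{12\mu_e},-\frac1{12\mu_e},-\frac12,\frac12\big)^T$, $\gamma_e=\frac{2K_e}{K_e+\mu_e}$. **Definitions.** *Strong neutral inclusion*: for every hydrostatic and every shear load there is a static field that equals the load for all $r>r_1$. *Weak neutral inclusion*: for every hydrostatic and every shear load, consider discs of radius $R>r_1$ whose boundary is given the displacement of the load; the strain energy of the disc with the core and shell embedded in matrix, minus the strain energy of the disc of pure matrix, tends to $0$ as $R\to\infty$ (replacing matrix by the composite does not change the energy).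 *Bulk modulus condition*: the solution $K_*$ on $[r_0,r_1]$ of $K_*'+\frac2{rC_{11}}\big(K_*^2-C_{12}K_*-\frac14(C_{11}C_{22}-C_{12}^2)\big)=0$, $K_*(r_0)=K_0$, exists and has $K_*(r_1)=K_e$. *Scattering*: let $k_L=\omega/c_L$, $k_T=\omega/c_T$, $c_L^2=(K_e+\mu_e)/\rho_e$, $c_T^2=\mu_e/\rho_e$. Longitudinal and transverse plane waves in the direction $x_1$ with potentials $\phi=-\varepsilon_Lk_L^{-2}e^{ik_Lx_1}$, $\psi=-\varepsilon_Tk_T^{-2}e^{ik_Tx_1}$ (strain amplitudes $\varepsilon_L,\varepsilon_T$ independent of $\omega$) are incident, so that the $e^{2i\theta}$ harmonics of the total potentials in $r>r_1$ are $$\phi=\tfrac{\varepsilon_L}{k_L^2}J_2(k_Lr)+B_LH_2^{(1)}(k_Lr),\qquad\psi=\tfrac{\varepsilon_T}{k_T^2}J_2(k_Tr)+iB_TH_2^{(1)}(k_Tr),$$ with exterior displacement $\mathbf u=\nabla\phi-\nabla\times\psi\mathbf e_3$. **Lemma.** 1. Let $\varepsilon_L\ne i\varepsilon_T$ (the $n=2$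 loading does not vanish), and for all small $\omega>0$ let $B_L(\omega),B_T(\omega)$ be amplitudes that solve the scattering problem. Then $B_L\to B_{L0}$ and $B_T\to B_{T0}$ as $\omega\to0^+$ for some $B_{L0},B_{T0}\in\mathbb C$, $\;B_{L0}/k_L^2=B_{T0}/k_T^2$ for all $\omega>0$, and the leading-order scattered waves vanish, $B_{L0}=B_{T0}=0$, if and only if $\alpha_3=0$. 2. The composite is a weak neutral inclusion if and only if the bulk modulus condition holds and $\alpha_3=0$. 3. The composite is a strong neutral inclusion if and only if the bulk modulus condition holds and $\alpha_3=\alpha_4=0$. 4. If the shell is uniform, then with $K=\frac12(\sqrt{C_{11}C_{22}}+C_{12})$, $\mu=\frac12(\sqrt{C_{11}C_{22}}-C_{12})$, $\beta=\sqrt{C_{22}/C_{11}}$, the bulk modulus condition is equivalent to $$K_e=\frac{K(\mu+K_0)-\mu(K-K_0)(r_0/r_1)^{2\beta}}{\mu+K_0+(K-K_0)(r_0/r_1)^{2\beta}}.$$ -/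

import Mathlib

open Set Filter Topology

noncomputable section

/-! ### Bessel and Hankel functions of integer order, for positive real argument -/

/-- Bessel function of the first kind `J_n`. -/
def besselJ (n : ℕ) (z : ℝ) : ℝ :=
  ∑' k : ℕ, (-1 : ℝ) ^ k / ((k.factorial : ℝ) * ((n + k).factorial : ℝ)) * (z / 2) ^ (2 * k + n)

/-- The digamma function at `m + 1`, that is `H_m - γ` with `γ` the Euler-Mascheroni constant. -/
def digammaSucc (m : ℕ) : ℝ := (harmonic m : ℝ) - Real.eulerMascheroniConstant

/-- Bessel function of the second kind `Y_n` (`z > 0`). -/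
def besselY (n : ℕ) (z : ℝ) : ℝ :=
  2 / Real.pi * besselJ n z * Real.log (z / 2)
    - 1 / Real.pi * ∑ k ∈ Finset.range n,
        ((n - k - 1).factorial : ℝ) / (k.factorial : ℝ) * ((z / 2) ^ (2 * k) / (z / 2) ^ n)
    - 1 / Real.pi * ∑' k : ℕ, (digammaSucc k + digammaSucc (n + k)) *
        ((-1 : ℝ) ^ k / ((k.factorial : ℝ) * ((n + k).factorial : ℝ)) * (z / 2) ^ (2 * k + n))

/-- Hankel function of the first kind `H_n^{(1)} = J_n + i Y_n`. -/
def hankel (n : ℕ) (z : ℝ) : ℂ := (besselJ n z : ℂ) + Complex.I * (besselY n z : ℂ)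

/-! ### Materials -/

/-- In-plane moduli (Voigt notation, `1, 2 ↔ r, θ`) of a cylindrically orthotropic material, and
its density. -/
structure PlaneMaterial where
  C11 : ℝ
  C22 : ℝ
  C12 : ℝ
  C66 : ℝ
  ρ : ℝ

namespace PlaneMaterial

/-- Positive definite strain energy and positive density. -/
def Positive (m : PlaneMaterial) : Prop :=
  0 < m.C11 ∧ 0 < m.C66 ∧ m.C12 ^ 2 < m.C11 * m.C22 ∧ 0 < m.ρ

/-- The isotropic material with in-plane bulk modulus `K`, shear modulus `μ` and density `ρ`. -/
def isotropic (K μ ρ : ℝ) : PlaneMaterial := ⟨K + μ, K + μ, K - μ, μ, ρ⟩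

/-- `γ = 1 + C₁₂ / C₁₁`. -/
def γ (m : PlaneMaterial) : ℝ := 1 + m.C12 / m.C11

/-- `C = C₂₂ - C₁₂² / C₁₁`. -/
def C (m : PlaneMaterial) : ℝ := m.C22 - m.C12 ^ 2 / m.C11

end PlaneMaterial

/-- A solid isotropic core `r < r0`, a cylindrically orthotropic shell `r0 ≤ r ≤ r1` with radially
varying properties, and an infinite isotropic matrix `r > r1`. -/
structure CoreShell where
  r0 : ℝ
  r1 : ℝ
  K0 : ℝ
  μ0 : ℝ
  ρ0 : ℝ
  shell : ℝ → PlaneMaterial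
  Ke : ℝ
  μe : ℝ
  ρe : ℝ
  r0_pos : 0 < r0
  r0_lt_r1 : r0 < r1
  K0_pos : 0 < K0
  μ0_pos : 0 < μ0
  ρ0_pos : 0 < ρ0
  Ke_pos : 0 < Ke
  μe_pos : 0 < μe
  ρe_pos : 0 < ρe
  shell_pos : ∀ r ∈ Icc r0 r1, (shell r).Positive
  shell_C11 : ContinuousOn (fun r => (shell r).C11) (Icc r0 r1)
  shell_C22 : ContinuousOn (fun r => (shell r).C22) (Icc r0 r1)
  shell_C12 : ContinuousOn (fun r => (shell r).C12) (Icc r0 r1)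
  shell_C66 : ContinuousOn (fun r => (shell r).C66) (Icc r0 r1)
  shell_ρ : ContinuousOn (fun r => (shell r).ρ) (Icc r0 r1)

/-! ### Fields of one angular harmonic

A displacement field with the angular dependence `e^{inθ}` (and the time dependence `e^{-iωt}`) is
recorded by its state vector `v = (u_r, -i u_θ, r σ_rr, -i r σ_rθ)`, a function of `r`. For `n = 2`
the real parts of the fields `v e^{2iθ}` with complex amplitude are all the real fields of
harmonic `2`. -/

/-- The system matrix: `dv/dr = (1/r) G v` are the constitutive law and the time-harmonic equation
of motion (equilibrium if `ω = 0`). -/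
def systemMatrix (n : ℕ) (ω : ℝ) (m : PlaneMaterial) (r : ℝ) : Matrix (Fin 4) (Fin 4) ℂ :=
  (!![1 - m.γ, n * (m.γ - 1), 1 / m.C11, 0;
      -n, 1, 0, 1 / m.C66;
      m.C - m.ρ * ω ^ 2 * r ^ 2, -(n * m.C), m.γ - 1, n;
      -(n * m.C), n ^ 2 * m.C - m.ρ * ω ^ 2 * r ^ 2, n * (1 - m.γ), -1]
    : Matrix (Fin 4) (Fin 4) ℝ).map (fun x : ℝ => (x : ℂ))

/-- Strain energy density `½ σ : ε` of the harmonic `n` with state vector `v`, in the Hermitian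
form of the complex strain amplitudes `ε_rr`, `ε_θθ` and `2 ε_rθ` (up to a factor `i`). -/
def strainEnergyDensity (n : ℕ) (m : PlaneMaterial) (v : ℝ → Fin 4 → ℂ) (r : ℝ) : ℝ :=
  let err : ℂ := deriv (fun s => v s 0) r
  let ett : ℂ := (v r 0 - n * v r 1) / r
  let grt : ℂ := deriv (fun s => v s 1) r - v r 1 / r + n * v r 0 / r
  (m.C11 * ‖err‖ ^ 2 + 2 * m.C12 * (err * (starRingEnd ℂ) ett).re + m.C22 * ‖ett‖ ^ 2
    + m.C66 * ‖grt‖ ^ 2) / 2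

/-- Strain energy in the disc of radius `R`: the sum of the energies of the real fields
`Re (v e^{inθ})` and `Im (v e^{inθ})`. -/
def strainEnergy (n : ℕ) (mat : ℝ → PlaneMaterial) (R : ℝ) (v : ℝ → Fin 4 → ℂ) : ℝ :=
  2 * Real.pi * ∫ r in (0 : ℝ)..R, strainEnergyDensity n (mat r) v r * r

namespace CoreShell

/-- The exterior (matrix) material. -/
def ext (c : CoreShell) : PlaneMaterial := PlaneMaterial.isotropic c.Ke c.μe c.ρe

/-- The material at radius `r` of the matrix with the core and shell embedded in it. -/
def material (c : CoreShell) (r : ℝ) : PlaneMaterial :=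
  if r < c.r0 then PlaneMaterial.isotropic c.K0 c.μ0 c.ρ0
  else if r ≤ c.r1 then c.shell r
  else c.ext

/-- `v` is a field of harmonic `n` and frequency `ω` on the set `S` of radii: displacement and
traction are continuous (also across the interfaces), the field equations hold in each of the
materials, and `v` is bounded near the axis. -/
def IsField (c : CoreShell) (n : ℕ) (ω : ℝ) (S : Set ℝ) (v : ℝ → Fin 4 → ℂ) : Prop :=
  ContinuousOn v S ∧
  (∀ r ∈ interior S, r ≠ c.r0 → r ≠ c.r1 →
    HasDerivAt v ((1 / r : ℂ) • (systemMatrix n ω (c.material r) r).mulVec (v r)) r) ∧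
  ∃ B : ℝ, ∀ r ∈ Ioo 0 c.r0, ‖v r‖ ≤ B

/-! ### Static loading -/

/-- Hydrostatic loading (`n = 0`) of the matrix, `u = α r / r1 e_r`. -/
def hydrostaticLoad (c : CoreShell) (α : ℂ) (r : ℝ) : Fin 4 → ℂ :=
  (α * (r / c.r1 : ℂ)) • ![1, 0, 2 * (c.Ke : ℂ), 0]

/-- Uniform shear loading (`n = 2`) of the matrix. -/
def shearLoad (c : CoreShell) (α : ℂ) (r : ℝ) : Fin 4 → ℂ :=
  (α * (r / c.r1 : ℂ)) • ![1, 1, 2 * (c.μe : ℂ), 2 * (c.μe : ℂ)]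

/-- The vector of the static exterior solution (`n = 2`) with `r⁻¹` decay. -/
def v3 (c : CoreShell) : Fin 4 → ℂ :=
  ![1 / (2 * (c.μe : ℂ)), (2 - (c.ext.γ : ℂ)) / (4 * (c.μe : ℂ)),
    -(c.ext.γ : ℂ), (c.ext.γ : ℂ) / 2]

/-- The vector of the static exterior solution (`n = 2`) with `r⁻³` decay. -/
def v4 (c : CoreShell) : Fin 4 → ℂ :=
  ![1 / (12 * (c.μe : ℂ)), -1 / (12 * (c.μe : ℂ)), -1 / 2, 1 / 2]

/-- The static `n = 2` problem with remote shear of amplitude `α₁` has a solution whose exterior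
part is the load plus `α₃` times the `r⁻¹` solution plus `α₄` times the `r⁻³` solution. -/
def StaticShear (c : CoreShell) (α₁ α₃ α₄ : ℂ) : Prop :=
  ∃ v, c.IsField 2 0 (Ioi 0) v ∧ ∀ r, c.r1 < r →
    v r = c.shearLoad α₁ r + (α₃ * (c.r1 / r : ℂ)) • c.v3 + (α₄ * (c.r1 / r : ℂ) ^ 3) • c.v4

/-- The load `L` of harmonic `n` is left unperturbed outside the core and shell. -/
def Unperturbed (c : CoreShell) (n : ℕ) (L : ℝ → Fin 4 → ℂ) : Prop :=
  ∃ v, c.IsField n 0 (Ioi 0) v ∧ ∀ r, c.r1 < r → v r = L r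

/-- Strong neutral inclusion: no hydrostatic or shear loading is perturbed in the exterior. -/
def StrongNeutral (c : CoreShell) : Prop :=
  ∀ α : ℂ, c.Unperturbed 0 (c.hydrostaticLoad α) ∧ c.Unperturbed 2 (c.shearLoad α)

/-- Energy equivalence for the load `L` of harmonic `n`: in a disc of matrix of large radius `R`
whose boundary is given the displacement of `L`, replacing the matrix in `r ≤ r1` by the core and
shell does not change the strain energy, in the limit of an infinite matrix. -/
def EnergyEquivalent (c : CoreShell) (n : ℕ) (L : ℝ → Fin 4 → ℂ) : Prop :=
  ∃ w : ℝ → ℝ → Fin 4 → ℂ,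
    (∀ R, c.r1 < R → c.IsField n 0 (Ioc 0 R) (w R) ∧ w R R 0 = L R 0 ∧ w R R 1 = L R 1) ∧
    Tendsto (fun R => strainEnergy n c.material R (w R) - strainEnergy n (fun _ => c.ext) R L)
      atTop (𝓝 0)

/-- Weak neutral inclusion: energy equivalence for all hydrostatic and shear loadings. -/
def WeakNeutral (c : CoreShell) : Prop :=
  ∀ α : ℂ, c.EnergyEquivalent 0 (c.hydrostaticLoad α) ∧ c.EnergyEquivalent 2 (c.shearLoad α)

/-- Bulk modulus condition: the pointwise effective bulk modulus `K_*`, the solution of the Riccati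
equation with the value `K0` at `r0`, equals the exterior bulk modulus at `r1`. -/
def BulkCondition (c : CoreShell) : Prop :=
  ∃ Ks : ℝ → ℝ, Ks c.r0 = c.K0 ∧ Ks c.r1 = c.Ke ∧
    ∀ r ∈ Icc c.r0 c.r1, HasDerivWithinAt Ks
      (-(2 / r * (1 / (c.shell r).C11) * (Ks r ^ 2 - (c.shell r).C12 * Ks r
        - ((c.shell r).C11 * (c.shell r).C22 - (c.shell r).C12 ^ 2) / 4))) (Icc c.r0 c.r1) r

/-! ### Scattering of the harmonic `n = 2` -/

/-- Longitudinal wavenumber `ω / c_L` of the matrix. -/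
def kL (c : CoreShell) (ω : ℝ) : ℝ := ω / Real.sqrt ((c.Ke + c.μe) / c.ρe)

/-- Transverse wavenumber `ω / c_T` of the matrix. -/
def kT (c : CoreShell) (ω : ℝ) : ℝ := ω / Real.sqrt (c.μe / c.ρe)

/-- Radial part of the `n = 2` harmonic of the potential `φ` outside the shell. Incident is the
plane wave `φ = -(εL / k_L²) e^{i k_L x₁}`, with normal strain of amplitude `εL`, whose harmonic
`e^{2iθ}` is `(εL / k_L²) J₂(k_L r)`; the scattered part is `B_L H₂(k_L r)`. -/
def phi (c : CoreShell) (ω : ℝ) (εL BL : ℂ) (r : ℝ) : ℂ :=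
  εL / (c.kL ω : ℂ) ^ 2 * (besselJ 2 (c.kL ω * r) : ℂ) + BL * hankel 2 (c.kL ω * r)

/-- The same for the potential `ψ`. Incident is the plane wave `ψ = -(εT / k_T²) e^{i k_T x₁}`, with
shear strain of amplitude `εT`; the scattered part is `i B_T H₂(k_T r)`. -/
def psi (c : CoreShell) (ω : ℝ) (εT BT : ℂ) (r : ℝ) : ℂ :=
  εT / (c.kT ω : ℂ) ^ 2 * (besselJ 2 (c.kT ω * r) : ℂ) + Complex.I * BT * hankel 2 (c.kT ω * r)

/-- `B_L`, `B_T` are the amplitudes of the `n = 2` scattered waves at frequency `ω`, when the strain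
amplitudes of the incident plane longitudinal and transverse waves are `εL`, `εT`: there is a
time-harmonic field whose exterior displacement is `∇φ - ∇ × (ψ e₃)`, that is
`u_r = φ' - (2i/r) ψ` and `u_θ = (2i/r) φ + ψ'`. -/
def Scattering (c : CoreShell) (ω : ℝ) (εL εT BL BT : ℂ) : Prop :=
  ∃ v, c.IsField 2 ω (Ioi 0) v ∧ ∀ r, c.r1 < r →
    v r 0 = deriv (c.phi ω εL BL) r - 2 * Complex.I / r * c.psi ω εT BT r ∧
    v r 1 = -Complex.I * (2 * Complex.I / r * c.phi ω εL BL r + deriv (c.psi ω εT BT) r)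

end CoreShell

end

/-! The static system of a fixed harmonic is Hamiltonian: the bilinear form `pair` of two static
fields does not depend on `r` (Betti reciprocity), while for a single static field the boundary work
`work` has derivative `energyForm / r ≥ 0`. Conservation replaces the explicit solution of the shell
problem, and monotonicity gives uniqueness.

For `n = 2`, an isotropic material has four power solutions, with exponents `1, 3, -1, -3`. They
pair nontrivially only in opposite exponents, so coefficients are read off by pairing. Boundedness
at the axis kills the exponents `-1, -3` in the core, and so leaves a two-dimensional space of
fields. A field whose exterior part only decays has work tending to `0` at infinity; as work is
nondecreasing and starts from `0`, the field vanishes. Hence the two growing exterior coefficients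
parametrize the fields, which gives the normalized basis `p = (1, 0, p2, p3)`, `q = (0, 1, q2, q3)`
of `StaticBasis`. Up to nonzero factors `α₃` is `p2` and `α₄` is `p3`, and reciprocity between `p`
and its conjugate makes `p2` real.

For `n = 0` the radial part of every field is a multiple of one real solution `(x, y)`, and `y / (2
x)` solves the Riccati equation. The bulk condition thus says `y = 2 Ke x` at `r1`, that is, the
decaying exterior part is absent (`HydroShell.bulkCondition_iff`). Strong neutrality can then be
read off from the exterior coefficients. In a uniform shell `(x, y)` is a combination of `r ^ β` and
`r ^ (-β)`.

For weak neutrality, a static strain energy is `π` times the boundary work, so at equal boundary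
displacement the energy difference is `π Re (pair (star L) w)`. As `R → ∞` it tends to a nonzero
multiple of `p2` under a nonzero shear load (`tendsto_strainEnergy_shear`), and of `y - 2 Ke x` at
`r1` under a nonzero hydrostatic load (`tendsto_strainEnergy_hydro`).

For scattering, the pairing of a static field with a field of frequency `ω` changes only through
inertia. With an a priori bound on low-frequency fields it is therefore `O(ω²)` relative to the size
of the field at a fixed exterior radius (`IsField.exists_norm_pair_le`). The Hankel expansions write
the exterior state as incident shear, plus `D = BL / kL² - BT / kT²` times nearly the `r⁻³`
solution, plus `BL` times nearly the `r⁻¹` solution. Pairing with `p` isolates `BL`, whose limit is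
a nonzero constant times `p2 (εL - i εT)`; pairing with `q` shows that `D` converges, so `BT` has
the limit of `(kT / kL)² BL`. -/

/-! ### Functions differentiable off two points -/

/-- A transitive relation between points of `[a, b]` that holds on the subintervals whose interior
avoids `c` and `d` holds on all subintervals. -/
theorem rel_of_avoid_two {P : ℝ → ℝ → Prop} {a b : ℝ} (c d : ℝ)
    (trans : ∀ x y z, a ≤ x → x ≤ y → y ≤ z → z ≤ b → P x y → P y z → P x z)
    (h : ∀ x y, a ≤ x → x ≤ y → y ≤ b → (∀ t ∈ Ioo x y, t ≠ c ∧ t ≠ d) → P x y)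
    {x y : ℝ} (hx : a ≤ x) (hxy : x ≤ y) (hy : y ≤ b) : P x y := by
  have one : ∀ x y, a ≤ x → x ≤ y → y ≤ b → (∀ t ∈ Ioo x y, t ≠ d) → P x y := by
    intro x y hx hxy hy hd
    by_cases hc : c ∈ Ioo x y
    · refine trans x c y hx hc.1.le hc.2.le hy ?_ ?_
      · exact h x c hx hc.1.le (hc.2.le.trans hy)
          fun t ht => ⟨ht.2.ne, hd t ⟨ht.1, ht.2.trans hc.2⟩⟩
      · exact h c y (hx.trans hc.1.le) hc.2.le hy
          fun t ht => ⟨ht.1.ne', hd t ⟨hc.1.trans ht.1, ht.2⟩⟩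
    · exact h x y hx hxy hy fun t ht => ⟨fun e => hc (e ▸ ht), hd t ht⟩
  by_cases hd : d ∈ Ioo x y
  · exact trans x d y hx hd.1.le hd.2.le hy
      (one x d hx hd.1.le (hd.2.le.trans hy) fun t ht => ht.2.ne)
      (one d y (hx.trans hd.1.le) hd.2.le hy fun t ht => ht.1.ne')
  · exact one x y hx hxy hy fun t ht e => hd (e ▸ ht)

theorem monotoneOn_of_hasDerivAt_nonneg_off_two {f f' : ℝ → ℝ} {a b c d : ℝ}
    (hf : ContinuousOn f (Icc a b))
    (hd : ∀ x ∈ Ioo a b, x ≠ c → x ≠ d → HasDerivAt f (f' x) x ∧ 0 ≤ f' x) :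
    MonotoneOn f (Icc a b) := by
  intro x hx y hy hxy
  refine rel_of_avoid_two (P := fun x y => f x ≤ f y) c d (fun _ _ _ _ _ _ _ => le_trans) ?_
    hx.1 hxy hy.2
  intro x y hx hxy hy h
  have hs : Icc x y ⊆ Icc a b := Icc_subset_Icc hx hy
  have key : ∀ t ∈ Ioo x y, HasDerivAt f (f' t) t ∧ 0 ≤ f' t := fun t ht =>
    hd t ⟨hx.trans_lt ht.1, ht.2.trans_le hy⟩ (h t ht).1 (h t ht).2
  refine monotoneOn_of_deriv_nonneg (convex_Icc x y) (hf.mono hs) ?_ ?_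
    (left_mem_Icc.2 hxy) (right_mem_Icc.2 hxy) hxy
  · rw [interior_Icc]
    exact fun t ht => (key t ht).1.differentiableAt.differentiableWithinAt
  · rw [interior_Icc]
    exact fun t ht => (key t ht).1.deriv ▸ (key t ht).2

theorem norm_sub_le_of_norm_hasDerivAt_le_off_two {E : Type*} [NormedAddCommGroup E]
    [NormedSpace ℝ E] {f f' : ℝ → E} {a b c d M : ℝ} (hab : a ≤ b)
    (hf : ContinuousOn f (Icc a b))
    (hd : ∀ x ∈ Ioo a b, x ≠ c → x ≠ d → HasDerivAt f (f' x) x ∧ ‖f' x‖ ≤ M) :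
    ‖f b - f a‖ ≤ M * (b - a) := by
  refine rel_of_avoid_two (P := fun x y => ‖f y - f x‖ ≤ M * (y - x)) c d ?_ ?_ le_rfl hab le_rfl
  · intro x y z _ _ _ _ h1 h2
    calc ‖f z - f x‖ = ‖(f z - f y) + (f y - f x)‖ := by congr 1; abel
      _ ≤ ‖f z - f y‖ + ‖f y - f x‖ := norm_add_le _ _
      _ ≤ M * (z - y) + M * (y - x) := add_le_add h2 h1
      _ = M * (z - x) := by ring
  · intro x y hx hxy hy h
    have hs : Icc x y ⊆ Icc a b := Icc_subset_Icc hx hy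
    have key : ∀ t ∈ Ioo x y, HasDerivAt f (f' t) t ∧ ‖f' t‖ ≤ M := fun t ht =>
      hd t ⟨hx.trans_lt ht.1, ht.2.trans_le hy⟩ (h t ht).1 (h t ht).2
    rcases hxy.eq_or_lt with rfl | hlt
    · simp
    -- The mean value inequality on a segment needs the derivative at both endpoints, so it is
    -- applied strictly inside and each endpoint is then reached by continuity.
    have inner : ∀ x' ∈ Ioo x y, ‖f y - f x'‖ ≤ M * (y - x') := by
      intro x' hx'
      have hs' : Icc x' y ⊆ Icc a b := (Icc_subset_Icc_left hx'.1.le).trans hs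
      have inner2 : ∀ y' ∈ Ioo x' y, ‖f y' - f x'‖ ≤ M * (y' - x') := by
        intro y' hy'
        refine norm_image_sub_le_of_norm_deriv_le_segment' (f' := f') (C := M)
          (fun t ht => (key t ⟨hx'.1.trans_le ht.1, ht.2.trans_lt hy'.2⟩).1.hasDerivWithinAt)
          (fun t ht => (key t ⟨hx'.1.trans_le ht.1, ht.2.trans hy'.2⟩).2) y' ⟨hy'.1.le, le_rfl⟩
      have hc : ContinuousWithinAt f (Ioo x' y) y :=
        ((hf.mono hs') y ⟨hx'.2.le, le_rfl⟩).mono Ioo_subset_Icc_self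
      have hne : (𝓝[Ioo x' y] y).NeBot := by
        rw [← mem_closure_iff_nhdsWithin_neBot, closure_Ioo hx'.2.ne]; exact ⟨hx'.2.le, le_rfl⟩
      refine le_of_tendsto_of_tendsto ((hc.sub_const (f x')).norm)
        (((continuousWithinAt_id (x := y) (s := Ioo x' y)).sub_const x').const_mul M) ?_
      filter_upwards [self_mem_nhdsWithin] with t ht using inner2 t ht
    have hc : ContinuousWithinAt f (Ioo x y) x :=
      ((hf.mono hs) x ⟨le_rfl, hxy⟩).mono Ioo_subset_Icc_self
    have hne : (𝓝[Ioo x y] x).NeBot := by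
      rw [← mem_closure_iff_nhdsWithin_neBot, closure_Ioo hlt.ne]; exact ⟨le_rfl, hlt.le⟩
    refine le_of_tendsto_of_tendsto ((hc.const_sub (f y)).norm)
      (((continuousWithinAt_id (x := x) (s := Ioo x y)).const_sub y).const_mul M) ?_
    filter_upwards [self_mem_nhdsWithin] with t ht using inner t ht

theorem eq_of_hasDerivAt_zero_off_two {E : Type*} [NormedAddCommGroup E]
    [NormedSpace ℝ E] {f : ℝ → E} {a b c d : ℝ} (hab : a ≤ b)
    (hf : ContinuousOn f (Icc a b))
    (hd : ∀ x ∈ Ioo a b, x ≠ c → x ≠ d → HasDerivAt f 0 x) : f b = f a := by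
  have := norm_sub_le_of_norm_hasDerivAt_le_off_two (M := 0) (f' := fun _ => 0) (c := c) (d := d)
    hab hf (fun x hx h1 h2 => ⟨hd x hx h1 h2, by simp⟩)
  rw [zero_mul, norm_le_zero_iff, sub_eq_zero] at this
  exact this

/-- Grönwall's inequality for functions that are not differentiable at two points. -/
theorem norm_le_of_norm_hasDerivAt_le_mul_off_two {E : Type*} [NormedAddCommGroup E]
    [NormedSpace ℝ E] {f f' : ℝ → E} {a b c d M : ℝ} (hab : a ≤ b)
    (hf : ContinuousOn f (Icc a b))
    (hd : ∀ x ∈ Ioo a b, x ≠ c → x ≠ d → HasDerivAt f (f' x) x ∧ ‖f' x‖ ≤ M * ‖f x‖) :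
    ‖f b‖ ≤ ‖f a‖ * Real.exp (M * (b - a)) := by
  refine rel_of_avoid_two (P := fun x y => ‖f y‖ ≤ ‖f x‖ * Real.exp (M * (y - x))) c d ?_ ?_
    le_rfl hab le_rfl
  · intro x y z _ _ _ _ h1 h2
    calc ‖f z‖ ≤ ‖f y‖ * Real.exp (M * (z - y)) := h2
      _ ≤ (‖f x‖ * Real.exp (M * (y - x))) * Real.exp (M * (z - y)) := by gcongr
      _ = ‖f x‖ * Real.exp (M * (z - x)) := by
        rw [mul_assoc, ← Real.exp_add]; congr 2; ring
  · intro x y hx hxy hy h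
    have hs : Icc x y ⊆ Icc a b := Icc_subset_Icc hx hy
    have key : ∀ t ∈ Ioo x y, HasDerivAt f (f' t) t ∧ ‖f' t‖ ≤ M * ‖f t‖ := fun t ht =>
      hd t ⟨hx.trans_lt ht.1, ht.2.trans_le hy⟩ (h t ht).1 (h t ht).2
    rcases hxy.eq_or_lt with rfl | hlt
    · simp
    have inner : ∀ x' ∈ Ioo x y, ‖f y‖ ≤ ‖f x'‖ * Real.exp (M * (y - x')) := by
      intro x' hx'
      have := norm_le_gronwallBound_of_norm_deriv_right_le (f := f) (f' := f') (K := M) (ε := 0)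
        (a := x') (b := y) (δ := ‖f x'‖) (hf.mono ((Icc_subset_Icc_left hx'.1.le).trans hs))
        (fun t ht => (key t ⟨hx'.1.trans_le ht.1, ht.2⟩).1.hasDerivWithinAt) le_rfl
        (fun t ht => by simpa using (key t ⟨hx'.1.trans_le ht.1, ht.2⟩).2) y ⟨hx'.2.le, le_rfl⟩
      rwa [gronwallBound_ε0] at this
    have hc : ContinuousWithinAt f (Ioo x y) x :=
      ((hf.mono hs) x ⟨le_rfl, hxy⟩).mono Ioo_subset_Icc_self
    have hne : (𝓝[Ioo x y] x).NeBot := by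
      rw [← mem_closure_iff_nhdsWithin_neBot, closure_Ioo hlt.ne]; exact ⟨le_rfl, hlt.le⟩
    have hexp : ContinuousWithinAt (fun t => Real.exp (M * (y - t))) (Ioo x y) x :=
      Continuous.continuousWithinAt (by fun_prop)
    refine le_of_tendsto_of_tendsto tendsto_const_nhds (hc.norm.mul hexp) ?_
    filter_upwards [self_mem_nhdsWithin] with t ht using inner t ht

/-- Grönwall's inequality backwards, for functions that are not differentiable at two points. -/
theorem norm_le_of_norm_hasDerivAt_le_mul_off_two' {E : Type*} [NormedAddCommGroup E]
    [NormedSpace ℝ E] {f f' : ℝ → E} {a b c d M : ℝ} (hab : a ≤ b)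
    (hf : ContinuousOn f (Icc a b))
    (hd : ∀ x ∈ Ioo a b, x ≠ c → x ≠ d → HasDerivAt f (f' x) x ∧ ‖f' x‖ ≤ M * ‖f x‖) :
    ‖f a‖ ≤ ‖f b‖ * Real.exp (M * (b - a)) := by
  have := norm_le_of_norm_hasDerivAt_le_mul_off_two (f := fun t => f (-t)) (f' := fun t => -f' (-t))
    (a := -b) (b := -a) (c := -c) (d := -d) (M := M) (by linarith)
    (hf.comp continuous_neg.continuousOn fun t ht => ⟨by linarith [ht.2], by linarith [ht.1]⟩)
    (fun t ht h1 h2 => by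
      obtain ⟨h3, h4⟩ := hd (-t) ⟨by linarith [ht.2], by linarith [ht.1]⟩
        (fun e => h1 (by linarith)) (fun e => h2 (by linarith))
      refine ⟨?_, by simpa using h4⟩
      have := h3.scomp t (hasDerivAt_neg t)
      simpa [Function.comp_def] using this)
  simp only [neg_neg] at this
  convert this using 3
  ring

/-! ### Linear differential equations -/

section LinearODE

variable {E : Type*} [NormedAddCommGroup E] [NormedSpace ℝ E]

theorem exists_linear_ode_glue {A : ℝ → E →L[ℝ] E} {a b c : ℝ} (hab : a ≤ b) (hbc : b ≤ c)
    {α β : ℝ → E} (hα : ∀ t ∈ Icc a b, HasDerivWithinAt α (A t (α t)) (Icc a b) t)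
    (hβ : ∀ t ∈ Icc b c, HasDerivWithinAt β (A t (β t)) (Icc b c) t) (h : β b = α b) :
    ∃ δ : ℝ → E, δ a = α a ∧ ∀ t ∈ Icc a c, HasDerivWithinAt δ (A t (δ t)) (Icc a c) t := by
  set δ : ℝ → E := fun t => if t ≤ b then α t else β t with hδ
  have e1 : EqOn δ α (Icc a b) := fun t ht => if_pos ht.2
  have e2 : EqOn δ β (Icc b c) := by
    intro t ht
    rcases ht.1.eq_or_lt with rfl | h'
    · simp [hδ, h]
    · exact if_neg (not_le.2 h')
  have d1 : ∀ t ∈ Icc a b, HasDerivWithinAt δ (A t (δ t)) (Icc a b) t := fun t ht => by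
    rw [e1 ht]; exact (hα t ht).congr_of_mem e1 ht
  have d2 : ∀ t ∈ Icc b c, HasDerivWithinAt δ (A t (δ t)) (Icc b c) t := fun t ht => by
    rw [e2 ht]; exact (hβ t ht).congr_of_mem e2 ht
  refine ⟨δ, e1 ⟨le_rfl, hab⟩, fun t ht => ?_⟩
  rw [← Icc_union_Icc_eq_Icc hab hbc]
  rcases lt_trichotomy t b with h' | h' | h'
  · refine (d1 t ⟨ht.1, h'.le⟩).union ?_
    refine hasDerivWithinAt_iff_hasFDerivWithinAt.2 (.of_notMem_closure ?_)
    rw [closure_Icc]; exact fun hh => absurd hh.1 (not_le.2 h')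
  · subst h'
    exact (d1 t ⟨ht.1, le_rfl⟩).union (d2 t ⟨le_rfl, ht.2⟩)
  · refine HasDerivWithinAt.union ?_ (d2 t ⟨h'.le, ht.2⟩)
    refine hasDerivWithinAt_iff_hasFDerivWithinAt.2 (.of_notMem_closure ?_)
    rw [closure_Icc]; exact fun hh => absurd hh.2 (not_le.2 h')

variable [CompleteSpace E]

/-- Picard–Lindelöf on the ball of radius `‖x₀‖` about `x₀`, where the velocity is at most `2 M
‖x₀‖`. By linearity the admissible length `1 / (2 M)` does not depend on `x₀`, so such pieces can be
chained to cover any interval. -/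
theorem exists_linear_ode_of_short {A : ℝ → E →L[ℝ] E} {a b M : ℝ} (hab : a ≤ b)
    (hA : ContinuousOn A (Icc a b)) (hM : ∀ t ∈ Icc a b, ‖A t‖ ≤ M) (hM0 : 0 ≤ M)
    (hs : 2 * M * (b - a) ≤ 1) (x₀ : E) :
    ∃ α : ℝ → E, α a = x₀ ∧ ∀ t ∈ Icc a b, HasDerivWithinAt α (A t (α t)) (Icc a b) t := by
  have h : IsPicardLindelof (fun t x => A t x) (⟨a, left_mem_Icc.2 hab⟩ : Icc a b) x₀
      ‖x₀‖₊ 0 (⟨M, hM0⟩ * (2 * ‖x₀‖₊)) ⟨M, hM0⟩ := by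
    refine ⟨fun t ht => ?_, fun x _ => ?_, fun t ht x hx => ?_, ?_⟩
    · exact ((A t).lipschitz.weaken (hM t ht)).lipschitzOnWith
    · exact hA.clm_apply continuousOn_const
    · have hx' : ‖x‖ ≤ 2 * ‖x₀‖ := by
        have h1 : ‖x - x₀‖ ≤ ‖x₀‖ := by simpa [dist_eq_norm] using hx
        have h2 := norm_add_le (x - x₀) x₀
        rw [sub_add_cancel] at h2
        linarith
      exact ((A t).le_opNorm x).trans (mul_le_mul (hM t ht) hx' (norm_nonneg _) hM0)
    · have : max (b - a) (a - a) = b - a := by simp [hab]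
      change M * (2 * ‖x₀‖) * max (b - a) (a - a) ≤ ‖x₀‖ - 0
      rw [this]
      nlinarith [norm_nonneg x₀]
  exact h.exists_eq_forall_mem_Icc_hasDerivWithinAt₀

/-- Linear differential equations with continuous coefficients have solutions on the whole
interval. -/
theorem exists_linear_ode {A : ℝ → E →L[ℝ] E} {a b : ℝ} (hab : a ≤ b)
    (hA : ContinuousOn A (Icc a b)) (x₀ : E) :
    ∃ α : ℝ → E, α a = x₀ ∧ ∀ t ∈ Icc a b, HasDerivWithinAt α (A t (α t)) (Icc a b) t := by
  obtain ⟨M', hM'⟩ := isCompact_Icc.exists_bound_of_continuousOn hA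
  obtain ⟨M, hM, hM1⟩ : ∃ M, (∀ t ∈ Icc a b, ‖A t‖ ≤ M) ∧ 1 ≤ M :=
    ⟨max M' 1, fun t ht => (hM' t ht).trans (le_max_left _ _), le_max_right _ _⟩
  have step : ∀ n : ℕ, ∀ c ∈ Icc a b, c ≤ a + n * (1 / (2 * M)) →
      ∃ α : ℝ → E, α a = x₀ ∧ ∀ t ∈ Icc a c, HasDerivWithinAt α (A t (α t)) (Icc a c) t := by
    intro n
    induction n with
    | zero =>
      intro c hc hca
      have : c = a := le_antisymm (by simpa using hca) hc.1
      subst this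
      exact exists_linear_ode_of_short le_rfl (hA.mono (Icc_subset_Icc_right hab))
        (fun t ht => hM t ⟨ht.1, ht.2.trans hab⟩) (by linarith) (by simp) x₀
    | succ n ih =>
      intro c hc hcn
      set e := max a (c - 1 / (2 * M)) with he
      have hpos : 0 < 1 / (2 * M) := by positivity
      have hec : e ≤ c := max_le hc.1 (by linarith)
      have hae : a ≤ e := le_max_left _ _
      obtain ⟨α, h1, h2⟩ := ih e ⟨hae, hec.trans hc.2⟩ (max_le (le_add_of_nonneg_right (by positivity)) (by
        push_cast at hcn; linarith))
      obtain ⟨β, h3, h4⟩ := exists_linear_ode_of_short hec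
        (hA.mono (Icc_subset_Icc hae hc.2)) (fun t ht => hM t ⟨hae.trans ht.1, ht.2.trans hc.2⟩)
        (by linarith) (by
          have : c - e ≤ 1 / (2 * M) := by linarith [le_max_right a (c - 1 / (2 * M))]
          calc 2 * M * (c - e) ≤ 2 * M * (1 / (2 * M)) := by gcongr
            _ = 1 := by field_simp) (α e)
      obtain ⟨δ, h5, h6⟩ := exists_linear_ode_glue hae hec h2 h4 h3
      exact ⟨δ, h5.trans h1, h6⟩
  obtain ⟨n, hn⟩ := exists_nat_ge ((b - a) * (2 * M))
  refine step n b ⟨hab, le_rfl⟩ ?_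
  have : b - a ≤ n * (1 / (2 * M)) := by
    rw [mul_one_div, le_div_iff₀ (by positivity)]; exact hn
  linarith

end LinearODE

/-! ### The field equations at a point -/

/-- `v` satisfies at the radius `r` the field equations of harmonic `n` and frequency `ω` in the
material `m`. -/
def SolvesAt (n : ℕ) (ω : ℝ) (m : PlaneMaterial) (v : ℝ → Fin 4 → ℂ) (r : ℝ) : Prop :=
  HasDerivAt v ((1 / r : ℂ) • (systemMatrix n ω m r).mulVec (v r)) r

/-- The conserved bilinear form of two state vectors. -/
def pair (v w : Fin 4 → ℂ) : ℂ := v 0 * w 2 + v 1 * w 3 - v 2 * w 0 - v 3 * w 1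

/-- The work of the tractions of a state vector on its displacements. -/
def work (v : Fin 4 → ℂ) : ℝ :=
  ((starRingEnd ℂ) (v 0) * v 2 + (starRingEnd ℂ) (v 1) * v 3).re

theorem systemMatrix_mulVec (n : ℕ) (ω : ℝ) (m : PlaneMaterial) (r : ℝ) (z : Fin 4 → ℂ) :
    (systemMatrix n ω m r).mulVec z =
      ![(1 - m.γ) * z 0 + n * (m.γ - 1) * z 1 + 1 / m.C11 * z 2,
        -n * z 0 + z 1 + 1 / m.C66 * z 3,
        (m.C - m.ρ * ω ^ 2 * r ^ 2) * z 0 - n * m.C * z 1 + (m.γ - 1) * z 2 + n * z 3,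
        -(n * m.C) * z 0 + (n ^ 2 * m.C - m.ρ * ω ^ 2 * r ^ 2) * z 1 + n * (1 - m.γ) * z 2
          - z 3] := by
  ext i
  fin_cases i <;> simp [systemMatrix, Matrix.mulVec, dotProduct, Fin.sum_univ_four] <;> ring

theorem solvesAt_iff {n : ℕ} {ω : ℝ} {m : PlaneMaterial} {v : ℝ → Fin 4 → ℂ} {r : ℝ} :
    SolvesAt n ω m v r ↔
      HasDerivAt (fun s => v s 0) ((1 / r : ℂ) *
        ((1 - m.γ) * v r 0 + n * (m.γ - 1) * v r 1 + 1 / m.C11 * v r 2)) r ∧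
      HasDerivAt (fun s => v s 1) ((1 / r : ℂ) * (-n * v r 0 + v r 1 + 1 / m.C66 * v r 3)) r ∧
      HasDerivAt (fun s => v s 2) ((1 / r : ℂ) *
        ((m.C - m.ρ * ω ^ 2 * r ^ 2) * v r 0 - n * m.C * v r 1 + (m.γ - 1) * v r 2 + n * v r 3)) r ∧
      HasDerivAt (fun s => v s 3) ((1 / r : ℂ) *
        (-(n * m.C) * v r 0 + (n ^ 2 * m.C - m.ρ * ω ^ 2 * r ^ 2) * v r 1
          + n * (1 - m.γ) * v r 2 - v r 3)) r := by
  rw [SolvesAt, hasDerivAt_pi, systemMatrix_mulVec]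
  simp [Fin.forall_fin_succ]

theorem SolvesAt.add {n : ℕ} {ω : ℝ} {m : PlaneMaterial} {v w : ℝ → Fin 4 → ℂ} {r : ℝ}
    (hv : SolvesAt n ω m v r) (hw : SolvesAt n ω m w r) :
    SolvesAt n ω m (fun s => v s + w s) r := by
  have := HasDerivAt.add hv hw
  rw [← smul_add, ← Matrix.mulVec_add] at this
  exact this

theorem SolvesAt.smul {n : ℕ} {ω : ℝ} {m : PlaneMaterial} {v : ℝ → Fin 4 → ℂ} {r : ℝ}
    (hv : SolvesAt n ω m v r) (a : ℂ) : SolvesAt n ω m (fun s => a • v s) r := by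
  have := HasDerivAt.const_smul a hv
  rw [smul_comm, ← Matrix.mulVec_smul] at this
  exact this

/-- The system matrix is real. Conjugation lets the bilinear form `pair` express Hermitian energies.
-/
theorem SolvesAt.conj {n : ℕ} {ω : ℝ} {m : PlaneMaterial} {v : ℝ → Fin 4 → ℂ} {r : ℝ}
    (hv : SolvesAt n ω m v r) : SolvesAt n ω m (fun s => star (v s)) r := by
  rw [solvesAt_iff] at *
  obtain ⟨h0, h1, h2, h3⟩ := hv
  refine ⟨?_, ?_, ?_, ?_⟩
  · exact HasDerivAt.congr_deriv h0.star (by simp)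
  · exact HasDerivAt.congr_deriv h1.star (by simp)
  · exact HasDerivAt.congr_deriv h2.star (by simp)
  · exact HasDerivAt.congr_deriv h3.star (by simp)

theorem pair_add_right (v w z : Fin 4 → ℂ) : pair v (w + z) = pair v w + pair v z := by
  simp [pair]; ring
theorem pair_add_left (v w z : Fin 4 → ℂ) : pair (v + w) z = pair v z + pair w z := by
  simp [pair]; ring
theorem pair_smul_right (a : ℂ) (v w : Fin 4 → ℂ) : pair v (a • w) = a * pair v w := by
  simp [pair]; ring
theorem pair_smul_left (a : ℂ) (v w : Fin 4 → ℂ) : pair (a • v) w = a * pair v w := by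
  simp [pair]; ring
theorem pair_sub_right (v w z : Fin 4 → ℂ) : pair v (w - z) = pair v w - pair v z := by
  simp [pair]; ring

theorem norm_pair_le (v w : Fin 4 → ℂ) : ‖pair v w‖ ≤ 4 * (‖v‖ * ‖w‖) := by
  have h : ∀ i j, ‖v i * w j‖ ≤ ‖v‖ * ‖w‖ := fun i j => by
    rw [norm_mul]
    exact mul_le_mul (norm_le_pi_norm v i) (norm_le_pi_norm w j) (norm_nonneg _) (norm_nonneg _)
  unfold pair
  calc _ ≤ ‖v 0 * w 2‖ + ‖v 1 * w 3‖ + ‖v 2 * w 0‖ + ‖v 3 * w 1‖ :=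
        (norm_sub_le _ _).trans (add_le_add_left ((norm_sub_le _ _).trans
          (add_le_add_left (norm_add_le _ _) _)) _)
    _ ≤ _ := by linarith [h 0 2, h 1 3, h 2 0, h 3 1]

theorem continuousOn_pair {v w : ℝ → Fin 4 → ℂ} {s : Set ℝ} (hv : ContinuousOn v s)
    (hw : ContinuousOn w s) : ContinuousOn (fun r => pair (v r) (w r)) s := by
  have h1 := continuousOn_pi.1 hv
  have h2 := continuousOn_pi.1 hw
  unfold pair
  exact ((((h1 0).mul (h2 2)).add ((h1 1).mul (h2 3))).sub ((h1 2).mul (h2 0))).sub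
    ((h1 3).mul (h2 1))

theorem continuous_work : Continuous work := by
  unfold work
  have : Continuous (starRingEnd ℂ) := Complex.continuous_conj
  fun_prop

/-- Reciprocity: for fields of frequencies `0` and `ω` the bilinear form changes only through the
inertia. -/
theorem SolvesAt.hasDerivAt_pair {n : ℕ} {ω : ℝ} {m : PlaneMaterial} {p v : ℝ → Fin 4 → ℂ} {r : ℝ}
    (hr : r ≠ 0) (hp : SolvesAt n 0 m p r) (hv : SolvesAt n ω m v r) :
    HasDerivAt (fun s => pair (p s) (v s))
      (-(m.ρ * ω ^ 2 * r : ℝ) * (p r 0 * v r 0 + p r 1 * v r 1)) r := by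
  rw [solvesAt_iff] at hp hv
  obtain ⟨p0, p1, p2, p3⟩ := hp
  obtain ⟨v0, v1, v2, v3⟩ := hv
  have hr' : (r : ℂ) ≠ 0 := by exact_mod_cast hr
  unfold pair
  refine ((((p0.mul v2).add (p1.mul v3)).sub (p2.mul v0)).sub (p3.mul v1)).congr_deriv ?_
  push_cast
  field_simp
  ring

theorem SolvesAt.hasDerivAt_pair_static {n : ℕ} {m : PlaneMaterial} {p v : ℝ → Fin 4 → ℂ} {r : ℝ}
    (hr : r ≠ 0) (hp : SolvesAt n 0 m p r) (hv : SolvesAt n 0 m v r) :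
    HasDerivAt (fun s => pair (p s) (v s)) 0 r := by
  refine (hp.hasDerivAt_pair hr hv).congr_deriv ?_
  simp

/-- Twice the strain energy density, times `r ^ 2`, in terms of the state vector. -/
noncomputable def energyForm (n : ℕ) (m : PlaneMaterial) (z : Fin 4 → ℂ) : ℝ :=
  ‖z 2‖ ^ 2 / m.C11 + ‖z 3‖ ^ 2 / m.C66 + m.C * ‖z 0 - n * z 1‖ ^ 2

theorem PlaneMaterial.Positive.C_pos {m : PlaneMaterial} (hm : m.Positive) : 0 < m.C := by
  obtain ⟨h1, _, h3, _⟩ := hm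
  unfold PlaneMaterial.C
  rw [sub_pos, div_lt_iff₀ h1]
  linarith

theorem energyForm_nonneg {n : ℕ} {m : PlaneMaterial} (hm : m.Positive) (z : Fin 4 → ℂ) :
    0 ≤ energyForm n m z := by
  have := hm.C_pos
  obtain ⟨h1, h2, _, _⟩ := hm
  unfold energyForm
  positivity

/-- Energy balance: the cross terms in `γ` and `n` cancel in the real part and only a positive form
in the tractions and the hoop strain remains. The resulting monotonicity of the work is behind the
injectivity of the static problem. -/
theorem SolvesAt.hasDerivAt_work {n : ℕ} {m : PlaneMaterial} {v : ℝ → Fin 4 → ℂ} {r : ℝ}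
    (hr : r ≠ 0) (hv : SolvesAt n 0 m v r) :
    HasDerivAt (fun s => work (v s)) (energyForm n m (v r) / r) r := by
  have hc := hv.conj
  rw [solvesAt_iff] at hv hc
  obtain ⟨c0, c1, -, -⟩ := hc
  obtain ⟨-, -, v2, v3⟩ := hv
  have h := Complex.reCLM.hasFDerivAt.comp_hasDerivAt r ((c0.mul v2).add (c1.mul v3))
  refine HasDerivAt.congr_deriv (f' := _) h ?_
  have hr' : (r : ℂ) ≠ 0 := by exact_mod_cast hr
  have key : ((energyForm n m (v r) / r : ℝ) : ℂ) = ((1 / r : ℂ) *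
      ((starRingEnd ℂ) (v r 2) * v r 2 / m.C11 + (starRingEnd ℂ) (v r 3) * v r 3 / m.C66 + m.C *
        ((starRingEnd ℂ) (v r 0 - n * v r 1) * (v r 0 - n * v r 1)))) := by
    simp only [Complex.conj_mul', energyForm]
    push_cast
    ring
  rw [← Complex.ofReal_re (energyForm n m (v r) / r), key, Complex.reCLM_apply]
  congr 1
  simp
  field_simp
  ring

/-- Expressing `ε_rr` through `σ_rr` completes the square: the `C12` cross term disappears and `C22`
is reduced to `C`. -/
theorem SolvesAt.strainEnergyDensity_mul {n : ℕ} {m : PlaneMaterial} {v : ℝ → Fin 4 → ℂ} {r : ℝ}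
    (hr : r ≠ 0) (hm : m.Positive) (hv : SolvesAt n 0 m v r) :
    strainEnergyDensity n m v r * r = energyForm n m (v r) / r / 2 := by
  rw [solvesAt_iff] at hv
  obtain ⟨v0, v1, -, -⟩ := hv
  have hr' : (r : ℂ) ≠ 0 := by exact_mod_cast hr
  have h11 : m.C11 ≠ 0 := hm.1.ne'
  have h66 : m.C66 ≠ 0 := hm.2.1.ne'
  have h11' : (m.C11 : ℂ) ≠ 0 := by exact_mod_cast h11
  have h66' : (m.C66 : ℂ) ≠ 0 := by exact_mod_cast h66
  unfold strainEnergyDensity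
  simp only [v0.deriv, v1.deriv]
  set s : ℂ := v r 0 - n * v r 1 with hs
  have e1 : (1 / r : ℂ) * ((1 - m.γ) * v r 0 + n * (m.γ - 1) * v r 1 + 1 / m.C11 * v r 2)
      = ((1 / (r * m.C11) : ℝ) : ℂ) * (v r 2 - m.C12 * s) := by
    simp only [PlaneMaterial.γ, hs]
    push_cast
    field_simp
    ring
  have e2 : (1 / r : ℂ) * (-n * v r 0 + v r 1 + 1 / m.C66 * v r 3) - v r 1 / r + n * v r 0 / r
      = ((1 / (r * m.C66) : ℝ) : ℂ) * v r 3 := by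
    push_cast
    field_simp
    ring
  have e3 : s / r = ((1 / r : ℝ) : ℂ) * s := by push_cast; ring
  rw [e1, e2, e3]
  simp only [energyForm, ← hs, PlaneMaterial.C, ← Complex.normSq_eq_norm_sq, Complex.normSq_apply]
  simp
  field_simp
  ring

/-- The strain energy of a static field is half the work of the boundary tractions. -/
theorem strainEnergy_eq {n : ℕ} {mat : ℝ → PlaneMaterial} {v : ℝ → Fin 4 → ℂ} {R c d : ℝ}
    (hR : 0 < R) (hv : ContinuousOn v (Ioc 0 R))
    (hd : ∀ r ∈ Ioo 0 R, r ≠ c → r ≠ d → (mat r).Positive ∧ SolvesAt n 0 (mat r) v r)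
    (h0 : Tendsto (fun r => work (v r)) (𝓝[>] 0) (𝓝 0)) :
    strainEnergy n mat R v = Real.pi * work (v R) := by
  set F : ℝ → ℝ := fun r => if r ≤ 0 then 0 else work (v r) with hF
  have hFe : ∀ r, 0 < r → F r = work (v r) := fun r hr => if_neg (not_le.2 hr)
  have hFc : ContinuousOn F (Icc 0 R) := by
    intro r hr
    rcases hr.1.eq_or_lt with rfl | h
    · have : ContinuousWithinAt F (Ioi 0) 0 := by
        have e : F 0 = 0 := if_pos le_rfl
        rw [ContinuousWithinAt, e]
        refine h0.congr' ?_
        filter_upwards [self_mem_nhdsWithin] with r hr using (hFe r hr).symm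
      exact (continuousWithinAt_Ioi_iff_Ici.1 this).mono Icc_subset_Ici_self
    · have h1 : ContinuousWithinAt (fun r => work (v r)) (Ioc 0 R) r :=
        continuous_work.continuousAt.comp_continuousWithinAt (hv r ⟨h, hr.2⟩)
      have h2 : ContinuousWithinAt F (Ioc 0 R) r :=
        h1.congr (fun s hs => hFe s hs.1) (hFe r h)
      refine h2.mono_of_mem_nhdsWithin ?_
      filter_upwards [self_mem_nhdsWithin, mem_nhdsWithin_of_mem_nhds (Ioi_mem_nhds h)] with s hs hs'
      exact ⟨hs', hs.2⟩
  have hFd : ∀ r ∈ Ioo 0 R, r ≠ c → r ≠ d →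
      HasDerivAt F (energyForm n (mat r) (v r) / r) r ∧ 0 ≤ energyForm n (mat r) (v r) / r := by
    intro r hr h1 h2
    obtain ⟨hm, hs⟩ := hd r hr h1 h2
    refine ⟨(hs.hasDerivAt_work hr.1.ne').congr_of_eventuallyEq ?_,
      div_nonneg (energyForm_nonneg hm _) hr.1.le⟩
    filter_upwards [Ioi_mem_nhds hr.1] with s hs using hFe s hs
  have hmono := monotoneOn_of_hasDerivAt_nonneg_off_two hFc hFd
  rw [← uIcc_of_le hR.le] at hmono
  -- The derivative of a monotone function is integrable, so no bound on the energy density near the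
  -- axis or the interfaces is required.
  have hint := hmono.intervalIntegrable_deriv
  have hcount : ({c, d} : Set ℝ).Countable := (Set.toFinite _).countable
  have hftc := MeasureTheory.integral_eq_of_hasDerivAt_off_countable_of_le F (deriv F) hR.le hcount
    hFc (fun r hr => by
      have h1 : r ≠ c := fun e => hr.2 (by simp [e])
      have h2 : r ≠ d := fun e => hr.2 (by simp [e])
      exact (hFd r hr.1 h1 h2).1.differentiableAt.hasDerivAt) hint
  have heq : ∫ r in (0 : ℝ)..R, strainEnergyDensity n (mat r) v r * r
      = ∫ r in (0 : ℝ)..R, deriv F r / 2 := by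
    refine intervalIntegral.integral_congr_ae ?_
    have hae : ∀ᵐ r : ℝ, r ∉ ({c, d, R} : Set ℝ) :=
      MeasureTheory.compl_mem_ae_iff.2 ((Set.toFinite _).measure_zero _)
    filter_upwards [hae] with r hr hrI
    rw [uIoc_of_le hR.le] at hrI
    simp only [mem_insert_iff, mem_singleton_iff, not_or] at hr
    have hrI' : r ∈ Ioo 0 R := ⟨hrI.1, lt_of_le_of_ne hrI.2 hr.2.2⟩
    obtain ⟨hm, hs⟩ := hd r hrI' hr.1 hr.2.1
    rw [(hFd r hrI' hr.1 hr.2.1).1.deriv, hs.strainEnergyDensity_mul hrI.1.ne' hm]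
  rw [strainEnergy, heq, intervalIntegral.integral_div, hftc, hFe R hR, hF]
  simp
  ring

/-! ### Isotropic materials: static fields of harmonic `2` -/

/-- For `ω = 0` and constant moduli the system is of Euler type, so eigenvectors give power
solutions. -/
theorem solvesAt_zpow {n : ℕ} {m : PlaneMaterial} {e : Fin 4 → ℂ} (k : ℤ) {r : ℝ} (hr : r ≠ 0)
    (he : (systemMatrix n 0 m r).mulVec e = (k : ℂ) • e) :
    SolvesAt n 0 m (fun s => (s : ℂ) ^ k • e) r := by
  have hr' : (r : ℂ) ≠ 0 := by exact_mod_cast hr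
  have h := ((hasDerivAt_zpow k (r : ℂ) (Or.inl hr')).comp_ofReal).smul_const e
  refine HasDerivAt.congr_deriv h ?_
  rw [Matrix.mulVec_smul, he, smul_smul, smul_smul, zpow_sub_one₀ hr']
  congr 1
  field_simp

theorem continuousOn_zpow_smul (k : ℤ) (e : Fin 4 → ℂ) :
    ContinuousOn (fun s : ℝ => (s : ℂ) ^ k • e) (Ioi 0) := by
  refine ContinuousOn.smul (ContinuousOn.zpow₀ Complex.continuous_ofReal.continuousOn k fun s hs => Or.inl ?_)
    continuousOn_const
  exact_mod_cast (ne_of_gt hs)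

theorem norm_zpow_smul {r : ℝ} (hr : 0 < r) (k : ℤ) (e : Fin 4 → ℂ) :
    ‖(r : ℂ) ^ k • e‖ = r ^ k * ‖e‖ := by
  rw [norm_smul, norm_zpow, Complex.norm_real, Real.norm_of_nonneg hr.le]

section IsoVectors

variable (K μ : ℝ)

/-- Uniform shear. -/
noncomputable def vecOne : Fin 4 → ℂ := ![1, 1, 2 * (μ : ℂ), 2 * (μ : ℂ)]

/-- The vector of the isotropic static solution that grows like `r ^ 3`. -/
noncomputable def vecThree : Fin 4 → ℂ := ![(K : ℂ) - μ, 2 * (K : ℂ) + μ, 0, 6 * (K : ℂ) * μ]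

/-- The vector of the isotropic static solution that decays like `r⁻¹`. -/
noncomputable def vecNegOne : Fin 4 → ℂ :=
  ![1 / (2 * (μ : ℂ)), 1 / (2 * ((K : ℂ) + μ)), -(2 * (K : ℂ) / (K + μ)), (K : ℂ) / (K + μ)]

/-- The vector of the isotropic static solution that decays like `r⁻³`. -/
noncomputable def vecNegThree : Fin 4 → ℂ :=
  ![1 / (12 * (μ : ℂ)), -1 / (12 * (μ : ℂ)), -1 / 2, 1 / 2]

variable {K μ}

theorem isotropic_positive {ρ : ℝ} (hK : 0 < K) (hμ : 0 < μ) (hρ : 0 < ρ) :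
    (PlaneMaterial.isotropic K μ ρ).Positive := by
  refine ⟨?_, hμ, ?_, hρ⟩
  · change 0 < K + μ; positivity
  · change (K - μ) ^ 2 < (K + μ) * (K + μ); nlinarith [mul_pos hK hμ]

theorem systemMatrix_isotropic (hK : 0 < K) (hμ : 0 < μ) (n : ℕ) (ρ r : ℝ) (z : Fin 4 → ℂ) :
    (systemMatrix n 0 (.isotropic K μ ρ) r).mulVec z =
      ![(-(((K : ℂ) - μ) * (z 0 - n * z 1)) + z 2) / (K + μ), -n * z 0 + z 1 + z 3 / μ,
        (4 * K * μ * (z 0 - n * z 1) + ((K : ℂ) - μ) * z 2) / (K + μ) + n * z 3,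
        (-(4 * n * K * μ * (z 0 - n * z 1)) - n * (((K : ℂ) - μ) * z 2)) / (K + μ) - z 3] := by
  have h1 : (K + μ : ℂ) ≠ 0 := by exact_mod_cast (add_pos hK hμ).ne'
  have h2 : (μ : ℂ) ≠ 0 := by exact_mod_cast hμ.ne'
  rw [systemMatrix_mulVec]
  ext i
  fin_cases i <;> simp [PlaneMaterial.isotropic, PlaneMaterial.γ, PlaneMaterial.C] <;> field_simp <;>
    ring

theorem mulVec_vecOne (hK : 0 < K) (hμ : 0 < μ) (ρ r : ℝ) :
    (systemMatrix 2 0 (.isotropic K μ ρ) r).mulVec (vecOne μ) = ((1 : ℤ) : ℂ) • vecOne μ := by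
  have h1 : (K + μ : ℂ) ≠ 0 := by exact_mod_cast (add_pos hK hμ).ne'
  have h2 : (μ : ℂ) ≠ 0 := by exact_mod_cast hμ.ne'
  rw [systemMatrix_isotropic hK hμ]
  ext i
  fin_cases i <;> simp [vecOne] <;> field_simp <;> ring

theorem mulVec_vecThree (hK : 0 < K) (hμ : 0 < μ) (ρ r : ℝ) :
    (systemMatrix 2 0 (.isotropic K μ ρ) r).mulVec (vecThree K μ) =
      ((3 : ℤ) : ℂ) • vecThree K μ := by
  have h1 : (K + μ : ℂ) ≠ 0 := by exact_mod_cast (add_pos hK hμ).ne'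
  have h2 : (μ : ℂ) ≠ 0 := by exact_mod_cast hμ.ne'
  rw [systemMatrix_isotropic hK hμ]
  ext i
  fin_cases i <;> simp [vecThree] <;> field_simp <;> ring

theorem mulVec_vecNegOne (hK : 0 < K) (hμ : 0 < μ) (ρ r : ℝ) :
    (systemMatrix 2 0 (.isotropic K μ ρ) r).mulVec (vecNegOne K μ) =
      ((-1 : ℤ) : ℂ) • vecNegOne K μ := by
  have h1 : (K + μ : ℂ) ≠ 0 := by exact_mod_cast (add_pos hK hμ).ne'
  have h2 : (μ : ℂ) ≠ 0 := by exact_mod_cast hμ.ne'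
  rw [systemMatrix_isotropic hK hμ]
  ext i
  fin_cases i <;> simp [vecNegOne] <;> field_simp <;> ring_nf <;> simp

theorem mulVec_vecNegThree (hK : 0 < K) (hμ : 0 < μ) (ρ r : ℝ) :
    (systemMatrix 2 0 (.isotropic K μ ρ) r).mulVec (vecNegThree μ) =
      ((-3 : ℤ) : ℂ) • vecNegThree μ := by
  have h1 : (K + μ : ℂ) ≠ 0 := by exact_mod_cast (add_pos hK hμ).ne'
  have h2 : (μ : ℂ) ≠ 0 := by exact_mod_cast hμ.ne'
  rw [systemMatrix_isotropic hK hμ]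
  ext i
  fin_cases i <;> simp [vecNegThree] <;> field_simp <;> ring

/-- The eigenvectors for `k` and `-k` are dual under `pair` and all other pairs are orthogonal; the
normalizations are `-2` for `±1` and `K + μ` for `±3`. -/
theorem eq_sum_pair_smul (hK : 0 < K) (hμ : 0 < μ) (z : Fin 4 → ℂ) :
    z = (pair (vecNegOne K μ) z / 2) • vecOne μ
      + (-pair (vecNegThree μ) z / (K + μ)) • vecThree K μ
      + (-pair (vecOne μ) z / 2) • vecNegOne K μ
      + (pair (vecThree K μ) z / (K + μ)) • vecNegThree μ := by
  have h1 : (K + μ : ℂ) ≠ 0 := by exact_mod_cast (add_pos hK hμ).ne'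
  have h2 : (μ : ℂ) ≠ 0 := by exact_mod_cast hμ.ne'
  ext i
  fin_cases i <;> simp [vecOne, vecThree, vecNegOne, vecNegThree, pair] <;> field_simp <;> ring

theorem pair_vecOne_vecThree : pair (vecOne μ) (vecThree K μ) = 0 := by
  simp [vecOne, vecThree, pair]; ring

theorem pair_self (v : Fin 4 → ℂ) : pair v v = 0 := by simp [pair]; ring

theorem pair_swap (v w : Fin 4 → ℂ) : pair v w = -pair w v := by simp [pair]; ring

theorem pair_vecOne_vecNegOne (hK : 0 < K) (hμ : 0 < μ) :
    pair (vecOne μ) (vecNegOne K μ) = -2 := by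
  have h1 : (K + μ : ℂ) ≠ 0 := by exact_mod_cast (add_pos hK hμ).ne'
  have h2 : (μ : ℂ) ≠ 0 := by exact_mod_cast hμ.ne'
  simp [vecOne, vecNegOne, pair]; field_simp; ring

theorem pair_vecOne_vecNegThree (hμ : 0 < μ) : pair (vecOne μ) (vecNegThree μ) = 0 := by
  have h2 : (μ : ℂ) ≠ 0 := by exact_mod_cast hμ.ne'
  simp [vecOne, vecNegThree, pair]; field_simp; ring

theorem pair_vecThree_vecNegOne (hK : 0 < K) (hμ : 0 < μ) :
    pair (vecThree K μ) (vecNegOne K μ) = 0 := by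
  have h1 : (K + μ : ℂ) ≠ 0 := by exact_mod_cast (add_pos hK hμ).ne'
  have h2 : (μ : ℂ) ≠ 0 := by exact_mod_cast hμ.ne'
  simp [vecThree, vecNegOne, pair]; field_simp; ring

theorem pair_vecThree_vecNegThree (hμ : 0 < μ) :
    pair (vecThree K μ) (vecNegThree μ) = K + μ := by
  have h2 : (μ : ℂ) ≠ 0 := by exact_mod_cast hμ.ne'
  simp [vecThree, vecNegThree, pair]; field_simp; ring

theorem pair_vecNegOne_vecNegThree (hK : 0 < K) (hμ : 0 < μ) :
    pair (vecNegOne K μ) (vecNegThree μ) = 0 := by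
  have h1 : (K + μ : ℂ) ≠ 0 := by exact_mod_cast (add_pos hK hμ).ne'
  have h2 : (μ : ℂ) ≠ 0 := by exact_mod_cast hμ.ne'
  simp [vecNegOne, vecNegThree, pair]; field_simp; ring

/-- The static field of harmonic `2` in an isotropic material with given coefficients. -/
noncomputable def isoField (K μ : ℝ) (a : Fin 4 → ℂ) (r : ℝ) : Fin 4 → ℂ :=
  a 0 • ((r : ℂ) ^ (1 : ℤ) • vecOne μ) + a 1 • ((r : ℂ) ^ (3 : ℤ) • vecThree K μ)
    + a 2 • ((r : ℂ) ^ (-1 : ℤ) • vecNegOne K μ) + a 3 • ((r : ℂ) ^ (-3 : ℤ) • vecNegThree μ)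

theorem solvesAt_isoField (hK : 0 < K) (hμ : 0 < μ) (ρ : ℝ) (a : Fin 4 → ℂ) {r : ℝ} (hr : r ≠ 0) :
    SolvesAt 2 0 (.isotropic K μ ρ) (isoField K μ a) r := by
  have h1 := (solvesAt_zpow 1 hr (mulVec_vecOne hK hμ ρ r)).smul (a 0)
  have h2 := (solvesAt_zpow 3 hr (mulVec_vecThree hK hμ ρ r)).smul (a 1)
  have h3 := (solvesAt_zpow (-1) hr (mulVec_vecNegOne hK hμ ρ r)).smul (a 2)
  have h4 := (solvesAt_zpow (-3) hr (mulVec_vecNegThree hK hμ ρ r)).smul (a 3)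
  have h := ((h1.add h2).add h3).add h4
  unfold isoField
  exact h

theorem continuousOn_isoField (K μ : ℝ) (a : Fin 4 → ℂ) :
    ContinuousOn (isoField K μ a) (Ioi 0) := by
  have h1 := (continuousOn_zpow_smul 1 (vecOne μ)).const_smul (a 0)
  have h2 := (continuousOn_zpow_smul 3 (vecThree K μ)).const_smul (a 1)
  have h3 := (continuousOn_zpow_smul (-1) (vecNegOne K μ)).const_smul (a 2)
  have h4 := (continuousOn_zpow_smul (-3) (vecNegThree μ)).const_smul (a 3)
  have h := ((h1.add h2).add h3).add h4
  unfold isoField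
  exact h

theorem isoField_add (a b : Fin 4 → ℂ) (r : ℝ) :
    isoField K μ (a + b) r = isoField K μ a r + isoField K μ b r := by
  simp only [isoField, Pi.add_apply, add_smul]; abel

theorem isoField_smul (t : ℂ) (a : Fin 4 → ℂ) (r : ℝ) :
    isoField K μ (t • a) r = t • isoField K μ a r := by
  simp only [isoField, Pi.smul_apply, smul_add, smul_smul, smul_eq_mul, mul_assoc]

/-- Only opposite exponents pair nontrivially, so all powers of `r` cancel. In coefficients `pair`
is a fixed nondegenerate symplectic form. -/
theorem pair_isoField (hK : 0 < K) (hμ : 0 < μ) (a b : Fin 4 → ℂ) {r : ℝ} (hr : r ≠ 0) :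
    pair (isoField K μ a r) (isoField K μ b r) =
      -2 * (a 0 * b 2 - a 2 * b 0) + (K + μ) * (a 1 * b 3 - a 3 * b 1) := by
  have hr' : (r : ℂ) ≠ 0 := by exact_mod_cast hr
  simp only [isoField, pair_add_left, pair_add_right, pair_smul_left, pair_smul_right, pair_self,
    pair_swap (vecThree K μ) (vecOne μ), pair_swap (vecNegOne K μ) (vecOne μ),
    pair_swap (vecNegThree μ) (vecOne μ), pair_swap (vecNegOne K μ) (vecThree K μ),
    pair_swap (vecNegThree μ) (vecThree K μ), pair_swap (vecNegThree μ) (vecNegOne K μ),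
    pair_vecOne_vecThree, pair_vecOne_vecNegOne hK hμ, pair_vecOne_vecNegThree hμ,
    pair_vecThree_vecNegOne hK hμ, pair_vecThree_vecNegThree hμ, pair_vecNegOne_vecNegThree hK hμ]
  simp only [zpow_neg, zpow_ofNat]
  field_simp
  ring

/-- The coefficients of a state vector in the isotropic static fields. -/
noncomputable def isoCoeff (K μ r : ℝ) (z : Fin 4 → ℂ) : Fin 4 → ℂ :=
  ![pair ((r : ℂ) ^ (-1 : ℤ) • vecNegOne K μ) z / 2,
    -pair ((r : ℂ) ^ (-3 : ℤ) • vecNegThree μ) z / (K + μ),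
    -pair ((r : ℂ) ^ (1 : ℤ) • vecOne μ) z / 2,
    pair ((r : ℂ) ^ (3 : ℤ) • vecThree K μ) z / (K + μ)]

theorem isoField_isoCoeff (hK : 0 < K) (hμ : 0 < μ) {r : ℝ} (hr : r ≠ 0) (z : Fin 4 → ℂ) :
    isoField K μ (isoCoeff K μ r z) r = z := by
  have hr' : (r : ℂ) ≠ 0 := by exact_mod_cast hr
  conv_rhs => rw [eq_sum_pair_smul hK hμ z]
  simp only [isoField, isoCoeff, pair_smul_left, smul_smul, zpow_neg]
  simp
  congr 1
  · congr 1
    · congr 1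
      · congr 1; field_simp
      · congr 1; field_simp
    · congr 1; field_simp
  · congr 1; field_simp

theorem isoField_injective (hK : 0 < K) (hμ : 0 < μ) {r : ℝ} (hr : r ≠ 0) {a b : Fin 4 → ℂ}
    (h : isoField K μ a r = isoField K μ b r) : a = b := by
  have h1 : (K + μ : ℂ) ≠ 0 := by exact_mod_cast (add_pos hK hμ).ne'
  have key : ∀ x : Fin 4 → ℂ, -2 * (x 0 * a 2 - x 2 * a 0) + (K + μ) * (x 1 * a 3 - x 3 * a 1) =
      -2 * (x 0 * b 2 - x 2 * b 0) + (K + μ) * (x 1 * b 3 - x 3 * b 1) := fun x => by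
    rw [← pair_isoField hK hμ x a hr, ← pair_isoField hK hμ x b hr, h]
  -- Nondegeneracy: pairing with each unit coefficient vector isolates the coefficient of the
  -- opposite exponent.
  have k0 := key ![1, 0, 0, 0]
  have k1 := key ![0, 1, 0, 0]
  have k2 := key ![0, 0, 1, 0]
  have k3 := key ![0, 0, 0, 1]
  simp at k0 k1 k2 k3
  ext i
  fin_cases i
  · exact k2
  · exact k3.resolve_right h1
  · exact k0
  · exact k1.resolve_right h1

end IsoVectors

theorem pair_eq_of_solvesAt {n : ℕ} {mat : ℝ → PlaneMaterial} {p v : ℝ → Fin 4 → ℂ} {a b c d : ℝ}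
    (ha : 0 < a) (hab : a ≤ b) (hp : ContinuousOn p (Icc a b)) (hv : ContinuousOn v (Icc a b))
    (hd : ∀ r ∈ Ioo a b, r ≠ c → r ≠ d → SolvesAt n 0 (mat r) p r ∧ SolvesAt n 0 (mat r) v r) :
    pair (p b) (v b) = pair (p a) (v a) :=
  eq_of_hasDerivAt_zero_off_two hab (continuousOn_pair hp hv)
    fun r hr h1 h2 => (hd r hr h1 h2).1.hasDerivAt_pair_static (ha.trans hr.1).ne'
      (hd r hr h1 h2).2

/-- Each coefficient is, up to a constant, the pairing with an explicit power solution, hence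
conserved. Static fields in an isotropic annulus are thus classified without a uniqueness theorem.
-/
theorem isoCoeff_eq_of_solvesAt {K μ ρ : ℝ} (hK : 0 < K) (hμ : 0 < μ) {v : ℝ → Fin 4 → ℂ} {a b : ℝ}
    (ha : 0 < a) (hab : a ≤ b) (hv : ContinuousOn v (Icc a b))
    (hd : ∀ r ∈ Ioo a b, SolvesAt 2 0 (.isotropic K μ ρ) v r) :
    isoCoeff K μ b (v b) = isoCoeff K μ a (v a) := by
  have hsub : Icc a b ⊆ Ioi 0 := fun r hr => ha.trans_le hr.1
  have key : ∀ (k : ℤ) (e : Fin 4 → ℂ), (∀ r : ℝ, (systemMatrix 2 0 (.isotropic K μ ρ) r).mulVec e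
      = (k : ℂ) • e) → pair ((b : ℂ) ^ k • e) (v b) = pair ((a : ℂ) ^ k • e) (v a) :=
    fun k e he => pair_eq_of_solvesAt (p := fun s : ℝ => (s : ℂ) ^ k • e) (v := v)
      (mat := fun _ => .isotropic K μ ρ) (c := 0) (d := 0) ha hab
      ((continuousOn_zpow_smul k e).mono hsub) hv
      fun r hr _ _ => ⟨solvesAt_zpow k (ha.trans hr.1).ne' (he r), hd r hr⟩
  have h1 := key 1 (vecOne μ) (mulVec_vecOne hK hμ ρ)
  have h2 := key 3 (vecThree K μ) (mulVec_vecThree hK hμ ρ)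
  have h3 := key (-1) (vecNegOne K μ) (mulVec_vecNegOne hK hμ ρ)
  have h4 := key (-3) (vecNegThree μ) (mulVec_vecNegThree hK hμ ρ)
  unfold isoCoeff
  rw [h1, h2, h3, h4]

theorem tendsto_isoField_zero (K μ : ℝ) (x y : ℂ) :
    Tendsto (isoField K μ ![x, y, 0, 0]) (𝓝[>] 0) (𝓝 0) := by
  have h : Continuous fun r : ℝ =>
      x • (((r : ℂ) ^ (1 : ℕ)) • vecOne μ) + y • (((r : ℂ) ^ (3 : ℕ)) • vecThree K μ) := by fun_prop
  have h0 := (h.tendsto 0).mono_left (nhdsWithin_le_nhds (s := Ioi 0))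
  simp only [Complex.ofReal_zero] at h0
  refine (h0.congr fun r => ?_).trans_eq (by simp)
  simp [isoField]

/-! ### Materials with continuous properties -/

/-- A material that is positive and continuous on `s`. -/
structure PlaneMaterial.RegularOn (m : ℝ → PlaneMaterial) (s : Set ℝ) : Prop where
  pos : ∀ r ∈ s, (m r).Positive
  C11 : ContinuousOn (fun r => (m r).C11) s
  C22 : ContinuousOn (fun r => (m r).C22) s
  C12 : ContinuousOn (fun r => (m r).C12) s
  C66 : ContinuousOn (fun r => (m r).C66) s
  ρ : ContinuousOn (fun r => (m r).ρ) s

theorem CoreShell.regularOn_shell (c : CoreShell) :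
    PlaneMaterial.RegularOn c.shell (Icc c.r0 c.r1) :=
  ⟨c.shell_pos, c.shell_C11, c.shell_C22, c.shell_C12, c.shell_C66, c.shell_ρ⟩

theorem CoreShell.ext_positive (c : CoreShell) : c.ext.Positive :=
  isotropic_positive c.Ke_pos c.μe_pos c.ρe_pos

theorem PlaneMaterial.Positive.regularOn {m : PlaneMaterial} (hm : m.Positive) (s : Set ℝ) :
    PlaneMaterial.RegularOn (fun _ => m) s :=
  ⟨fun _ _ => hm, continuousOn_const, continuousOn_const, continuousOn_const, continuousOn_const,
    continuousOn_const⟩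

/-- The right-hand side of the field equations as an operator on state vectors. -/
noncomputable def fieldOp (n : ℕ) (ω : ℝ) (m : PlaneMaterial) (r : ℝ) :
    (Fin 4 → ℂ) →L[ℝ] (Fin 4 → ℂ) :=
  LinearMap.toContinuousLinearMap
    (((1 / r : ℂ) • (systemMatrix n ω m r).mulVecLin).restrictScalars ℝ)

theorem fieldOp_apply (n : ℕ) (ω : ℝ) (m : PlaneMaterial) (r : ℝ) (z : Fin 4 → ℂ) :
    fieldOp n ω m r z = (1 / r : ℂ) • (systemMatrix n ω m r).mulVec z := rfl

/-- Joint continuity in frequency and radius makes the later growth bounds uniform for `ω` down to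
`0`. -/
theorem PlaneMaterial.RegularOn.continuousOn_fieldOp {m : ℝ → PlaneMaterial} {s : Set ℝ}
    (hm : PlaneMaterial.RegularOn m s) (hs : ∀ r ∈ s, r ≠ 0) (n : ℕ) :
    ContinuousOn (fun x : ℝ × ℝ => fieldOp n x.1 (m x.2) x.2) (univ ×ˢ s) := by
  rw [continuousOn_clm_apply]
  intro z
  have hmaps : MapsTo (Prod.snd : ℝ × ℝ → ℝ) (univ ×ˢ s) s := fun x hx => hx.2
  have cast : ∀ {f : ℝ × ℝ → ℝ}, ContinuousOn f (univ ×ˢ s) →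
      ContinuousOn (fun x => (f x : ℂ)) (univ ×ˢ s) := fun hf =>
    Complex.continuous_ofReal.comp_continuousOn hf
  have h11 := hm.C11.comp continuousOn_snd hmaps
  have h22 := hm.C22.comp continuousOn_snd hmaps
  have h12 := hm.C12.comp continuousOn_snd hmaps
  have h66 := hm.C66.comp continuousOn_snd hmaps
  have hρ := cast (hm.ρ.comp continuousOn_snd hmaps)
  have hr := cast (continuousOn_snd (α := ℝ) (β := ℝ) (s := univ ×ˢ s))
  have hω := cast (continuousOn_fst (α := ℝ) (β := ℝ) (s := univ ×ˢ s))
  have hγ : ContinuousOn (fun x : ℝ × ℝ => ((m x.2).γ : ℂ)) (univ ×ˢ s) :=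
    cast (continuousOn_const.add (h12.div h11 fun x hx => (hm.pos _ hx.2).1.ne'))
  have hC : ContinuousOn (fun x : ℝ × ℝ => ((m x.2).C : ℂ)) (univ ×ˢ s) :=
    cast (h22.sub ((h12.pow 2).div h11 fun x hx => (hm.pos _ hx.2).1.ne'))
  have i11 : ContinuousOn (fun x : ℝ × ℝ => (1 / (m x.2).C11 : ℂ)) (univ ×ˢ s) :=
    continuousOn_const.div (cast h11) fun x hx => by exact_mod_cast (hm.pos _ hx.2).1.ne'
  have i66 : ContinuousOn (fun x : ℝ × ℝ => (1 / (m x.2).C66 : ℂ)) (univ ×ˢ s) :=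
    continuousOn_const.div (cast h66) fun x hx => by exact_mod_cast (hm.pos _ hx.2).2.1.ne'
  have ir : ContinuousOn (fun x : ℝ × ℝ => (1 / x.2 : ℂ)) (univ ×ˢ s) :=
    continuousOn_const.div hr fun x hx => by exact_mod_cast hs _ hx.2
  simp only [fieldOp_apply, systemMatrix_mulVec]
  refine ir.smul (continuousOn_pi.2 fun i => ?_)
  fin_cases i <;> simp only [Fin.zero_eta, Fin.mk_one, Fin.reduceFinMk, Matrix.cons_val]
  · exact (((continuousOn_const.sub hγ).mul continuousOn_const).add
      ((continuousOn_const.mul (hγ.sub continuousOn_const)).mul continuousOn_const)).add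
      (i11.mul continuousOn_const)
  · exact continuousOn_const.add (i66.mul continuousOn_const)
  · exact ((((hC.sub ((hρ.mul (hω.pow 2)).mul (hr.pow 2))).mul continuousOn_const).sub
      ((continuousOn_const.mul hC).mul continuousOn_const)).add
      ((hγ.sub continuousOn_const).mul continuousOn_const)).add continuousOn_const
  · exact ((((continuousOn_const.mul hC).neg.mul continuousOn_const).add
      (((continuousOn_const.mul hC).sub ((hρ.mul (hω.pow 2)).mul (hr.pow 2))).mul
        continuousOn_const)).add
      ((continuousOn_const.mul (continuousOn_const.sub hγ)).mul continuousOn_const)).sub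
      continuousOn_const

theorem PlaneMaterial.RegularOn.exists_norm_fieldOp_le {m : ℝ → PlaneMaterial} {a b : ℝ}
    (hm : PlaneMaterial.RegularOn m (Icc a b)) (ha : 0 < a) (n : ℕ) :
    ∃ M, ∀ ω ∈ Icc (0 : ℝ) 1, ∀ r ∈ Icc a b, ‖fieldOp n ω (m r) r‖ ≤ M := by
  have h := (hm.continuousOn_fieldOp (fun r hr => (ha.trans_le hr.1).ne') n).mono
    (prod_mono (subset_univ (Icc (0 : ℝ) 1)) Subset.rfl)
  obtain ⟨M, hM⟩ := (isCompact_Icc.prod isCompact_Icc).exists_bound_of_continuousOn h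
  exact ⟨M, fun ω hω r hr => hM (ω, r) ⟨hω, hr⟩⟩

namespace CoreShell

variable (c : CoreShell)

theorem r1_pos : 0 < c.r1 := c.r0_pos.trans c.r0_lt_r1

theorem material_core {r : ℝ} (h : r < c.r0) :
    c.material r = PlaneMaterial.isotropic c.K0 c.μ0 c.ρ0 := if_pos h

theorem material_shell {r : ℝ} (h : r ∈ Icc c.r0 c.r1) : c.material r = c.shell r := by
  rw [material, if_neg (not_lt.2 h.1), if_pos h.2]

theorem material_ext {r : ℝ} (h : c.r1 < r) : c.material r = c.ext := by
  rw [material, if_neg (not_lt.2 (c.r0_lt_r1.trans h).le), if_neg (not_le.2 h)]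

theorem material_positive (r : ℝ) : (c.material r).Positive := by
  rcases lt_or_ge r c.r0 with h | h
  · rw [c.material_core h]; exact isotropic_positive c.K0_pos c.μ0_pos c.ρ0_pos
  rcases le_or_gt r c.r1 with h' | h'
  · rw [c.material_shell ⟨h, h'⟩]; exact c.shell_pos r ⟨h, h'⟩
  · rw [c.material_ext h']; exact c.ext_positive

theorem exists_norm_fieldOp_material_le (n : ℕ) (R : ℝ) :
    ∃ M, ∀ ω ∈ Icc (0 : ℝ) 1, ∀ r ∈ Icc c.r0 R, ‖fieldOp n ω (c.material r) r‖ ≤ M := by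
  obtain ⟨M1, h1⟩ := c.regularOn_shell.exists_norm_fieldOp_le c.r0_pos n
  obtain ⟨M2, h2⟩ := (c.ext_positive.regularOn (Icc c.r1 R)).exists_norm_fieldOp_le c.r1_pos n
  refine ⟨max M1 M2, fun ω hω r hr => ?_⟩
  rcases le_or_gt r c.r1 with h | h
  · rw [c.material_shell ⟨hr.1, h⟩]; exact (h1 ω hω r ⟨hr.1, h⟩).trans (le_max_left _ _)
  · rw [c.material_ext h]; exact (h2 ω hω r ⟨h.le, hr.2⟩).trans (le_max_right _ _)

/-! ### Fields -/

variable {c} {n : ℕ} {ω : ℝ} {v w : ℝ → Fin 4 → ℂ} {S : Set ℝ} {R : ℝ}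

theorem IsField.mono {T : Set ℝ} (hv : c.IsField n ω S v) (h : T ⊆ S) : c.IsField n ω T v :=
  ⟨hv.1.mono h, fun r hr => hv.2.1 r (interior_mono h hr), hv.2.2⟩

theorem IsField.solvesAt (hv : c.IsField n ω (Ioc 0 R) v) {r : ℝ} (hr : r ∈ Ioo 0 R)
    (h0 : r ≠ c.r0) (h1 : r ≠ c.r1) : SolvesAt n ω (c.material r) v r :=
  hv.2.1 r (by rwa [interior_Ioc]) h0 h1

theorem IsField.add (hv : c.IsField n ω S v) (hw : c.IsField n ω S w) :
    c.IsField n ω S (fun r => v r + w r) := by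
  obtain ⟨B, hB⟩ := hv.2.2
  obtain ⟨B', hB'⟩ := hw.2.2
  exact ⟨hv.1.add hw.1, fun r hr h0 h1 => SolvesAt.add (hv.2.1 r hr h0 h1) (hw.2.1 r hr h0 h1),
    B + B', fun r hr => (norm_add_le _ _).trans (add_le_add (hB r hr) (hB' r hr))⟩

theorem IsField.smul (hv : c.IsField n ω S v) (a : ℂ) :
    c.IsField n ω S (fun r => a • v r) := by
  obtain ⟨B, hB⟩ := hv.2.2
  refine ⟨hv.1.const_smul a, fun r hr h0 h1 => SolvesAt.smul (hv.2.1 r hr h0 h1) a,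
    ‖a‖ * B, fun r hr => ?_⟩
  rw [norm_smul]
  exact mul_le_mul_of_nonneg_left (hB r hr) (norm_nonneg a)

theorem IsField.sub (hv : c.IsField n ω S v) (hw : c.IsField n ω S w) :
    c.IsField n ω S (fun r => v r - w r) := by
  have := hv.add (hw.smul (-1))
  simpa [sub_eq_add_neg] using this

theorem IsField.conj (hv : c.IsField n ω S v) : c.IsField n ω S (fun r => star (v r)) := by
  obtain ⟨B, hB⟩ := hv.2.2
  exact ⟨continuous_star.comp_continuousOn hv.1,
    fun r hr h0 h1 => SolvesAt.conj (hv.2.1 r hr h0 h1), B,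
    fun r hr => by rw [norm_star]; exact hB r hr⟩

/-- Outside the core a field is controlled by its value at either end. -/
theorem exists_norm_le_norm (c : CoreShell) (n : ℕ) (R : ℝ) :
    ∃ M, 0 ≤ M ∧ ∀ ω ∈ Icc (0 : ℝ) 1, ∀ v, c.IsField n ω (Ioc 0 R) v → ∀ r ∈ Icc c.r0 R,
      ‖v r‖ ≤ M * ‖v c.r0‖ ∧ ‖v r‖ ≤ M * ‖v R‖ := by
  obtain ⟨M', hM'⟩ := c.exists_norm_fieldOp_material_le n R
  set M := max M' 0 with hM0
  refine ⟨Real.exp (M * (R - c.r0)), (Real.exp_pos _).le, fun ω hω v hv r hr => ?_⟩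
  have hder : ∀ s ∈ Ioo c.r0 R, s ≠ c.r0 → s ≠ c.r1 →
      HasDerivAt v (fieldOp n ω (c.material s) s (v s)) s ∧
      ‖fieldOp n ω (c.material s) s (v s)‖ ≤ M * ‖v s‖ := by
    intro s hs h0 h1
    refine ⟨hv.solvesAt ⟨c.r0_pos.trans hs.1, hs.2⟩ h0 h1, ?_⟩
    exact ((fieldOp n ω (c.material s) s).le_opNorm _).trans (mul_le_mul_of_nonneg_right
      ((hM' ω hω s ⟨hs.1.le, hs.2.le⟩).trans (le_max_left _ _)) (norm_nonneg _))
  have hcont : ContinuousOn v (Icc c.r0 R) :=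
    hv.1.mono fun s hs => ⟨c.r0_pos.trans_le hs.1, hs.2⟩
  have e1 : Real.exp (M * (r - c.r0)) ≤ Real.exp (M * (R - c.r0)) :=
    Real.exp_le_exp.2 (mul_le_mul_of_nonneg_left (by linarith [hr.2]) (le_max_right _ _))
  have e2 : Real.exp (M * (R - r)) ≤ Real.exp (M * (R - c.r0)) :=
    Real.exp_le_exp.2 (mul_le_mul_of_nonneg_left (by linarith [hr.1]) (le_max_right _ _))
  constructor
  · have := norm_le_of_norm_hasDerivAt_le_mul_off_two (M := M) (c := c.r0) (d := c.r1) hr.1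
      (hcont.mono (Icc_subset_Icc_right hr.2)) (fun s hs => hder s ⟨hs.1, hs.2.trans_le hr.2⟩)
    rw [mul_comm]
    exact this.trans (mul_le_mul_of_nonneg_left e1 (norm_nonneg _))
  · have := norm_le_of_norm_hasDerivAt_le_mul_off_two' (M := M) (c := c.r0) (d := c.r1) hr.2
      (hcont.mono (Icc_subset_Icc_left hr.1)) (fun s hs => hder s ⟨hr.1.trans_lt hs.1, hs.2⟩)
    rw [mul_comm]
    exact this.trans (mul_le_mul_of_nonneg_left e2 (norm_nonneg _))

theorem IsField.eq_zero_of_eq_zero_core (hv : c.IsField n 0 (Ioc 0 R) v) (h : v c.r0 = 0)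
    {r : ℝ} (hr : r ∈ Icc c.r0 R) : v r = 0 := by
  obtain ⟨M, -, hM⟩ := c.exists_norm_le_norm n R
  have := (hM 0 ⟨le_rfl, zero_le_one⟩ v hv r hr).1
  rwa [h, norm_zero, mul_zero, norm_le_zero_iff] at this

theorem IsField.pair_eq (hv : c.IsField n 0 (Ioc 0 R) v) (hw : c.IsField n 0 (Ioc 0 R) w)
    {a b : ℝ} (ha : 0 < a) (hab : a ≤ b) (hb : b ≤ R) : pair (v b) (w b) = pair (v a) (w a) := by
  have hs : Icc a b ⊆ Ioc 0 R := fun r hr => ⟨ha.trans_le hr.1, hr.2.trans hb⟩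
  exact pair_eq_of_solvesAt (mat := c.material) ha hab (hv.1.mono hs) (hw.1.mono hs)
    fun r hr h0 h1 => ⟨hv.solvesAt ⟨ha.trans hr.1, hr.2.trans_le hb⟩ h0 h1,
      hw.solvesAt ⟨ha.trans hr.1, hr.2.trans_le hb⟩ h0 h1⟩

/-- The pairing is constant and tends to `0` at the axis, where one field vanishes and the other is
bounded. -/
theorem IsField.pair_eq_zero (hv : c.IsField n 0 (Ioc 0 R) v) (hw : c.IsField n 0 (Ioc 0 R) w)
    (h0 : Tendsto v (𝓝[>] 0) (𝓝 0)) {r : ℝ} (hr : r ∈ Ioc 0 R) : pair (v r) (w r) = 0 := by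
  obtain ⟨B, hB⟩ := hw.2.2
  have hlim : Tendsto (fun s => pair (v s) (w s)) (𝓝[>] 0) (𝓝 0) := by
    refine squeeze_zero_norm' (a := fun s => 4 * (‖v s‖ * B)) ?_ ?_
    · filter_upwards [Ioo_mem_nhdsGT c.r0_pos] with s hs
      exact (norm_pair_le _ _).trans (by gcongr; exact hB s hs)
    · simpa using ((h0.norm.mul_const B).const_mul 4)
  refine tendsto_nhds_unique (tendsto_const_nhds.congr' ?_) hlim
  filter_upwards [Ioo_mem_nhdsGT hr.1] with s hs
  exact hv.pair_eq hw hs.1 hs.2.le hr.2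

theorem IsField.work_mono (hv : c.IsField n 0 (Ioc 0 R) v) {a b : ℝ} (ha : 0 < a) (hab : a ≤ b)
    (hb : b ≤ R) : work (v a) ≤ work (v b) := by
  have hs : Icc a b ⊆ Ioc 0 R := fun r hr => ⟨ha.trans_le hr.1, hr.2.trans hb⟩
  refine monotoneOn_of_hasDerivAt_nonneg_off_two (f := fun r => work (v r))
    (f' := fun r => energyForm n (c.material r) (v r) / r) (c := c.r0) (d := c.r1)
    (continuous_work.comp_continuousOn (hv.1.mono hs)) (fun r hr h0 h1 => ?_)
    (left_mem_Icc.2 hab) (right_mem_Icc.2 hab) hab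
  exact ⟨(hv.solvesAt ⟨ha.trans hr.1, hr.2.trans_le hb⟩ h0 h1).hasDerivAt_work (ha.trans hr.1).ne',
    div_nonneg (energyForm_nonneg (c.material_positive r) _) (ha.trans hr.1).le⟩

theorem IsField.strainEnergy_eq (hv : c.IsField n 0 (Ioc 0 R) v) (hR : 0 < R)
    (h0 : Tendsto (fun r => work (v r)) (𝓝[>] 0) (𝓝 0)) :
    strainEnergy n c.material R v = Real.pi * work (v R) :=
  _root_.strainEnergy_eq (c := c.r0) (d := c.r1) hR hv.1
    (fun r hr h0 h1 => ⟨c.material_positive r, hv.solvesAt hr h0 h1⟩) h0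

/-- The work starts from `0` at the axis and is nondecreasing, so if it is not positive at `R` it
vanishes identically, and with it its derivative. -/
theorem IsField.energyForm_eq_zero (hv : c.IsField n 0 (Ioc 0 R) v)
    (h0 : Tendsto (fun r => work (v r)) (𝓝[>] 0) (𝓝 0)) (hR : work (v R) ≤ 0) {r : ℝ}
    (hr : r ∈ Ioo 0 R) (hr0 : r ≠ c.r0) (hr1 : r ≠ c.r1) :
    energyForm n (c.material r) (v r) = 0 := by
  have hz : ∀ s ∈ Ioo 0 R, work (v s) = 0 := by
    intro s hs
    refine le_antisymm ((hv.work_mono hs.1 hs.2.le le_rfl).trans hR) ?_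
    refine le_of_tendsto h0 ?_
    filter_upwards [Ioo_mem_nhdsGT hs.1] with t ht using hv.work_mono ht.1 ht.2.le hs.2.le
  have h1 := (hv.solvesAt hr hr0 hr1).hasDerivAt_work hr.1.ne'
  have h2 : HasDerivAt (fun s => work (v s)) 0 r := by
    refine (hasDerivAt_const r (0 : ℝ)).congr_of_eventuallyEq ?_
    filter_upwards [Ioo_mem_nhds hr.1 hr.2] with s hs using hz s hs
  have := h1.unique h2
  rwa [div_eq_zero_iff, or_iff_left hr.1.ne'] at this

/-- A field of the core material continues to all radii. -/
theorem exists_isField_of_core (c : CoreShell) (n : ℕ)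
    (hext : ∀ z, ∃ f : ℝ → Fin 4 → ℂ, f c.r1 = z ∧ ContinuousOn f (Ioi 0) ∧
      ∀ r, 0 < r → SolvesAt n 0 c.ext f r)
    {f : ℝ → Fin 4 → ℂ} (hf : ContinuousOn f (Ioi 0)) (hfB : Tendsto f (𝓝[>] 0) (𝓝 0))
    (hfs : ∀ r, 0 < r → SolvesAt n 0 (PlaneMaterial.isotropic c.K0 c.μ0 c.ρ0) f r) :
    ∃ v, c.IsField n 0 (Ioi 0) v ∧ (∀ r ∈ Ioc 0 c.r0, v r = f r) ∧
      ∀ r ∈ Icc c.r0 c.r1, HasDerivWithinAt v (fieldOp n 0 (c.shell r) r (v r))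
        (Icc c.r0 c.r1) r := by
  have hop : ContinuousOn (fun r => fieldOp n 0 (c.shell r) r) (Icc c.r0 c.r1) :=
    (c.regularOn_shell.continuousOn_fieldOp (fun r hr => (c.r0_pos.trans_le hr.1).ne') n).comp
      (f := fun r => ((0 : ℝ), r)) (by fun_prop) fun r hr => ⟨mem_univ _, hr⟩
  obtain ⟨g, hg0, hg⟩ := exists_linear_ode c.r0_lt_r1.le hop (f c.r0)
  obtain ⟨h, hh1, hhc, hhs⟩ := hext (g c.r1)
  have hgc : ContinuousOn g (Icc c.r0 c.r1) := fun r hr => (hg r hr).continuousWithinAt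
  -- Core field, shell solution and exterior solution are chosen with matching values at the
  -- interfaces, so that gluing them keeps displacement and traction continuous.
  set v : ℝ → Fin 4 → ℂ := fun r => if r ≤ c.r0 then f r else if r ≤ c.r1 then g r else h r with hv
  have v1 : ∀ r, r ≤ c.r0 → v r = f r := fun r hr => if_pos hr
  have v2 : ∀ r ∈ Icc c.r0 c.r1, v r = g r := by
    intro r hr
    rcases hr.1.eq_or_lt with h' | h'
    · rw [← h', v1 _ le_rfl, hg0]
    · rw [hv]; simp only [if_neg (not_le.2 h'), if_pos hr.2]
  have v3 : ∀ r, c.r1 ≤ r → v r = h r := by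
    intro r hr
    rcases hr.eq_or_lt with h' | h'
    · rw [← h', v2 _ ⟨c.r0_lt_r1.le, le_rfl⟩, hh1]
    · rw [hv]; simp only [if_neg (not_le.2 h'), if_neg (not_le.2 (c.r0_lt_r1.trans h'))]
  have hc1 : ContinuousOn v (Ioc 0 c.r0) :=
    (hf.mono Ioc_subset_Ioi_self).congr fun r hr => v1 r hr.2
  have hc2 : ContinuousOn v (Icc c.r0 c.r1) := hgc.congr v2
  have hc3 : ContinuousOn v (Ici c.r1) :=
    (hhc.mono fun r hr => c.r1_pos.trans_le hr).congr v3
  refine ⟨v, ⟨?_, ?_, ?_⟩, fun r hr => v1 r hr.2, fun r hr => ?_⟩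
  · intro r hr
    refine ContinuousAt.continuousWithinAt ?_
    rcases lt_trichotomy r c.r0 with h' | h' | h'
    · exact hc1.continuousAt (Ioc_mem_nhds hr h')
    · subst h'
      refine continuousAt_iff_continuous_left_right.2 ⟨?_, ?_⟩
      · exact (hc1 _ ⟨hr, le_rfl⟩).mono_of_mem_nhdsWithin (Ioc_mem_nhdsLE hr)
      · exact (hc2 _ ⟨le_rfl, c.r0_lt_r1.le⟩).mono_of_mem_nhdsWithin (Icc_mem_nhdsGE c.r0_lt_r1)
    rcases lt_trichotomy r c.r1 with h'' | h'' | h''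
    · exact hc2.continuousAt (Icc_mem_nhds h' h'')
    · subst h''
      refine continuousAt_iff_continuous_left_right.2 ⟨?_, ?_⟩
      · exact (hc2 _ ⟨h'.le, le_rfl⟩).mono_of_mem_nhdsWithin (Icc_mem_nhdsLE h')
      · exact hc3 _ self_mem_Ici
    · exact hc3.continuousAt (Ici_mem_nhds h'')
  · rw [interior_Ioi]
    intro r hr h0 h1
    rcases lt_or_gt_of_ne h0 with h' | h'
    · rw [c.material_core h', v1 r h'.le]
      refine (hfs r hr).congr_of_eventuallyEq ?_
      filter_upwards [Iio_mem_nhds h'] with s hs using v1 s (le_of_lt hs)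
    rcases lt_or_gt_of_ne h1 with h'' | h''
    · rw [c.material_shell ⟨h'.le, h''.le⟩, v2 r ⟨h'.le, h''.le⟩]
      refine ((hg r ⟨h'.le, h''.le⟩).hasDerivAt (Icc_mem_nhds h' h'')).congr_of_eventuallyEq ?_
      filter_upwards [Icc_mem_nhds h' h''] with s hs using v2 s hs
    · rw [c.material_ext h'', v3 r h''.le]
      refine (hhs r hr).congr_of_eventuallyEq ?_
      filter_upwards [Ioi_mem_nhds h''] with s hs using v3 s (le_of_lt hs)
  · have hb : Tendsto v (𝓝[>] 0) (𝓝 0) := by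
      refine hfB.congr' ?_
      filter_upwards [Ioo_mem_nhdsGT c.r0_pos] with s hs using (v1 s hs.2.le).symm
    obtain ⟨t, ht, ht'⟩ := (mem_nhdsGT_iff_exists_Ioo_subset).1
      ((hb.norm.eventually_le_const (u := 1) (by simp)))
    obtain ⟨B, hB⟩ := (isCompact_Icc (a := t) (b := c.r0)).exists_bound_of_continuousOn
      (hf.mono fun r hr => lt_of_lt_of_le ht hr.1)
    refine ⟨max 1 B, fun r hr => ?_⟩
    rcases lt_or_ge r t with h' | h'
    · exact (ht' ⟨hr.1, h'⟩).trans (le_max_left _ _)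
    · rw [v1 r hr.2.le]; exact (hB r ⟨h', hr.2.le⟩).trans (le_max_right _ _)
  · rw [v2 r hr]
    exact (hg r hr).congr_of_mem v2 hr

end CoreShell

namespace CoreShell

variable {c : CoreShell} {v : ℝ → Fin 4 → ℂ} {R : ℝ}

/-! ### Static fields of harmonic `2` -/

/-- The coefficients of `r⁻¹` and `r⁻³` are pairings with the solutions growing like `r` and `r ^
3`; these vanish at the axis while `v` is bounded, so both coefficients are `0`. -/
theorem IsField.exists_core_eq (hv : c.IsField 2 0 (Ioc 0 R) v) (hR : c.r0 ≤ R) :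
    ∃ x y : ℂ, ∀ r ∈ Ioc 0 c.r0, v r = isoField c.K0 c.μ0 ![x, y, 0, 0] r := by
  have hK := c.K0_pos
  have hμ := c.μ0_pos
  have h1 : (c.K0 + c.μ0 : ℂ) ≠ 0 := by exact_mod_cast (add_pos hK hμ).ne'
  set a := isoCoeff c.K0 c.μ0 c.r0 (v c.r0) with ha
  have hconst : ∀ r ∈ Ioc 0 c.r0, isoCoeff c.K0 c.μ0 r (v r) = a := fun r hr =>
    (isoCoeff_eq_of_solvesAt (ρ := c.ρ0) hK hμ hr.1 hr.2
      (hv.1.mono fun s hs => ⟨hr.1.trans_le hs.1, hs.2.trans hR⟩)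
      fun s hs => by
        have := hv.solvesAt ⟨hr.1.trans hs.1, hs.2.trans_le hR⟩ hs.2.ne
          (hs.2.trans c.r0_lt_r1).ne
        rwa [c.material_core hs.2] at this).symm
  obtain ⟨B, hB⟩ := hv.2.2
  have lim : ∀ (k : ℕ) (e : Fin 4 → ℂ), k ≠ 0 →
      Tendsto (fun r : ℝ => pair ((r : ℂ) ^ (k : ℤ) • e) (v r)) (𝓝[>] 0) (𝓝 0) := by
    intro k e hk
    refine squeeze_zero_norm' (a := fun r : ℝ => 4 * (r ^ k * ‖e‖ * B)) ?_ ?_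
    · filter_upwards [Ioo_mem_nhdsGT c.r0_pos] with s hs
      refine (norm_pair_le _ _).trans ?_
      rw [norm_zpow_smul hs.1, zpow_natCast]
      have := hB s hs
      have := hs.1
      gcongr
    · have : Continuous fun r : ℝ => 4 * (r ^ k * ‖e‖ * B) := by fun_prop
      have h := (this.tendsto 0).mono_left (nhdsWithin_le_nhds (s := Ioi 0))
      simpa [hk] using h
  have ev : ∀ᶠ r in 𝓝[>] (0 : ℝ), isoCoeff c.K0 c.μ0 r (v r) = a := by
    filter_upwards [Ioo_mem_nhdsGT c.r0_pos] with s hs using hconst s ⟨hs.1, hs.2.le⟩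
  have a2 : a 2 = 0 := by
    refine tendsto_nhds_unique (tendsto_const_nhds (f := 𝓝[>] (0 : ℝ)))
      (Tendsto.congr' ?_ (((lim 1 (vecOne c.μ0) one_ne_zero).neg.div_const 2).trans_eq (by simp)))
    filter_upwards [ev] with s hs
    rw [← hs]; rfl
  have a3 : a 3 = 0 := by
    refine tendsto_nhds_unique (tendsto_const_nhds (f := 𝓝[>] (0 : ℝ)))
      (Tendsto.congr' ?_ (((lim 3 (vecThree c.K0 c.μ0) three_ne_zero).div_const
        (c.K0 + c.μ0)).trans_eq (by simp)))
    filter_upwards [ev] with s hs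
    rw [← hs]; rfl
  refine ⟨a 0, a 1, fun r hr => ?_⟩
  have : ![a 0, a 1, 0, 0] = a := by
    ext i; fin_cases i <;> simp [a2, a3]
  rw [this, ← hconst r hr, isoField_isoCoeff hK hμ hr.1.ne']

theorem IsField.exists_ext_eq (hv : c.IsField 2 0 (Ioc 0 R) v) :
    ∃ a, ∀ r ∈ Icc c.r1 R, v r = isoField c.Ke c.μe a r := by
  refine ⟨isoCoeff c.Ke c.μe c.r1 (v c.r1), fun r hr => ?_⟩
  have := isoCoeff_eq_of_solvesAt (ρ := c.ρe) c.Ke_pos c.μe_pos c.r1_pos hr.1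
    (hv.1.mono fun s hs => ⟨c.r1_pos.trans_le hs.1, hs.2.trans hr.2⟩)
    (fun s hs => by
        have := hv.solvesAt ⟨c.r1_pos.trans hs.1, hs.2.trans_le hr.2⟩
          (c.r0_lt_r1.trans hs.1).ne' hs.1.ne'
        rwa [c.material_ext hs.1] at this)
  rw [← this, isoField_isoCoeff c.Ke_pos c.μe_pos (c.r1_pos.trans_le hr.1).ne']

theorem IsField.tendsto_zero (hv : c.IsField 2 0 (Ioc 0 R) v) (hR : c.r0 ≤ R) :
    Tendsto v (𝓝[>] 0) (𝓝 0) := by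
  obtain ⟨x, y, h⟩ := hv.exists_core_eq hR
  refine (tendsto_isoField_zero c.K0 c.μ0 x y).congr' ?_
  filter_upwards [Ioo_mem_nhdsGT c.r0_pos] with s hs using (h s ⟨hs.1, hs.2.le⟩).symm

theorem tendsto_work_zero {f : ℝ → Fin 4 → ℂ} {l : Filter ℝ} (h : Tendsto f l (𝓝 0)) :
    Tendsto (fun r => work (f r)) l (𝓝 0) := by
  have := (continuous_work.tendsto 0).comp h
  rwa [show work 0 = 0 by simp [work]] at this

theorem IsField.eq_zero_of_core (hv : c.IsField 2 0 (Ioc 0 R) v) (hR : c.r0 ≤ R) {x y : ℂ}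
    (h : ∀ r ∈ Ioo 0 c.r0, v r = isoField c.K0 c.μ0 ![x, y, 0, 0] r) (hx : x = 0) (hy : y = 0)
    {r : ℝ} (hr : r ∈ Ioc 0 R) : v r = 0 := by
  obtain ⟨x', y', h'⟩ := hv.exists_core_eq hR
  have hm : c.r0 / 2 ∈ Ioo 0 c.r0 := ⟨half_pos c.r0_pos, half_lt_self c.r0_pos⟩
  have e := isoField_injective c.K0_pos c.μ0_pos hm.1.ne'
    ((h _ hm).symm.trans (h' _ ⟨hm.1, hm.2.le⟩))
  have hz : ∀ r ∈ Ioc 0 c.r0, v r = 0 := by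
    intro r hr
    rw [h' r hr, ← e, hx, hy]
    simp [isoField]
  rcases le_total r c.r0 with h0 | h0
  · exact hz r ⟨hr.1, h0⟩
  · exact hv.eq_zero_of_eq_zero_core (hz _ ⟨c.r0_pos, le_rfl⟩) ⟨h0, hr.2⟩

/-- A static field of harmonic `2` is determined by its displacement, or its traction, on a
circle. -/
theorem IsField.eq_zero_of_work_nonpos (hv : c.IsField 2 0 (Ioc 0 R) v) (hR : c.r0 ≤ R)
    (hw : work (v R) ≤ 0) {r : ℝ} (hr : r ∈ Ioc 0 R) : v r = 0 := by
  obtain ⟨x, y, h⟩ := hv.exists_core_eq hR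
  have hm : c.r0 / 2 ∈ Ioo 0 c.r0 := ⟨half_pos c.r0_pos, half_lt_self c.r0_pos⟩
  have hE := hv.energyForm_eq_zero (tendsto_work_zero (hv.tendsto_zero hR)) hw
    ⟨hm.1, hm.2.trans_le hR⟩ hm.2.ne (hm.2.trans c.r0_lt_r1).ne
  have hpos := c.material_positive (c.r0 / 2)
  have hmat := c.material_core hm.2
  set z := v (c.r0 / 2) with hz
  have hC := hpos.C_pos
  obtain ⟨h11, h66, -, -⟩ := hpos
  have t1 : 0 ≤ ‖z 2‖ ^ 2 / (c.material (c.r0 / 2)).C11 := by positivity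
  have t2 : 0 ≤ ‖z 3‖ ^ 2 / (c.material (c.r0 / 2)).C66 := by positivity
  have t3 : 0 ≤ (c.material (c.r0 / 2)).C * ‖z 0 - (2 : ℕ) * z 1‖ ^ 2 := by positivity
  unfold energyForm at hE
  -- Vanishing energy at one core radius kills both tractions. The radial traction of the `r ^ 3`
  -- solution is zero, so `z 2 = 0` gives `x = 0`, and then `z 3 = 0` gives `y = 0`.
  have z2 : z 2 = 0 := by
    have : ‖z 2‖ ^ 2 / (c.material (c.r0 / 2)).C11 = 0 := by linarith
    simpa [h11.ne'] using this
  have z3 : z 3 = 0 := by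
    have : ‖z 3‖ ^ 2 / (c.material (c.r0 / 2)).C66 = 0 := by linarith
    simpa [h66.ne'] using this
  have hr0 : (c.r0 : ℂ) ≠ 0 := by exact_mod_cast c.r0_pos.ne'
  have hK : (c.K0 : ℂ) ≠ 0 := by exact_mod_cast c.K0_pos.ne'
  have hμ : (c.μ0 : ℂ) ≠ 0 := by exact_mod_cast c.μ0_pos.ne'
  have hval := h _ ⟨hm.1, hm.2.le⟩
  rw [← hz] at hval
  have x0 : x = 0 := by
    rw [hval] at z2
    simpa [isoField, vecOne, vecThree, hr0, hμ] using z2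
  have y0 : y = 0 := by
    rw [hval] at z3
    simpa [isoField, vecOne, vecThree, hr0, hμ, hK, x0, zpow_ofNat] using z3
  exact hv.eq_zero_of_core hR (fun r hr => h r ⟨hr.1, hr.2.le⟩) x0 y0 hr

theorem tendsto_isoField_atTop (K μ : ℝ) (x y : ℂ) :
    Tendsto (isoField K μ ![0, 0, x, y]) atTop (𝓝 0) := by
  have h : ∀ k : ℕ, k ≠ 0 → Tendsto (fun r : ℝ => (r : ℂ) ^ (-(k : ℤ))) atTop (𝓝 0) := by
    intro k hk
    rw [tendsto_zero_iff_norm_tendsto_zero]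
    refine (tendsto_pow_neg_atTop (𝕜 := ℝ) hk).congr' ?_
    filter_upwards [eventually_gt_atTop 0] with r hr
    rw [norm_zpow, Complex.norm_real, Real.norm_of_nonneg hr.le]
  have h1 := ((h 1 one_ne_zero).smul_const (vecNegOne K μ)).const_smul x
  have h3 := ((h 3 three_ne_zero).smul_const (vecNegThree μ)).const_smul y
  refine ((h1.add h3).congr fun r => ?_).trans_eq (by simp)
  simp [isoField]

/-- Without growing exterior terms the work tends to `0` at infinity; being nondecreasing, it is
nowhere positive. -/
theorem IsField.eq_zero_of_decaying (hv : c.IsField 2 0 (Ioi 0) v) {x y : ℂ}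
    (h : ∀ r, c.r1 < r → v r = isoField c.Ke c.μe ![0, 0, x, y] r) {r : ℝ} (hr : 0 < r) :
    v r = 0 := by
  set R := max r c.r0
  have hlim : Tendsto (fun s => work (v s)) atTop (𝓝 0) := by
    refine (tendsto_work_zero (tendsto_isoField_atTop c.Ke c.μe x y)).congr' ?_
    filter_upwards [eventually_gt_atTop c.r1] with s hs
    rw [h s hs]
  have hR : 0 < R := hr.trans_le (le_max_left _ _)
  refine (hv.mono Ioc_subset_Ioi_self).eq_zero_of_work_nonpos (R := R) (le_max_right _ _) ?_
    ⟨hr, le_max_left _ _⟩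
  refine ge_of_tendsto hlim ?_
  filter_upwards [eventually_ge_atTop R] with s hs
  exact (hv.mono Ioc_subset_Ioi_self).work_mono (R := s) hR hs le_rfl

/-- Two static fields of harmonic `2` that span all of them, normalized in the exterior. -/
structure StaticBasis (c : CoreShell) where
  p : ℝ → Fin 4 → ℂ
  q : ℝ → Fin 4 → ℂ
  p2 : ℂ
  p3 : ℂ
  q2 : ℂ
  q3 : ℂ
  hp : c.IsField 2 0 (Ioi 0) p
  hq : c.IsField 2 0 (Ioi 0) q
  p_ext : ∀ r, c.r1 ≤ r → p r = isoField c.Ke c.μe ![1, 0, p2, p3] r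
  q_ext : ∀ r, c.r1 ≤ r → q r = isoField c.Ke c.μe ![0, 1, q2, q3] r
  span : ∀ R, c.r1 < R → ∀ v, c.IsField 2 0 (Ioc 0 R) v →
    ∃ a b : ℂ, ∀ r ∈ Ioc 0 R, v r = a • p r + b • q r

theorem IsField.exists_ext_eq' (hv : c.IsField 2 0 (Ioi 0) v) :
    ∃ a, ∀ r, c.r1 ≤ r → v r = isoField c.Ke c.μe a r := by
  have h : ∀ R, ∃ a, ∀ r ∈ Icc c.r1 R, v r = isoField c.Ke c.μe a r := fun R =>
    (hv.mono Ioc_subset_Ioi_self).exists_ext_eq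
  obtain ⟨a, ha⟩ := h (c.r1 + 1)
  refine ⟨a, fun r hr => ?_⟩
  obtain ⟨b, hb⟩ := h (r + 1)
  have e : b = a := isoField_injective c.Ke_pos c.μe_pos c.r1_pos.ne'
    ((hb _ ⟨le_rfl, by linarith⟩).symm.trans (ha _ ⟨le_rfl, by linarith⟩))
  rw [hb r ⟨hr, by linarith⟩, e]

/-- The two core coefficients map linearly to the two growing exterior coefficients. The kernel
consists of decaying fields and is trivial, so this `2 × 2` map is invertible and any growing part
can be prescribed. -/
theorem nonempty_staticBasis (c : CoreShell) : Nonempty c.StaticBasis := by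
  have hext : ∀ z, ∃ f : ℝ → Fin 4 → ℂ, f c.r1 = z ∧ ContinuousOn f (Ioi 0) ∧
      ∀ r, 0 < r → SolvesAt 2 0 c.ext f r := fun z =>
    ⟨isoField c.Ke c.μe (isoCoeff c.Ke c.μe c.r1 z),
      isoField_isoCoeff c.Ke_pos c.μe_pos c.r1_pos.ne' z, continuousOn_isoField _ _ _,
      fun r hr => solvesAt_isoField c.Ke_pos c.μe_pos _ _ hr.ne'⟩
  have core : ∀ x y : ℂ, ∃ v, c.IsField 2 0 (Ioi 0) v ∧
      ∀ r ∈ Ioc 0 c.r0, v r = isoField c.K0 c.μ0 ![x, y, 0, 0] r := fun x y =>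
    (exists_isField_of_core c 2 hext (continuousOn_isoField _ _ _) (tendsto_isoField_zero _ _ x y)
      fun r hr => solvesAt_isoField c.K0_pos c.μ0_pos _ _ hr.ne').imp fun _ h => ⟨h.1, h.2.1⟩
  obtain ⟨f, hf, hf0⟩ := core 1 0
  obtain ⟨g, hg, hg0⟩ := core 0 1
  obtain ⟨a, ha⟩ := hf.exists_ext_eq'
  obtain ⟨b, hb⟩ := hg.exists_ext_eq'
  have comb : ∀ s t : ℂ, c.IsField 2 0 (Ioi 0) (fun r => s • f r + t • g r) := fun s t =>
    (hf.smul s).add (hg.smul t)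
  have comb_core : ∀ s t : ℂ, ∀ r ∈ Ioc 0 c.r0,
      s • f r + t • g r = isoField c.K0 c.μ0 ![s, t, 0, 0] r := by
    intro s t r hr
    rw [hf0 r hr, hg0 r hr, ← isoField_smul, ← isoField_smul, ← isoField_add]
    congr 1
    ext i; fin_cases i <;> simp
  have comb_ext : ∀ s t : ℂ, ∀ r, c.r1 ≤ r →
      s • f r + t • g r = isoField c.Ke c.μe (s • a + t • b) r := by
    intro s t r hr
    rw [ha r hr, hb r hr, ← isoField_smul, ← isoField_smul, ← isoField_add]
  have inj : ∀ s t : ℂ, s * a 0 + t * b 0 = 0 → s * a 1 + t * b 1 = 0 → s = 0 ∧ t = 0 := by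
    intro s t h0 h1
    have hz : s • f c.r0 + t • g c.r0 = 0 :=
      (comb s t).eq_zero_of_decaying (x := s * a 2 + t * b 2) (y := s * a 3 + t * b 3)
        (fun r hr => by
          rw [comb_ext s t r hr.le]
          congr 1
          ext i; fin_cases i <;> simp [h0, h1]) c.r0_pos
    rw [comb_core s t _ ⟨c.r0_pos, le_rfl⟩] at hz
    have hzero : isoField c.K0 c.μ0 0 c.r0 = 0 := by simp [isoField]
    have e := isoField_injective c.K0_pos c.μ0_pos c.r0_pos.ne' (hz.trans hzero.symm)
    exact ⟨by simpa using congrFun e 0, by simpa using congrFun e 1⟩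
  have det : a 0 * b 1 - a 1 * b 0 ≠ 0 := by
    intro h
    obtain ⟨h1, h2⟩ := inj (b 0) (-a 0) (by ring) (by linear_combination -h)
    obtain ⟨h3, h4⟩ := inj (b 1) (-a 1) (by linear_combination h) (by ring)
    have := inj 1 0 (by simpa using h2) (by simpa using h4)
    exact one_ne_zero this.1
  set d := a 0 * b 1 - a 1 * b 0 with hd
  -- The weights of `f` and `g` are given by Cramer's rule for the growing coefficients `s`, `t`.
  have inv : ∀ s t : ℂ, ∃ p : ℝ → Fin 4 → ℂ, ∃ p2 p3 : ℂ, c.IsField 2 0 (Ioi 0) p ∧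
      (∀ r, c.r1 ≤ r → p r = isoField c.Ke c.μe ![s, t, p2, p3] r) ∧
      (∀ r, p r = ((b 1 * s - b 0 * t) / d) • f r + ((a 0 * t - a 1 * s) / d) • g r) := by
    intro s t
    set x := (b 1 * s - b 0 * t) / d with hx
    set y := (a 0 * t - a 1 * s) / d with hy
    refine ⟨_, x * a 2 + y * b 2, x * a 3 + y * b 3, comb x y, fun r hr => ?_, fun r => rfl⟩
    rw [comb_ext x y r hr]
    congr 1
    ext i; fin_cases i
    · simp [hx, hy]; field_simp; rw [hd]; ring
    · simp [hx, hy]; field_simp; rw [hd]; ring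
    · simp
    · simp
  obtain ⟨p, p2, p3, hp, hpe, hpf⟩ := inv 1 0
  obtain ⟨q, q2, q3, hq, hqe, hqf⟩ := inv 0 1
  refine ⟨⟨p, q, p2, p3, q2, q3, hp, hq, hpe, hqe, fun R hR v hv => ?_⟩⟩
  obtain ⟨s, t, hst⟩ := hv.exists_core_eq (c.r0_lt_r1.trans hR).le
  refine ⟨s * a 0 + t * b 0, s * a 1 + t * b 1, fun r hr => ?_⟩
  have hw := (hv.sub ((comb s t).mono Ioc_subset_Ioi_self)).eq_zero_of_core
    (c.r0_lt_r1.trans hR).le (x := 0) (y := 0) (fun r hr => by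
      rw [comb_core s t r ⟨hr.1, hr.2.le⟩, hst r ⟨hr.1, hr.2.le⟩]
      simp [isoField]) rfl rfl hr
  rw [sub_eq_zero] at hw
  rw [hw, hpf, hqf]
  ext i
  simp
  field_simp
  rw [hd]
  ring

namespace StaticBasis

variable (b : c.StaticBasis)

theorem comb_ext (x y : ℂ) {r : ℝ} (hr : c.r1 ≤ r) :
    x • b.p r + y • b.q r =
      isoField c.Ke c.μe ![x, y, x * b.p2 + y * b.q2, x * b.p3 + y * b.q3] r := by
  rw [b.p_ext r hr, b.q_ext r hr, ← isoField_smul, ← isoField_smul, ← isoField_add]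
  congr 1
  ext i; fin_cases i <;> simp

theorem isField_comb (x y : ℂ) : c.IsField 2 0 (Ioi 0) (fun r => x • b.p r + y • b.q r) :=
  (b.hp.smul x).add (b.hq.smul y)

/-- A static field is determined by its coefficients in the exterior. -/
theorem coeff_of_isField (hR : c.r1 < R) (hv : c.IsField 2 0 (Ioc 0 R) v) {a : Fin 4 → ℂ} {r : ℝ}
    (hr : r ∈ Ioc c.r1 R) (h : v r = isoField c.Ke c.μe a r) :
    a 2 = a 0 * b.p2 + a 1 * b.q2 ∧ a 3 = a 0 * b.p3 + a 1 * b.q3 := by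
  obtain ⟨x, y, hxy⟩ := b.span R hR v hv
  have hr0 := c.r1_pos.trans hr.1
  rw [hxy r ⟨hr0, hr.2⟩, b.comb_ext x y hr.1.le] at h
  have e := isoField_injective c.Ke_pos c.μe_pos hr0.ne' h
  rw [← e]
  simp

/-- The coefficient of the `r⁻¹` decay under shear is real. -/
theorem p2_im : b.p2.im = 0 := by
  have hr : c.r1 < c.r1 + 1 := by linarith
  have hr0 : c.r1 + 1 ∈ Ioc 0 (c.r1 + 1) := ⟨by linarith [c.r1_pos], le_rfl⟩
  have hp := b.hp.mono (Ioc_subset_Ioi_self : Ioc 0 (c.r1 + 1) ⊆ Ioi 0)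
  -- Both `p` and its conjugate vanish at the axis, so their pairing is zero. In exterior
  -- coefficients it equals `-2 (p2 - star p2)`.
  have h := hp.conj.pair_eq_zero hp (by
    have := continuous_star.tendsto (0 : Fin 4 → ℂ) |>.comp
      (hp.tendsto_zero (c.r0_lt_r1.trans hr).le)
    simpa [Function.comp_def] using this) hr0
  have hstar : star (b.p (c.r1 + 1)) =
      isoField c.Ke c.μe ![1, 0, star b.p2, star b.p3] (c.r1 + 1) := by
    rw [b.p_ext _ hr.le]
    ext i
    fin_cases i <;> simp [isoField, vecOne, vecThree, vecNegOne, vecNegThree]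
  rw [hstar, b.p_ext _ hr.le, pair_isoField c.Ke_pos c.μe_pos _ _ hr0.1.ne'] at h
  simp at h
  have h' : b.p2 = (starRingEnd ℂ) b.p2 := by linear_combination h
  exact Complex.conj_eq_iff_im.1 h'.symm

end StaticBasis

/-! ### The prescribed static loads -/

theorem ext_γ (c : CoreShell) : c.ext.γ = 2 * c.Ke / (c.Ke + c.μe) := by
  have := (add_pos c.Ke_pos c.μe_pos).ne'
  simp only [ext, PlaneMaterial.isotropic, PlaneMaterial.γ]
  field_simp
  ring

theorem v3_eq (c : CoreShell) : c.v3 = vecNegOne c.Ke c.μe := by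
  have h1 : (c.Ke + c.μe : ℂ) ≠ 0 := by exact_mod_cast (add_pos c.Ke_pos c.μe_pos).ne'
  have h2 : (c.μe : ℂ) ≠ 0 := by exact_mod_cast c.μe_pos.ne'
  ext i
  fin_cases i <;> simp [v3, vecNegOne, ext_γ] <;> field_simp <;> ring

theorem shearLoad_eq (c : CoreShell) (α : ℂ) (r : ℝ) :
    c.shearLoad α r = isoField c.Ke c.μe ![α / c.r1, 0, 0, 0] r := by
  ext i
  fin_cases i <;> simp [shearLoad, isoField, vecOne] <;> ring

theorem shear_exterior_eq (c : CoreShell) (α₁ α₃ α₄ : ℂ) (r : ℝ) :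
    c.shearLoad α₁ r + (α₃ * (c.r1 / r : ℂ)) • c.v3 + (α₄ * (c.r1 / r : ℂ) ^ 3) • c.v4 =
      isoField c.Ke c.μe ![α₁ / c.r1, 0, α₃ * c.r1, α₄ * c.r1 ^ 3] r := by
  rw [shearLoad_eq, v3_eq]
  have : c.v4 = vecNegThree c.μe := rfl
  rw [this]
  simp only [isoField, zpow_neg]
  simp [← smul_assoc]
  congr 2
  · ring
  · field_simp

/-- The exterior coefficients of the static field under shear. -/
theorem StaticShear.coeff {α₁ α₃ α₄ : ℂ} (h : c.StaticShear α₁ α₃ α₄) (b : c.StaticBasis) :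
    α₃ * c.r1 ^ 2 = α₁ * b.p2 ∧ α₄ * c.r1 ^ 4 = α₁ * b.p3 := by
  obtain ⟨v, hv, he⟩ := h
  have hr : c.r1 < c.r1 + 1 := by linarith
  have hr1 : (c.r1 : ℂ) ≠ 0 := by exact_mod_cast c.r1_pos.ne'
  obtain ⟨h2, h3⟩ := b.coeff_of_isField hr (hv.mono Ioc_subset_Ioi_self) ⟨hr, le_rfl⟩
    ((he _ hr).trans (shear_exterior_eq c α₁ α₃ α₄ _))
  simp at h2 h3
  field_simp at h2 h3
  exact ⟨by linear_combination h2, by linear_combination h3⟩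

end CoreShell

/-! ### The pointwise effective bulk modulus -/

namespace CoreShell

variable {c : CoreShell}

/-- `x`, `y` are the radial displacement and `r σ_rr` of a static field of harmonic `0` in the
shell. -/
structure HydroShell (c : CoreShell) (x y : ℝ → ℝ) : Prop where
  deriv_x : ∀ r ∈ Icc c.r0 c.r1, HasDerivWithinAt x
    (1 / r * (-((c.shell r).C12 / (c.shell r).C11) * x r + 1 / (c.shell r).C11 * y r))
    (Icc c.r0 c.r1) r
  deriv_y : ∀ r ∈ Icc c.r0 c.r1, HasDerivWithinAt y
    (1 / r * ((c.shell r).C * x r + (c.shell r).C12 / (c.shell r).C11 * y r)) (Icc c.r0 c.r1) r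
  core : y c.r0 = 2 * c.K0 * x c.r0
  pos : 0 < x c.r0

namespace HydroShell

variable {x y : ℝ → ℝ}

/-- The product is the work of the radial traction: positive at `r0` because `K0 > 0`, and
nondecreasing. In particular `x` has no zero in the shell, so the quotient `y / (2 x)` makes sense
there. -/
theorem mul_pos (h : c.HydroShell x y) {r : ℝ} (hr : r ∈ Icc c.r0 c.r1) : 0 < x r * y r := by
  have hmono : MonotoneOn (fun r => x r * y r) (Icc c.r0 c.r1) := by
    refine monotoneOn_of_hasDerivAt_nonneg_off_two (c := 0) (d := 0)
      (f' := fun r => 1 / r * ((c.shell r).C * x r ^ 2 + 1 / (c.shell r).C11 * y r ^ 2))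
      (fun r hr => ((h.deriv_x r hr).continuousWithinAt.mul (h.deriv_y r hr).continuousWithinAt))
      fun r hr _ _ => ?_
    have hr' : r ∈ Icc c.r0 c.r1 := ⟨hr.1.le, hr.2.le⟩
    have hp := c.shell_pos r hr'
    have hC := hp.C_pos
    have h11 := hp.1
    have hr0 : 0 < r := c.r0_pos.trans hr.1
    refine ⟨(((h.deriv_x r hr').hasDerivAt (Icc_mem_nhds hr.1 hr.2)).mul
      ((h.deriv_y r hr').hasDerivAt (Icc_mem_nhds hr.1 hr.2))).congr_deriv (by ring),
      by positivity⟩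
  have h0 : 0 < x c.r0 * y c.r0 := by
    rw [h.core]
    have := h.pos
    have := c.K0_pos
    positivity
  exact h0.trans_le (hmono ⟨le_rfl, hr.1.trans hr.2⟩ hr hr.1)

/-- The substitution `K_* = y / (2 x)` linearizes the Riccati equation. Conversely, for a given
Riccati solution the defect `y - 2 K_* x` solves a homogeneous linear equation with zero initial
value, hence vanishes by Grönwall. -/
theorem bulkCondition_iff (h : c.HydroShell x y) :
    c.BulkCondition ↔ y c.r1 = 2 * c.Ke * x c.r1 := by
  have hne : ∀ r ∈ Icc c.r0 c.r1, x r ≠ 0 := fun r hr e => by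
    have := h.mul_pos hr
    simp [e] at this
  have hr1 : c.r1 ∈ Icc c.r0 c.r1 := ⟨c.r0_lt_r1.le, le_rfl⟩
  have hr0 : c.r0 ∈ Icc c.r0 c.r1 := ⟨le_rfl, c.r0_lt_r1.le⟩
  constructor
  · rintro ⟨Ks, h0, h1, hK⟩
    have hKc : ContinuousOn Ks (Icc c.r0 c.r1) := fun r hr => (hK r hr).continuousWithinAt
    set κ : ℝ → ℝ := fun r => ((c.shell r).C12 - 2 * Ks r) / ((c.shell r).C11 * r) with hκ
    have hκc : ContinuousOn κ (Icc c.r0 c.r1) :=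
      (c.shell_C12.sub (continuousOn_const.mul hKc)).div (c.shell_C11.mul continuousOn_id)
        fun r hr => (_root_.mul_pos (c.shell_pos r hr).1 (c.r0_pos.trans_le hr.1)).ne'
    obtain ⟨M, hM⟩ := isCompact_Icc.exists_bound_of_continuousOn hκc
    have hd : ∀ r ∈ Icc c.r0 c.r1, HasDerivWithinAt (fun r => y r - 2 * Ks r * x r)
        (κ r * (y r - 2 * Ks r * x r)) (Icc c.r0 c.r1) r := by
      intro r hr
      have h11 := (c.shell_pos r hr).1.ne'
      have hr' := (c.r0_pos.trans_le hr.1).ne'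
      refine ((h.deriv_y r hr).sub (((hK r hr).const_mul 2).mul (h.deriv_x r hr))).congr_deriv ?_
      simp only [hκ, PlaneMaterial.C]
      field_simp
      ring
    have hle := norm_le_of_norm_hasDerivAt_le_mul_off_two (c := 0) (d := 0) (M := M)
      (f' := fun r => κ r * (y r - 2 * Ks r * x r)) c.r0_lt_r1.le
      (fun r hr => (hd r hr).continuousWithinAt)
      fun r hr _ _ => ⟨(hd r ⟨hr.1.le, hr.2.le⟩).hasDerivAt (Icc_mem_nhds hr.1 hr.2), by
        rw [norm_mul]
        exact mul_le_mul_of_nonneg_right (hM r ⟨hr.1.le, hr.2.le⟩) (norm_nonneg _)⟩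
    rw [h0, h.core, sub_self, norm_zero, zero_mul, norm_le_zero_iff, h1, sub_eq_zero] at hle
    exact hle
  · intro h1
    refine ⟨fun r => y r / (2 * x r), ?_, ?_, fun r hr => ?_⟩
    · have := hne _ hr0
      simp only [h.core]; field_simp
    · have := hne _ hr1
      simp only [h1]; field_simp
    · have h11 := (c.shell_pos r hr).1.ne'
      have hr' := (c.r0_pos.trans_le hr.1).ne'
      have hx := hne r hr
      refine ((h.deriv_y r hr).div ((h.deriv_x r hr).const_mul 2)
        (mul_ne_zero two_ne_zero hx)).congr_deriv ?_
      simp only [PlaneMaterial.C]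
      field_simp
      ring

end HydroShell

/-- The bulk modulus condition of a uniform shell. -/
theorem bulkCondition_iff_of_uniform {m : PlaneMaterial}
    (hm : ∀ r ∈ Icc c.r0 c.r1, c.shell r = m) {K μ β : ℝ}
    (hK : K = (Real.sqrt (m.C11 * m.C22) + m.C12) / 2)
    (hμ : μ = (Real.sqrt (m.C11 * m.C22) - m.C12) / 2) (hβ : β = Real.sqrt (m.C22 / m.C11)) :
    c.BulkCondition ↔
      c.Ke = (K * (μ + c.K0) - μ * (K - c.K0) * (c.r0 / c.r1) ^ (2 * β)) /
        (μ + c.K0 + (K - c.K0) * (c.r0 / c.r1) ^ (2 * β)) := by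
  have hr0m : c.r0 ∈ Icc c.r0 c.r1 := ⟨le_rfl, c.r0_lt_r1.le⟩
  obtain ⟨h11, -, h12, -⟩ : m.Positive := hm _ hr0m ▸ c.shell_pos _ hr0m
  have h22 : 0 < m.C22 := by
    by_contra hn
    nlinarith [mul_nonneg h11.le (neg_nonneg.2 (not_lt.1 hn)), sq_nonneg m.C12]
  have hs : |m.C12| < Real.sqrt (m.C11 * m.C22) := Real.lt_sqrt_of_sq_lt (by rwa [sq_abs])
  have hsβ : Real.sqrt (m.C11 * m.C22) = m.C11 * β := by
    have : m.C11 * m.C22 = m.C11 ^ 2 * (m.C22 / m.C11) := by field_simp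
    rw [this, Real.sqrt_mul (sq_nonneg _), Real.sqrt_sq h11.le, hβ]
  have hβ2 : m.C22 = m.C11 * β ^ 2 := by
    rw [hβ, Real.sq_sqrt (div_pos h22 h11).le]; field_simp
  obtain ⟨hs1, hs2⟩ := abs_lt.1 hs
  have hKpos : 0 < K := by rw [hK]; linarith
  have hμpos : 0 < μ := by rw [hμ]; linarith
  have hβpos : 0 < β := by rw [hβ]; exact Real.sqrt_pos.2 (div_pos h22 h11)
  rw [hsβ] at hK hμ
  have hr0 := c.r0_pos
  have hr1 := c.r1_pos
  have hK0 := c.K0_pos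
  have hpow : ∀ s : ℝ, ∀ r ∈ Icc c.r0 c.r1, HasDerivWithinAt (fun r => (r / c.r0) ^ s)
      (1 / r * (s * (r / c.r0) ^ s)) (Icc c.r0 c.r1) r := by
    intro s r hr
    have hr' : 0 < r := hr0.trans_le hr.1
    refine ((((hasDerivAt_id r).div_const c.r0).rpow_const (p := s)
      (Or.inl (div_pos hr' hr0).ne')).congr_deriv ?_).hasDerivWithinAt
    simp only [id]
    rw [Real.rpow_sub_one (div_pos hr' hr0).ne']
    field_simp
  -- The Euler exponents are `±β`, with traction-to-displacement ratios `2 K` and `-2 μ`. The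
  -- weights `μ + K0` and `K - K0` are those for which `y = 2 K0 x` at `r0`.
  have hH : c.HydroShell
      (fun r => (μ + c.K0) * (r / c.r0) ^ β + (K - c.K0) * (r / c.r0) ^ (-β))
      (fun r => 2 * K * (μ + c.K0) * (r / c.r0) ^ β
        - 2 * μ * (K - c.K0) * (r / c.r0) ^ (-β)) := by
    refine ⟨fun r hr => ?_, fun r hr => ?_, ?_, ?_⟩
    · rw [hm r hr]
      refine (((hpow β r hr).const_mul _).add ((hpow (-β) r hr).const_mul _)).congr_deriv ?_
      rw [hK, hμ]
      field_simp
      ring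
    · rw [hm r hr]
      refine (((hpow β r hr).const_mul _).sub ((hpow (-β) r hr).const_mul _)).congr_deriv ?_
      rw [PlaneMaterial.C, hK, hμ, hβ2]
      field_simp
      ring
    · simp only [div_self hr0.ne', Real.one_rpow]; ring
    · simp only [div_self hr0.ne', Real.one_rpow]; linarith
  rw [hH.bulkCondition_iff]
  set s := (c.r1 / c.r0) ^ β with hsdef
  have hs0 : 0 < s := Real.rpow_pos_of_pos (div_pos hr1 hr0) _
  have hs1 : 1 < s := Real.one_lt_rpow ((one_lt_div hr0).2 c.r0_lt_r1) hβpos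
  have e1 : (c.r1 / c.r0) ^ (-β) = s⁻¹ := Real.rpow_neg (div_pos hr1 hr0).le _
  have e2 : (c.r0 / c.r1) ^ (2 * β) = (s ^ 2)⁻¹ := by
    rw [← inv_div, Real.inv_rpow (div_pos hr1 hr0).le, mul_comm, Real.rpow_mul (div_pos hr1 hr0).le,
      ← hsdef, Real.rpow_two]
  have ht : (s ^ 2)⁻¹ < 1 := inv_lt_one_of_one_lt₀ (by nlinarith)
  have ht0 : 0 < (s ^ 2)⁻¹ := by positivity
  -- With `t = (r0 / r1) ^ (2 β)` in `(0, 1)` the denominator is `μ + K t + K0 (1 - t)`.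
  have hden : 0 < μ + c.K0 + (K - c.K0) * (s ^ 2)⁻¹ := by nlinarith
  rw [e1, e2, eq_div_iff hden.ne']
  constructor
  · intro h
    field_simp at h ⊢
    linarith
  · intro h
    field_simp at h ⊢
    linarith

/-! ### Static fields of harmonic `0` -/

variable {v : ℝ → Fin 4 → ℂ} {n : ℕ} {R : ℝ}

theorem IsField.pair_core_eq (hv : c.IsField n 0 (Ioc 0 R) v) (hR : c.r0 ≤ R) {k : ℤ}
    {e : Fin 4 → ℂ} (he : ∀ r, (systemMatrix n 0 (.isotropic c.K0 c.μ0 c.ρ0) r).mulVec e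
      = (k : ℂ) • e) {r : ℝ} (hr : r ∈ Ioc 0 c.r0) :
    pair ((c.r0 : ℂ) ^ k • e) (v c.r0) = pair ((r : ℂ) ^ k • e) (v r) :=
  pair_eq_of_solvesAt (p := fun s : ℝ => (s : ℂ) ^ k • e) (v := v)
    (mat := fun _ => .isotropic c.K0 c.μ0 c.ρ0) (c := 0) (d := 0) hr.1 hr.2
    ((continuousOn_zpow_smul k e).mono fun s hs => hr.1.trans_le hs.1)
    (hv.1.mono fun s hs => ⟨hr.1.trans_le hs.1, hs.2.trans hR⟩) fun s hs _ _ => by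
      refine ⟨solvesAt_zpow k (hr.1.trans hs.1).ne' (he s), ?_⟩
      have := hv.solvesAt ⟨hr.1.trans hs.1, hs.2.trans_le hR⟩ hs.2.ne (hs.2.trans c.r0_lt_r1).ne
      rwa [c.material_core hs.2] at this

theorem IsField.pair_core_eq_zero (hv : c.IsField n 0 (Ioc 0 R) v) (hR : c.r0 ≤ R) {k : ℕ}
    (hk : k ≠ 0) {e : Fin 4 → ℂ}
    (he : ∀ r, (systemMatrix n 0 (.isotropic c.K0 c.μ0 c.ρ0) r).mulVec e = ((k : ℤ) : ℂ) • e)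
    {r : ℝ} (hr : r ∈ Ioc 0 c.r0) : pair ((r : ℂ) ^ (k : ℤ) • e) (v r) = 0 := by
  obtain ⟨B, hB⟩ := hv.2.2
  have lim : Tendsto (fun r : ℝ => pair ((r : ℂ) ^ (k : ℤ) • e) (v r)) (𝓝[>] 0) (𝓝 0) := by
    refine squeeze_zero_norm' (a := fun r : ℝ => 4 * (r ^ k * ‖e‖ * B)) ?_ ?_
    · filter_upwards [Ioo_mem_nhdsGT c.r0_pos] with s hs
      refine (norm_pair_le _ _).trans ?_
      rw [norm_zpow_smul hs.1, zpow_natCast]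
      have := hB s hs
      have := hs.1
      gcongr
    · have : Continuous fun r : ℝ => 4 * (r ^ k * ‖e‖ * B) := by fun_prop
      have h := (this.tendsto 0).mono_left (nhdsWithin_le_nhds (s := Ioi 0))
      simpa [hk] using h
  rw [← hv.pair_core_eq hR he hr]
  refine tendsto_nhds_unique (tendsto_const_nhds (f := 𝓝[>] (0 : ℝ))) (lim.congr' ?_)
  filter_upwards [Ioo_mem_nhdsGT c.r0_pos] with s hs
    using (hv.pair_core_eq hR he ⟨hs.1, hs.2.le⟩).symm

theorem IsField.pair_ext_eq (hv : c.IsField n 0 (Ioc 0 R) v) {k : ℤ}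
    {e : Fin 4 → ℂ} (he : ∀ r, (systemMatrix n 0 c.ext r).mulVec e = (k : ℂ) • e) {r : ℝ}
    (hr : r ∈ Icc c.r1 R) :
    pair ((r : ℂ) ^ k • e) (v r) = pair ((c.r1 : ℂ) ^ k • e) (v c.r1) :=
  pair_eq_of_solvesAt (p := fun s : ℝ => (s : ℂ) ^ k • e) (v := v)
    (mat := fun _ => c.ext) (c := 0) (d := 0) c.r1_pos hr.1
    ((continuousOn_zpow_smul k e).mono fun s hs => c.r1_pos.trans_le hs.1)
    (hv.1.mono fun s hs => ⟨c.r1_pos.trans_le hs.1, hs.2.trans hr.2⟩) fun s hs _ _ => by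
      refine ⟨solvesAt_zpow k (c.r1_pos.trans hs.1).ne' (he s), ?_⟩
      have := hv.solvesAt ⟨c.r1_pos.trans hs.1, hs.2.trans_le hr.2⟩ (c.r0_lt_r1.trans hs.1).ne'
        hs.1.ne'
      rwa [c.material_ext hs.1] at this

theorem mulVec_zero_one {K μ : ℝ} (hK : 0 < K) (hμ : 0 < μ) (ρ r : ℝ) :
    (systemMatrix 0 0 (.isotropic K μ ρ) r).mulVec ![1, 0, 2 * (K : ℂ), 0] =
      ((1 : ℤ) : ℂ) • ![1, 0, 2 * (K : ℂ), 0] := by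
  have h1 : (K + μ : ℂ) ≠ 0 := by exact_mod_cast (add_pos hK hμ).ne'
  rw [systemMatrix_isotropic hK hμ]
  ext i
  fin_cases i <;> simp <;> field_simp <;> ring

theorem mulVec_zero_rot {K μ : ℝ} (hK : 0 < K) (hμ : 0 < μ) (ρ r : ℝ) :
    (systemMatrix 0 0 (.isotropic K μ ρ) r).mulVec ![0, 1, 0, 0] =
      ((1 : ℤ) : ℂ) • ![0, 1, 0, 0] := by
  rw [systemMatrix_isotropic hK hμ]
  ext i
  fin_cases i <;> simp

theorem mulVec_zero_negOne {K μ : ℝ} (hK : 0 < K) (hμ : 0 < μ) (ρ r : ℝ) :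
    (systemMatrix 0 0 (.isotropic K μ ρ) r).mulVec ![1, 0, -2 * (μ : ℂ), 0] =
      ((-1 : ℤ) : ℂ) • ![1, 0, -2 * (μ : ℂ), 0] := by
  have h1 : (K + μ : ℂ) ≠ 0 := by exact_mod_cast (add_pos hK hμ).ne'
  rw [systemMatrix_isotropic hK hμ]
  ext i
  fin_cases i <;> simp <;> field_simp <;> ring

theorem mulVec_zero_negOne_rot {K μ : ℝ} (hK : 0 < K) (hμ : 0 < μ) (ρ r : ℝ) :
    (systemMatrix 0 0 (.isotropic K μ ρ) r).mulVec ![0, 1, 0, -2 * (μ : ℂ)] =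
      ((-1 : ℤ) : ℂ) • ![0, 1, 0, -2 * (μ : ℂ)] := by
  have h2 : (μ : ℂ) ≠ 0 := by exact_mod_cast hμ.ne'
  rw [systemMatrix_isotropic hK hμ]
  ext i
  fin_cases i <;> simp <;> field_simp <;> ring

/-- In the core a field of harmonic `0` is an expansion and a rotation. -/
theorem IsField.zero_core (hv : c.IsField 0 0 (Ioc 0 R) v) (hR : c.r0 ≤ R) {r : ℝ}
    (hr : r ∈ Ioc 0 c.r0) : v r 2 = 2 * c.K0 * v r 0 ∧ v r 3 = 0 := by
  have hr' : (r : ℂ) ≠ 0 := by exact_mod_cast hr.1.ne'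
  have h1 := hv.pair_core_eq_zero hR one_ne_zero
    (mulVec_zero_one c.K0_pos c.μ0_pos c.ρ0) hr
  have h2 := hv.pair_core_eq_zero hR one_ne_zero
    (mulVec_zero_rot c.K0_pos c.μ0_pos c.ρ0) hr
  rw [pair_smul_left] at h1 h2
  simp [pair, hr'] at h1 h2
  exact ⟨by linear_combination h1, h2⟩

/-- The rotational component carries no traction in the core and does no work. The radial
displacement is linear in `r`, with slope fixed by the conserved pairing with the `r⁻¹` solution. -/
theorem IsField.zero_tendsto_work (hv : c.IsField 0 0 (Ioc 0 R) v) (hR : c.r0 ≤ R) :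
    Tendsto (fun r => work (v r)) (𝓝[>] 0) (𝓝 0) := by
  have hK : (c.K0 + c.μ0 : ℂ) ≠ 0 := by exact_mod_cast (add_pos c.K0_pos c.μ0_pos).ne'
  set k := pair ((c.r0 : ℂ) ^ (-1 : ℤ) • ![1, 0, -2 * (c.μ0 : ℂ), 0]) (v c.r0) with hk
  have hlim : Tendsto (fun r : ℝ => work ![k / (2 * (c.K0 + c.μ0)) * r, 0,
      2 * c.K0 * (k / (2 * (c.K0 + c.μ0)) * r), 0]) (𝓝[>] 0) (𝓝 0) := by
    refine tendsto_work_zero ?_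
    have : Continuous fun r : ℝ => (r : ℂ) • ![k / (2 * (c.K0 + c.μ0)), 0,
      2 * c.K0 * (k / (2 * (c.K0 + c.μ0))), 0] := by fun_prop
    refine (((this.tendsto 0).mono_left nhdsWithin_le_nhds).congr fun r => ?_).trans_eq (by simp)
    ext i
    fin_cases i <;> simp <;> ring
  refine hlim.congr' ?_
  filter_upwards [Ioo_mem_nhdsGT c.r0_pos] with r hr
  have hr' : (r : ℂ) ≠ 0 := by exact_mod_cast hr.1.ne'
  obtain ⟨h2, h3⟩ := hv.zero_core hR ⟨hr.1, hr.2.le⟩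
  have h0 := hv.pair_core_eq hR (mulVec_zero_negOne c.K0_pos c.μ0_pos c.ρ0) ⟨hr.1, hr.2.le⟩
  rw [← hk, pair_smul_left] at h0
  simp [pair, h2] at h0
  have : v r 0 = k / (2 * (c.K0 + c.μ0)) * r := by
    rw [h0]; field_simp
  simp only [work, h2, h3, this]
  simp

/-- The radial part of a field of harmonic `0` is a field. -/
theorem IsField.zero_radial {S : Set ℝ} (hv : c.IsField 0 0 S v) :
    c.IsField 0 0 S (fun r => ![v r 0, 0, v r 2, 0]) := by
  have hle : ∀ z : Fin 4 → ℂ, ‖![z 0, 0, z 2, 0]‖ ≤ ‖z‖ := by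
    intro z
    rw [pi_norm_le_iff_of_nonneg (norm_nonneg _)]
    intro i
    fin_cases i <;> simp [norm_le_pi_norm]
  refine ⟨?_, fun r hr h0 h1 => ?_, ?_⟩
  · have h := continuousOn_pi.1 hv.1
    refine continuousOn_pi.2 fun i => ?_
    fin_cases i
    · exact h 0
    · exact continuousOn_const
    · exact h 2
    · exact continuousOn_const
  · have := hv.2.1 r hr h0 h1
    change SolvesAt _ _ _ _ _ at this
    change SolvesAt _ _ _ _ _
    rw [solvesAt_iff] at this ⊢
    obtain ⟨d0, -, d2, -⟩ := this
    refine ⟨?_, ?_, ?_, ?_⟩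
    · refine d0.congr_deriv ?_; simp
    · refine (hasDerivAt_const r (0 : ℂ)).congr_deriv ?_; simp
    · refine d2.congr_deriv ?_; simp
    · refine (hasDerivAt_const r (0 : ℂ)).congr_deriv ?_; simp
  · obtain ⟨B, hB⟩ := hv.2.2
    exact ⟨B, fun r hr => (hle _).trans (hB r hr)⟩

theorem exists_ext_zero (c : CoreShell) (z : Fin 4 → ℂ) :
    ∃ f : ℝ → Fin 4 → ℂ, f c.r1 = z ∧ ContinuousOn f (Ioi 0) ∧
      ∀ r, 0 < r → SolvesAt 0 0 c.ext f r := by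
  have hK := c.Ke_pos
  have hμ := c.μe_pos
  have h1 : (c.Ke + c.μe : ℂ) ≠ 0 := by exact_mod_cast (add_pos hK hμ).ne'
  have h2 : (c.μe : ℂ) ≠ 0 := by exact_mod_cast hμ.ne'
  have h3 : (c.r1 : ℂ) ≠ 0 := by exact_mod_cast c.r1_pos.ne'
  set a := (z 2 + 2 * c.μe * z 0) / (2 * (c.Ke + c.μe)) / c.r1 with ha
  set b := (2 * c.Ke * z 0 - z 2) / (2 * (c.Ke + c.μe)) * c.r1 with hb
  set d := (z 1 + z 3 / (2 * c.μe)) / c.r1 with hd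
  set e := -(z 3 / (2 * c.μe)) * c.r1 with he
  refine ⟨fun r => a • ((r : ℂ) ^ (1 : ℤ) • ![1, 0, 2 * (c.Ke : ℂ), 0])
    + b • ((r : ℂ) ^ (-1 : ℤ) • ![1, 0, -2 * (c.μe : ℂ), 0])
    + d • ((r : ℂ) ^ (1 : ℤ) • ![0, 1, 0, 0])
    + e • ((r : ℂ) ^ (-1 : ℤ) • ![0, 1, 0, -2 * (c.μe : ℂ)]), ?_, ?_, fun r hr => ?_⟩
  · ext i
    fin_cases i <;> simp [ha, hb, hd, he] <;> field_simp <;> ring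
  · exact ((((continuousOn_zpow_smul _ _).const_smul a).add
      ((continuousOn_zpow_smul _ _).const_smul b)).add
      ((continuousOn_zpow_smul _ _).const_smul d)).add ((continuousOn_zpow_smul _ _).const_smul e)
  · exact ((((solvesAt_zpow 1 hr.ne' (mulVec_zero_one hK hμ c.ρe r)).smul a).add
      ((solvesAt_zpow (-1) hr.ne' (mulVec_zero_negOne hK hμ c.ρe r)).smul b)).add
      ((solvesAt_zpow 1 hr.ne' (mulVec_zero_rot hK hμ c.ρe r)).smul d)).add
      ((solvesAt_zpow (-1) hr.ne' (mulVec_zero_negOne_rot hK hμ c.ρe r)).smul e)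

/-- A real static field of harmonic `0` that spans all of them up to rotations. -/
theorem exists_hydroShell_isField (c : CoreShell) : ∃ x y : ℝ → ℝ, c.HydroShell x y ∧
    c.IsField 0 0 (Ioi 0) (fun r => ![(x r : ℂ), 0, (y r : ℂ), 0]) := by
  have hr0 : (c.r0 : ℂ) ≠ 0 := by exact_mod_cast c.r0_pos.ne'
  obtain ⟨v, hv, hcore, hsh⟩ := exists_isField_of_core c 0 c.exists_ext_zero
    (f := fun r : ℝ => (r : ℂ) ^ (1 : ℤ) • ![1, 0, 2 * (c.K0 : ℂ), 0])
    (continuousOn_zpow_smul _ _) (by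
      have : Continuous fun r : ℝ => (r : ℂ) • ![1, 0, 2 * (c.K0 : ℂ), 0] := by fun_prop
      refine (((this.tendsto 0).mono_left nhdsWithin_le_nhds).congr fun r => ?_).trans_eq (by simp)
      rw [zpow_one])
    (fun r hr => solvesAt_zpow 1 hr.ne' (mulVec_zero_one c.K0_pos c.μ0_pos c.ρ0 r))
  have hv0 := hcore c.r0 ⟨c.r0_pos, le_rfl⟩
  -- The core field is real and a static field is determined beyond `r0` by its value there, so the
  -- continuation agrees with its conjugate.
  have hreal : ∀ r, 0 < r → star (v r) = v r := by
    intro r hr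
    rcases le_total r c.r0 with h | h
    · rw [hcore r ⟨hr, h⟩]
      ext i
      fin_cases i <;> simp
    · have := ((hv.conj.sub hv).mono (Ioc_subset_Ioi_self : Ioc 0 r ⊆ Ioi 0)).eq_zero_of_eq_zero_core
        (by
          rw [hv0, sub_eq_zero]
          ext i
          fin_cases i <;> simp) (r := r) ⟨h, le_rfl⟩
      rwa [sub_eq_zero] at this
  have hre : ∀ r, 0 < r → ∀ i, ((v r i).re : ℂ) = v r i := fun r hr i =>
    Complex.conj_eq_iff_re.1 (congrFun (hreal r hr) i)
  refine ⟨fun r => (v r 0).re, fun r => (v r 2).re, ⟨fun r hr => ?_, fun r hr => ?_, ?_, ?_⟩, ?_⟩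
  · have h := (hasDerivWithinAt_pi.1 (hsh r hr)) 0
    have h' := Complex.reCLM.hasFDerivAt.comp_hasDerivWithinAt r h
    refine HasDerivWithinAt.congr_deriv (f := fun r => (v r 0).re) h' ?_
    have hr' : 0 < r := c.r0_pos.trans_le hr.1
    rw [fieldOp_apply, systemMatrix_mulVec, ← Complex.ofReal_inj]
    simp [PlaneMaterial.γ]
  · have h := (hasDerivWithinAt_pi.1 (hsh r hr)) 2
    have h' := Complex.reCLM.hasFDerivAt.comp_hasDerivWithinAt r h
    refine HasDerivWithinAt.congr_deriv (f := fun r => (v r 2).re) h' ?_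
    have hr' : 0 < r := c.r0_pos.trans_le hr.1
    rw [fieldOp_apply, systemMatrix_mulVec, ← Complex.ofReal_inj]
    simp [PlaneMaterial.γ]
  · simp [hv0]
    ring
  · simp [hv0, c.r0_pos]
  · have hrad := hv.zero_radial
    have heq : ∀ r, 0 < r → ![((v r 0).re : ℂ), 0, ((v r 2).re : ℂ), 0] = ![v r 0, 0, v r 2, 0] :=
      fun r hr => by rw [hre r hr, hre r hr]
    refine ⟨hrad.1.congr heq, fun r hr h0 h1 => ?_, ?_⟩
    · have hr' : 0 < r := by rwa [interior_Ioi] at hr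
      have := hrad.2.1 r hr h0 h1
      simp only [heq r hr']
      refine this.congr_of_eventuallyEq ?_
      filter_upwards [Ioi_mem_nhds hr'] with s hs using heq s hs
    · obtain ⟨B, hB⟩ := hrad.2.2
      exact ⟨B, fun r hr => (congrArg norm (heq r hr.1)).trans_le (hB r hr)⟩

/-- Every static field of harmonic `0` has a multiple of a given one as its radial part. -/
theorem IsField.exists_radial_eq (hv : c.IsField 0 0 (Ioc 0 R) v) (hR : c.r0 ≤ R) {x y : ℝ → ℝ}
    (hs : c.HydroShell x y) (hf : c.IsField 0 0 (Ioi 0) (fun r => ![(x r : ℂ), 0, (y r : ℂ), 0])) :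
    ∃ a : ℂ, ∀ r ∈ Icc c.r0 R, v r 0 = a * x r ∧ v r 2 = a * y r := by
  have hx : (x c.r0 : ℂ) ≠ 0 := by exact_mod_cast hs.pos.ne'
  refine ⟨v c.r0 0 / x c.r0, fun r hr => ?_⟩
  have h2 := (hv.zero_core hR ⟨c.r0_pos, le_rfl⟩).1
  have hz := (hv.zero_radial.sub ((hf.mono Ioc_subset_Ioi_self).smul (v c.r0 0 / x c.r0)))
    |>.eq_zero_of_eq_zero_core (by
      ext i
      fin_cases i <;> simp [h2, hs.core] <;> field_simp <;> ring) hr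
  have e0 := congrFun hz 0
  have e2 := congrFun hz 2
  simp [sub_eq_zero] at e0 e2
  exact ⟨e0, e2⟩

/-- The radial part in the exterior. -/
theorem hydro_ext {x y : ℝ → ℝ}
    (hf : c.IsField 0 0 (Ioi 0) (fun r => ![(x r : ℂ), 0, (y r : ℂ), 0])) {r : ℝ} (hr : c.r1 ≤ r) :
    r * (y r - 2 * c.Ke * x r) = c.r1 * (y c.r1 - 2 * c.Ke * x c.r1) ∧
    (y r + 2 * c.μe * x r) / r = (y c.r1 + 2 * c.μe * x c.r1) / c.r1 := by
  have hv := hf.mono (Ioc_subset_Ioi_self : Ioc 0 r ⊆ Ioi 0)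
  -- The two exterior invariants are the pairings with the growing and the decaying radial
  -- solutions; the first measures the decaying part of the field, the second its growing part.
  have h1 := hv.pair_ext_eq (mulVec_zero_one c.Ke_pos c.μe_pos c.ρe) ⟨hr, le_rfl⟩
  have h2 := hv.pair_ext_eq (mulVec_zero_negOne c.Ke_pos c.μe_pos c.ρe) ⟨hr, le_rfl⟩
  rw [pair_smul_left, pair_smul_left] at h1 h2
  simp [pair] at h1 h2
  norm_cast at h1 h2
  exact ⟨h1, by rw [div_eq_inv_mul, div_eq_inv_mul]; linarith⟩

end CoreShell

namespace CoreShell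

variable {c : CoreShell}

/-! ### Strong neutral inclusions -/

/-- The load has exterior coefficients `(α / r1, 0, 0, 0)`, so an unperturbed field must be `(α /
r1) p`. The amplitude `r1` gives `p` itself. -/
theorem forall_unperturbed_shear_iff (b : c.StaticBasis) :
    (∀ α, c.Unperturbed 2 (c.shearLoad α)) ↔ b.p2 = 0 ∧ b.p3 = 0 := by
  have hr1 : (c.r1 : ℂ) ≠ 0 := by exact_mod_cast c.r1_pos.ne'
  constructor
  · intro h
    obtain ⟨v, hv, he⟩ := h c.r1
    have hr : c.r1 < c.r1 + 1 := by linarith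
    have := b.coeff_of_isField hr (hv.mono Ioc_subset_Ioi_self) ⟨hr, le_rfl⟩
      ((he _ hr).trans (shearLoad_eq c _ _))
    simp [hr1] at this
    exact ⟨this.1.symm, this.2.symm⟩
  · rintro ⟨h2, h3⟩ α
    refine ⟨_, b.isField_comb (α / c.r1) 0, fun r hr => ?_⟩
    rw [b.comb_ext _ _ hr.le, shearLoad_eq, h2, h3]
    simp

/-- The radial part of a field is a multiple of `(x, y)`, whose decaying exterior part is
proportional to the invariant `r (y - 2 Ke x)`. It has to vanish for the load to be unperturbed, and
if it does, rescaling `(x, y)` matches the load. -/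
theorem forall_unperturbed_hydro_iff {x y : ℝ → ℝ} (hs : c.HydroShell x y)
    (hf : c.IsField 0 0 (Ioi 0) (fun r => ![(x r : ℂ), 0, (y r : ℂ), 0])) :
    (∀ α, c.Unperturbed 0 (c.hydrostaticLoad α)) ↔ y c.r1 = 2 * c.Ke * x c.r1 := by
  have hr1 : (c.r1 : ℂ) ≠ 0 := by exact_mod_cast c.r1_pos.ne'
  have hx1 : x c.r1 ≠ 0 := fun e => by
    have := hs.mul_pos ⟨c.r0_lt_r1.le, le_rfl⟩
    simp [e] at this
  have hKμ : c.Ke + c.μe ≠ 0 := (add_pos c.Ke_pos c.μe_pos).ne'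
  constructor
  · intro h
    obtain ⟨v, hv, he⟩ := h c.r1
    set R := c.r1 + 1
    have hR : c.r1 < R := by simp [R]
    have hR0 : 0 < R := c.r1_pos.trans hR
    have hv' := hv.mono (Ioc_subset_Ioi_self : Ioc 0 R ⊆ Ioi 0)
    obtain ⟨a, ha⟩ := hv'.exists_radial_eq (c.r0_lt_r1.trans hR).le hs hf
    obtain ⟨h0, h2⟩ := ha R ⟨(c.r0_lt_r1.trans hR).le, le_rfl⟩
    rw [he R hR] at h0 h2
    have hcancel : (c.r1 : ℂ) * (R / c.r1) = R := by field_simp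
    simp [hydrostaticLoad, hcancel] at h0 h2
    have hRc : (R : ℂ) ≠ 0 := by exact_mod_cast hR0.ne'
    have ha0 : a ≠ 0 := fun e => hRc (by rw [h0, e, zero_mul])
    have e : (y R : ℂ) = 2 * c.Ke * x R := by
      refine mul_left_cancel₀ ha0 ?_
      rw [← h2, h0]; ring
    have e' : y R = 2 * c.Ke * x R := by exact_mod_cast e
    obtain ⟨g1, -⟩ := hydro_ext hf hR.le
    rw [e', sub_self, mul_zero] at g1
    have := (mul_eq_zero.1 g1.symm).resolve_left c.r1_pos.ne'
    linarith
  · intro h α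
    refine ⟨_, hf.smul (α / x c.r1), fun r hr => ?_⟩
    have hr0 : 0 < r := c.r1_pos.trans hr
    obtain ⟨g1, g2⟩ := hydro_ext hf hr.le
    rw [h, sub_self, mul_zero] at g1
    have e1 : y r = 2 * c.Ke * x r := by
      have := (mul_eq_zero.1 g1).resolve_left hr0.ne'
      linarith
    have e2 : x r = x c.r1 * (r / c.r1) := by
      rw [e1, h] at g2
      have := c.r1_pos.ne'
      field_simp at g2 ⊢
      linarith
    have hx1' : (x c.r1 : ℂ) ≠ 0 := by exact_mod_cast hx1
    rw [e1, e2]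
    ext i
    fin_cases i <;> simp [hydrostaticLoad] <;> field_simp

/-! ### Weak neutral inclusions -/

/-- At equal displacements a difference of quadratic works becomes a reciprocity form, whose value
is known from the exterior coefficients. -/
theorem work_sub_work {w l : Fin 4 → ℂ} (h0 : w 0 = l 0) (h1 : w 1 = l 1) :
    work w - work l = (pair (star l) w).re := by
  simp [work, pair, h0, h1]
  ring

/-- The energy stored by replacing the matrix by the composite, at fixed boundary displacement, is
a reciprocity form of the two fields. -/
theorem IsField.strainEnergy_sub {n : ℕ} {w L : ℝ → Fin 4 → ℂ} {R : ℝ}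
    (hw : c.IsField n 0 (Ioc 0 R) w) (hR : 0 < R)
    (hw0 : Tendsto (fun r => work (w r)) (𝓝[>] 0) (𝓝 0))
    (hLc : ContinuousOn L (Ioi 0)) (hL : ∀ r, 0 < r → SolvesAt n 0 c.ext L r)
    (hL0 : Tendsto L (𝓝[>] 0) (𝓝 0)) (h0 : w R 0 = L R 0) (h1 : w R 1 = L R 1) :
    strainEnergy n c.material R w - strainEnergy n (fun _ => c.ext) R L =
      Real.pi * (pair (star (L R)) (w R)).re := by
  rw [hw.strainEnergy_eq hR hw0, _root_.strainEnergy_eq (c := 0) (d := 0) hR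
    (hLc.mono Ioc_subset_Ioi_self) (fun r hr _ _ => ⟨c.ext_positive, hL r hr.1⟩)
    (tendsto_work_zero hL0), ← mul_sub, work_sub_work h0 h1]

theorem det_ne_zero_of_injective {a b c d : ℂ}
    (h : ∀ s t : ℂ, s * a + t * b = 0 → s * c + t * d = 0 → s = 0 ∧ t = 0) :
    a * d - c * b ≠ 0 := by
  intro hd
  obtain ⟨-, h2⟩ := h b (-a) (by ring) (by linear_combination -hd)
  obtain ⟨-, h4⟩ := h d (-c) (by linear_combination hd) (by ring)
  exact one_ne_zero (h 1 0 (by simpa using h2) (by simpa using h4)).1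

/-! ### Shear displacement prescribed on a large circle -/

namespace StaticBasis

variable (b : c.StaticBasis)

/-- The radial displacement of `p` over that of uniform shear, as a function of `u = r⁻²`. -/
noncomputable def m00 (u : ℂ) : ℂ := 1 + b.p2 * u / (2 * c.μe) + b.p3 * u ^ 2 / (12 * c.μe)

/-- The radial displacement of `q`, over `r ^ 3`. -/
noncomputable def m01 (u : ℂ) : ℂ :=
  (c.Ke - c.μe) + b.q2 * u ^ 2 / (2 * c.μe) + b.q3 * u ^ 3 / (12 * c.μe)

/-- The angular displacement of `p` over that of uniform shear. -/
noncomputable def m10 (u : ℂ) : ℂ :=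
  1 + b.p2 * u / (2 * (c.Ke + c.μe)) - b.p3 * u ^ 2 / (12 * c.μe)

/-- The angular displacement of `q`, over `r ^ 3`. -/
noncomputable def m11 (u : ℂ) : ℂ :=
  (2 * c.Ke + c.μe) + b.q2 * u ^ 2 / (2 * (c.Ke + c.μe)) - b.q3 * u ^ 3 / (12 * c.μe)

theorem disp_comb (x y : ℂ) {r : ℝ} (hr : c.r1 ≤ r) :
    (x • b.p r + y • b.q r) 0 =
      r * (x * b.m00 (((r : ℂ) ^ 2)⁻¹) + y * (r : ℂ) ^ 2 * b.m01 (((r : ℂ) ^ 2)⁻¹)) ∧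
    (x • b.p r + y • b.q r) 1 =
      r * (x * b.m10 (((r : ℂ) ^ 2)⁻¹) + y * (r : ℂ) ^ 2 * b.m11 (((r : ℂ) ^ 2)⁻¹)) := by
  have h1 : (c.Ke + c.μe : ℂ) ≠ 0 := by exact_mod_cast (add_pos c.Ke_pos c.μe_pos).ne'
  have h2 : (c.μe : ℂ) ≠ 0 := by exact_mod_cast c.μe_pos.ne'
  have h3 : (r : ℂ) ≠ 0 := by exact_mod_cast (c.r1_pos.trans_le hr).ne'
  rw [b.comb_ext x y hr]
  constructor
  · simp [isoField, vecOne, vecThree, vecNegOne, vecNegThree, m00, m01, zpow_neg, zpow_ofNat]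
    field_simp
    ring
  · simp [isoField, vecOne, vecThree, vecNegOne, vecNegThree, m10, m11, zpow_neg, zpow_ofNat]
    field_simp
    ring

/-- The determinant of the displacement boundary value problem. -/
noncomputable def det (u : ℂ) : ℂ := b.m00 u * b.m11 u - b.m10 u * b.m01 u

/-- A kernel vector would give a field with zero displacement at `R`, so with zero work there, hence
the zero field. The factor `R ^ 2` accounts for the growth of `q` relative to `p`. -/
theorem det_ne_zero {R : ℝ} (hR : c.r1 < R) : b.det (((R : ℂ) ^ 2)⁻¹) ≠ 0 := by
  have hR0 := c.r1_pos.trans hR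
  have hRc : (R : ℂ) ≠ 0 := by exact_mod_cast hR0.ne'
  refine det_ne_zero_of_injective fun s t h0 h1 => ?_
  have e : t / (R : ℂ) ^ 2 * (R : ℂ) ^ 2 = t := by field_simp
  obtain ⟨d0, d1⟩ := b.disp_comb s (t / (R : ℂ) ^ 2) hR.le
  rw [e, h0, mul_zero] at d0
  rw [e, h1, mul_zero] at d1
  have hz := ((b.isField_comb s (t / (R : ℂ) ^ 2)).mono
    (Ioc_subset_Ioi_self : Ioc 0 R ⊆ Ioi 0)).eq_zero_of_work_nonpos (c.r0_lt_r1.trans hR).le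
    (by rw [work, d0, d1]; simp) (r := R) ⟨hR0, le_rfl⟩
  rw [b.comb_ext _ _ hR.le] at hz
  have h0' : isoField c.Ke c.μe 0 R = 0 := by simp [isoField]
  have e := isoField_injective c.Ke_pos c.μe_pos hR0.ne' (hz.trans h0'.symm)
  have e0 := congrFun e 0
  have e1 := congrFun e 1
  simp [hRc] at e0 e1
  exact ⟨e0, e1⟩

/-- The coefficients of the solution of the displacement boundary value problem of shear. -/
theorem coeff_of_disp {R : ℝ} (hR : c.r1 < R) {x y t : ℂ}
    (h0 : (x • b.p R + y • b.q R) 0 = t * R) (h1 : (x • b.p R + y • b.q R) 1 = t * R) :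
    x = t * (b.m11 (((R : ℂ) ^ 2)⁻¹) - b.m01 (((R : ℂ) ^ 2)⁻¹)) / b.det (((R : ℂ) ^ 2)⁻¹) ∧
    y = t * (b.m00 (((R : ℂ) ^ 2)⁻¹) - b.m10 (((R : ℂ) ^ 2)⁻¹)) / b.det (((R : ℂ) ^ 2)⁻¹)
      * ((R : ℂ) ^ 2)⁻¹ := by
  have hRc : (R : ℂ) ≠ 0 := by exact_mod_cast (c.r1_pos.trans hR).ne'
  have hd := b.det_ne_zero hR
  obtain ⟨d0, d1⟩ := b.disp_comb x y hR.le
  rw [h0, mul_comm, mul_right_inj' hRc] at d0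
  rw [h1, mul_comm, mul_right_inj' hRc] at d1
  set u := ((R : ℂ) ^ 2)⁻¹ with hu
  have hyu : y = y * (R : ℂ) ^ 2 * u := by rw [hu]; field_simp
  constructor
  · rw [eq_div_iff hd, det]
    linear_combination (-b.m11 u) * d0 + b.m01 u * d1
  · rw [hyu]
    congr 1
    rw [eq_div_iff hd, det]
    linear_combination (-b.m00 u) * d1 + b.m10 u * d0

theorem exists_isField_disp {R : ℝ} (hR : c.r1 < R) (t : ℂ) :
    ∃ x y : ℂ, (x • b.p R + y • b.q R) 0 = t * R ∧ (x • b.p R + y • b.q R) 1 = t * R := by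
  have hRc : (R : ℂ) ≠ 0 := by exact_mod_cast (c.r1_pos.trans hR).ne'
  have hd := b.det_ne_zero hR
  refine ⟨t * (b.m11 (((R : ℂ) ^ 2)⁻¹) - b.m01 (((R : ℂ) ^ 2)⁻¹)) / b.det (((R : ℂ) ^ 2)⁻¹),
    t * (b.m00 (((R : ℂ) ^ 2)⁻¹) - b.m10 (((R : ℂ) ^ 2)⁻¹)) / b.det (((R : ℂ) ^ 2)⁻¹)
      * ((R : ℂ) ^ 2)⁻¹, ?_⟩
  obtain ⟨d0, d1⟩ := b.disp_comb (t * (b.m11 (((R : ℂ) ^ 2)⁻¹) - b.m01 (((R : ℂ) ^ 2)⁻¹)) /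
    b.det (((R : ℂ) ^ 2)⁻¹)) (t * (b.m00 (((R : ℂ) ^ 2)⁻¹) - b.m10 (((R : ℂ) ^ 2)⁻¹)) /
    b.det (((R : ℂ) ^ 2)⁻¹) * ((R : ℂ) ^ 2)⁻¹) hR.le
  rw [d0, d1]
  set u := ((R : ℂ) ^ 2)⁻¹ with hu
  have e : u * (R : ℂ) ^ 2 = 1 := by rw [hu]; field_simp
  simp only [mul_assoc _ u, e]
  constructor
  · field_simp
    rw [det]; ring
  · field_simp
    rw [det]; ring

end StaticBasis

/-- Write `w R = X p + Y q` and `t = α / r1`. The load has only the coefficient of exponent `1`, so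
its pairing with `w R` sees only the `r⁻¹` coefficient `X p2 + Y q2`. By Cramer's rule, with
determinant tending to `Ke + 2 μe`, `X → t` and `Y → 0`. -/
theorem tendsto_strainEnergy_shear (b : c.StaticBasis) (α : ℂ) {w : ℝ → ℝ → Fin 4 → ℂ}
    (hw : ∀ R, c.r1 < R → c.IsField 2 0 (Ioc 0 R) (w R) ∧
      w R R 0 = c.shearLoad α R 0 ∧ w R R 1 = c.shearLoad α R 1) :
    Tendsto (fun R => strainEnergy 2 c.material R (w R) -
      strainEnergy 2 (fun _ => c.ext) R (c.shearLoad α)) atTop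
      (𝓝 (Real.pi * (-2 * (‖α / c.r1‖ ^ 2 * b.p2.re)))) := by
  have hfun : c.shearLoad α = isoField c.Ke c.μe ![α / c.r1, 0, 0, 0] :=
    funext (shearLoad_eq c α)
  set t := α / c.r1 with ht
  set X : ℝ → ℂ := fun R =>
    t * (b.m11 (((R : ℂ) ^ 2)⁻¹) - b.m01 (((R : ℂ) ^ 2)⁻¹)) / b.det (((R : ℂ) ^ 2)⁻¹) with hX
  set Y : ℝ → ℂ := fun R => t * (b.m00 (((R : ℂ) ^ 2)⁻¹) - b.m10 (((R : ℂ) ^ 2)⁻¹)) /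
    b.det (((R : ℂ) ^ 2)⁻¹) * ((R : ℂ) ^ 2)⁻¹ with hY
  have hu : Tendsto (fun R : ℝ => ((R : ℂ) ^ 2)⁻¹) atTop (𝓝 0) := by
    rw [tendsto_zero_iff_norm_tendsto_zero]
    refine (tendsto_inv_atTop_zero.comp (tendsto_pow_atTop (α := ℝ) two_ne_zero)).congr fun R => ?_
    simp
  have hKμ : (c.Ke + 2 * c.μe : ℂ) ≠ 0 := by
    exact_mod_cast (by linarith [c.Ke_pos, c.μe_pos] : 0 < c.Ke + 2 * c.μe).ne'
  have c00 : Continuous b.m00 := by unfold StaticBasis.m00; fun_prop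
  have c01 : Continuous b.m01 := by unfold StaticBasis.m01; fun_prop
  have c10 : Continuous b.m10 := by unfold StaticBasis.m10; fun_prop
  have c11 : Continuous b.m11 := by unfold StaticBasis.m11; fun_prop
  have l00 : Tendsto _ atTop (𝓝 (1 : ℂ)) :=
    ((c00.tendsto 0).comp hu).trans_eq (by simp [StaticBasis.m00])
  have l01 : Tendsto _ atTop (𝓝 (c.Ke - c.μe : ℂ)) :=
    ((c01.tendsto 0).comp hu).trans_eq (by simp [StaticBasis.m01])
  have l10 : Tendsto _ atTop (𝓝 (1 : ℂ)) :=
    ((c10.tendsto 0).comp hu).trans_eq (by simp [StaticBasis.m10])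
  have l11 : Tendsto _ atTop (𝓝 (2 * c.Ke + c.μe : ℂ)) :=
    ((c11.tendsto 0).comp hu).trans_eq (by simp [StaticBasis.m11])
  have ldet : Tendsto (fun R : ℝ => b.det (((R : ℂ) ^ 2)⁻¹)) atTop (𝓝 (c.Ke + 2 * c.μe : ℂ)) :=
    ((l00.mul l11).sub (l10.mul l01)).trans_eq (by congr 1; ring)
  have lX : Tendsto X atTop (𝓝 t) := by
    refine (((l11.sub l01).const_mul t).div ldet hKμ).trans_eq ?_
    congr 1
    field_simp
    ring
  have lY : Tendsto Y atTop (𝓝 0) := by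
    refine ((((l00.sub l10).const_mul t).div ldet hKμ).mul hu).trans_eq ?_
    simp
  have hE : ∀ R, c.r1 < R → strainEnergy 2 c.material R (w R) -
      strainEnergy 2 (fun _ => c.ext) R (c.shearLoad α) =
      Real.pi * (-2 * ((starRingEnd ℂ) t * (X R * b.p2 + Y R * b.q2))).re := by
    intro R hR
    have hR0 := c.r1_pos.trans hR
    obtain ⟨hf, h0, h1⟩ := hw R hR
    rw [hf.strainEnergy_sub hR0 (tendsto_work_zero (hf.tendsto_zero (c.r0_lt_r1.trans hR).le))
      (by rw [hfun]; exact continuousOn_isoField _ _ _)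
      (fun r hr => by rw [hfun]; exact solvesAt_isoField c.Ke_pos c.μe_pos _ _ hr.ne')
      (by rw [hfun]; exact tendsto_isoField_zero _ _ _ _) h0 h1]
    obtain ⟨x, y, hxy⟩ := b.span R hR _ hf
    have hxyR := hxy R ⟨hR0, le_rfl⟩
    have hL : c.shearLoad α R 0 = t * R ∧ c.shearLoad α R 1 = t * R := by
      rw [hfun]; simp [isoField, vecOne]
    obtain ⟨ex, ey⟩ := b.coeff_of_disp hR (x := x) (y := y) (t := t) (by rw [← hxyR, h0, hL.1])
      (by rw [← hxyR, h1, hL.2])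
    have hstar : star (c.shearLoad α R) =
        isoField c.Ke c.μe ![(starRingEnd ℂ) t, 0, 0, 0] R := by
      rw [hfun]
      ext i
      fin_cases i <;> simp [isoField, vecOne]
    rw [hstar, hxyR, b.comb_ext x y hR.le, pair_isoField c.Ke_pos c.μe_pos _ _ hR0.ne', ex, ey]
    congr 2
    simp [hX, hY]
  have hlim : Tendsto (fun R => Real.pi *
      (-2 * ((starRingEnd ℂ) t * (X R * b.p2 + Y R * b.q2))).re) atTop
      (𝓝 (Real.pi * (-2 * ((starRingEnd ℂ) t * (t * b.p2 + 0 * b.q2))).re)) :=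
    ((Complex.continuous_re.tendsto _).comp ((((lX.mul_const b.p2).add
      (lY.mul_const b.q2)).const_mul _).const_mul _)).const_mul _
  have hval : (-2 * ((starRingEnd ℂ) t * (t * b.p2 + 0 * b.q2))).re = -2 * (‖t‖ ^ 2 * b.p2.re) := by
    rw [zero_mul, add_zero, ← mul_assoc, ← mul_assoc, mul_assoc (-2 : ℂ), Complex.conj_mul']
    have : (-2 * (‖t‖ : ℂ) ^ 2 * b.p2) = ((-2 * ‖t‖ ^ 2 : ℝ) : ℂ) * b.p2 := by push_cast; ring
    rw [this, Complex.re_ofReal_mul]; ring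
  rw [hval] at hlim
  refine hlim.congr' ?_
  filter_upwards [eventually_gt_atTop c.r1] with R hR using (hE R hR).symm

theorem forall_energyEquivalent_shear_iff (b : c.StaticBasis) :
    (∀ α, c.EnergyEquivalent 2 (c.shearLoad α)) ↔ b.p2 = 0 := by
  have hr1 : (c.r1 : ℂ) ≠ 0 := by exact_mod_cast c.r1_pos.ne'
  constructor
  · intro h
    obtain ⟨w, hw, hlim⟩ := h c.r1
    have h0 := tendsto_nhds_unique hlim (tendsto_strainEnergy_shear b c.r1 hw)
    rw [div_self hr1] at h0
    have : b.p2.re = 0 := by simpa [Real.pi_ne_zero] using h0.symm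
    -- The energy detects only the real part of `p2`; reciprocity has already excluded an imaginary
    -- part.
    exact Complex.ext this b.p2_im
  · intro h α
    have hex : ∀ R, ∃ w : ℝ → Fin 4 → ℂ, c.r1 < R → c.IsField 2 0 (Ioc 0 R) w ∧
        w R 0 = c.shearLoad α R 0 ∧ w R 1 = c.shearLoad α R 1 := by
      intro R
      by_cases hR : c.r1 < R
      · obtain ⟨x, y, h0, h1⟩ := b.exists_isField_disp hR (α / c.r1)
        refine ⟨_, fun _ => ⟨(b.isField_comb x y).mono Ioc_subset_Ioi_self, h0.trans ?_,
          h1.trans ?_⟩⟩ <;> simp [shearLoad] <;> ring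
      · exact ⟨0, fun h => absurd h hR⟩
    choose w hw using hex
    refine ⟨w, hw, ?_⟩
    have := tendsto_strainEnergy_shear b α hw
    simpa [h] using this

/-- The radial part of `w R` is `a (x, y)`, and the boundary displacement gives `a ℓ R = α / r1`,
where `ℓ R = x R / R` converges to a nonzero limit. The pairing with the load is `a` times `conj α`
times the exterior invariant `A`. -/
theorem tendsto_strainEnergy_hydro {x y : ℝ → ℝ} (hs : c.HydroShell x y)
    (hf : c.IsField 0 0 (Ioi 0) (fun r => ![(x r : ℂ), 0, (y r : ℂ), 0])) (α : ℂ)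
    {w : ℝ → ℝ → Fin 4 → ℂ}
    (hw : ∀ R, c.r1 < R → c.IsField 0 0 (Ioc 0 R) (w R) ∧
      w R R 0 = c.hydrostaticLoad α R 0 ∧ w R R 1 = c.hydrostaticLoad α R 1) :
    ∃ ξ : ℝ, ξ ≠ 0 ∧ Tendsto (fun R => strainEnergy 0 c.material R (w R) -
      strainEnergy 0 (fun _ => c.ext) R (c.hydrostaticLoad α)) atTop
      (𝓝 (Real.pi * (‖α‖ ^ 2 * (ξ * (y c.r1 - 2 * c.Ke * x c.r1))))) := by
  have hKμ : 0 < c.Ke + c.μe := add_pos c.Ke_pos c.μe_pos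
  have hr1 : (c.r1 : ℂ) ≠ 0 := by exact_mod_cast c.r1_pos.ne'
  have hxy1 : 0 < x c.r1 * y c.r1 := hs.mul_pos ⟨c.r0_lt_r1.le, le_rfl⟩
  set A := y c.r1 - 2 * c.Ke * x c.r1 with hA
  set B := (y c.r1 + 2 * c.μe * x c.r1) / c.r1 with hB
  -- Otherwise `y = -2 μe x` at `r1`, contradicting `x y > 0`.
  have hB0 : B ≠ 0 := by
    intro h
    rw [hB, div_eq_zero_iff, or_iff_left c.r1_pos.ne'] at h
    have : y c.r1 = -(2 * c.μe * x c.r1) := by linarith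
    rw [this] at hxy1
    nlinarith [c.μe_pos, mul_nonneg c.μe_pos.le (sq_nonneg (x c.r1))]
  have hxR : ∀ R, c.r1 < R → x R = (B - c.r1 * A / R ^ 2) / (2 * (c.Ke + c.μe)) * R := by
    intro R hR
    obtain ⟨g1, g2⟩ := hydro_ext hf hR.le
    have hR0 := (c.r1_pos.trans hR).ne'
    rw [← hA] at g1
    rw [← hB, div_eq_iff hR0] at g2
    field_simp
    linear_combination R * g2 - g1
  set ℓ : ℝ → ℝ := fun R => (B - c.r1 * A / R ^ 2) / (2 * (c.Ke + c.μe)) with hℓ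
  have hℓlim : Tendsto ℓ atTop (𝓝 (B / (2 * (c.Ke + c.μe)))) := by
    have h1 : Tendsto (fun R : ℝ => c.r1 * A / R ^ 2) atTop (𝓝 0) :=
      tendsto_const_nhds.div_atTop (tendsto_pow_atTop two_ne_zero)
    simpa using (h1.const_sub B).div_const (2 * (c.Ke + c.μe))
  have hlim0 : B / (2 * (c.Ke + c.μe)) ≠ 0 := div_ne_zero hB0 (by positivity)
  refine ⟨1 / (c.r1 * (B / (2 * (c.Ke + c.μe)))), by
    have := c.r1_pos.ne'; positivity, ?_⟩
  have hE : ∀ R, c.r1 < R → strainEnergy 0 c.material R (w R) -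
      strainEnergy 0 (fun _ => c.ext) R (c.hydrostaticLoad α) =
      Real.pi * (‖α‖ ^ 2 * (1 / (c.r1 * ℓ R) * A)) := by
    intro R hR
    have hR0 := c.r1_pos.trans hR
    have hRc : (R : ℂ) ≠ 0 := by exact_mod_cast hR0.ne'
    obtain ⟨hfR, h0, h1⟩ := hw R hR
    have hLfun : c.hydrostaticLoad α = fun r : ℝ =>
        (α / c.r1) • ((r : ℂ) ^ (1 : ℤ) • ![1, 0, 2 * (c.Ke : ℂ), 0]) := by
      ext r i
      fin_cases i <;> simp [hydrostaticLoad] <;> ring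
    rw [hfR.strainEnergy_sub hR0 (hfR.zero_tendsto_work (c.r0_lt_r1.trans hR).le)
      (by rw [hLfun]; exact (continuousOn_zpow_smul 1 ![1, 0, 2 * (c.Ke : ℂ), 0]).const_smul (α / c.r1 : ℂ))
      (fun r hr => by
        rw [hLfun]
        exact (solvesAt_zpow 1 hr.ne' (mulVec_zero_one c.Ke_pos c.μe_pos c.ρe r)).smul _)
      (by
        rw [hLfun]
        have : Continuous fun r : ℝ => (α / c.r1) • ((r : ℂ) • ![1, 0, 2 * (c.Ke : ℂ), 0]) := by
          fun_prop
        refine (((this.tendsto 0).mono_left nhdsWithin_le_nhds).congr fun r => ?_).trans_eq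
          (by simp)
        rw [zpow_one]) h0 h1]
    obtain ⟨a, ha⟩ := hfR.exists_radial_eq (c.r0_lt_r1.trans hR).le hs hf
    obtain ⟨a0, a2⟩ := ha R ⟨(c.r0_lt_r1.trans hR).le, le_rfl⟩
    have hg : (R : ℂ) * (y R - 2 * c.Ke * x R) = c.r1 * A := by
      have := (hydro_ext hf hR.le).1
      rw [← hA] at this
      exact_mod_cast this
    have hx : (x R : ℂ) = ℓ R * R := by exact_mod_cast hxR R hR
    have hae : a * ℓ R = α / c.r1 := by
      rw [h0, hx] at a0
      simp [hydrostaticLoad] at a0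
      refine mul_right_cancel₀ hRc ?_
      linear_combination -a0
    have hpair : pair (star (c.hydrostaticLoad α R)) (w R R) = (starRingEnd ℂ) α * a * A := by
      have e : pair (star (c.hydrostaticLoad α R)) (w R R) =
          (starRingEnd ℂ) α / c.r1 * a * (R * (y R - 2 * c.Ke * x R)) := by
        rw [hLfun]
        simp [pair, a0, a2]
        ring
      rw [e, hg]
      field_simp
    by_cases hα : α = 0
    · rw [hpair]; simp [hα]
    have hℓ0 : (ℓ R : ℂ) ≠ 0 := fun e => by
      rw [e, mul_zero] at hae
      exact div_ne_zero hα hr1 hae.symm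
    have hav : a = α / c.r1 / ℓ R := by rw [← hae]; field_simp
    rw [hpair, hav]
    have : (starRingEnd ℂ) α * (α / c.r1 / ℓ R) * A =
        ((‖α‖ ^ 2 * (1 / (c.r1 * ℓ R) * A) : ℝ) : ℂ) := by
      push_cast
      rw [← Complex.conj_mul']
      field_simp
    rw [this, Complex.ofReal_re]
  have hfinal : Tendsto (fun R => Real.pi * (‖α‖ ^ 2 * (1 / (c.r1 * ℓ R) * A))) atTop
      (𝓝 (Real.pi * (‖α‖ ^ 2 * (1 / (c.r1 * (B / (2 * (c.Ke + c.μe)))) * A)))) :=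
    (((tendsto_const_nhds.div (hℓlim.const_mul c.r1)
      (mul_ne_zero c.r1_pos.ne' hlim0)).mul_const A).const_mul _).const_mul _
  refine hfinal.congr' ?_
  filter_upwards [eventually_gt_atTop c.r1] with R hR using (hE R hR).symm

theorem forall_energyEquivalent_hydro_iff {x y : ℝ → ℝ} (hs : c.HydroShell x y)
    (hf : c.IsField 0 0 (Ioi 0) (fun r => ![(x r : ℂ), 0, (y r : ℂ), 0])) :
    (∀ α, c.EnergyEquivalent 0 (c.hydrostaticLoad α)) ↔ y c.r1 = 2 * c.Ke * x c.r1 := by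
  constructor
  · intro h
    obtain ⟨w, hw, hlim⟩ := h 1
    obtain ⟨ξ, hξ, hlim'⟩ := tendsto_strainEnergy_hydro hs hf 1 hw
    have h0 := tendsto_nhds_unique hlim hlim'
    have : y c.r1 - 2 * c.Ke * x c.r1 = 0 := by simpa [Real.pi_ne_zero, hξ] using h0.symm
    linarith
  · intro h α
    have hex : ∀ R, ∃ w : ℝ → Fin 4 → ℂ, c.r1 < R → c.IsField 0 0 (Ioc 0 R) w ∧
        w R 0 = c.hydrostaticLoad α R 0 ∧ w R 1 = c.hydrostaticLoad α R 1 := by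
      intro R
      have hfR := hf.mono (Ioc_subset_Ioi_self : Ioc 0 R ⊆ Ioi 0)
      refine ⟨_, fun hR => ⟨hfR.smul (α * (R / c.r1) / x R), ?_, ?_⟩⟩
      -- The work `x y` is positive at `r1` and nondecreasing beyond it.
      · have hx : (x R : ℂ) ≠ 0 := by
          have h1 := hfR.work_mono c.r1_pos hR.le le_rfl
          have h2 := hs.mul_pos (r := c.r1) ⟨c.r0_lt_r1.le, le_rfl⟩
          simp [work] at h1
          intro e
          have e' : x R = 0 := by exact_mod_cast e
          rw [e', zero_mul] at h1
          linarith
        simp [hydrostaticLoad]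
        field_simp
      · simp [hydrostaticLoad]
    choose w hw using hex
    refine ⟨w, hw, ?_⟩
    obtain ⟨ξ, hξ, hlim⟩ := tendsto_strainEnergy_hydro hs hf α hw
    simpa [h] using hlim

end CoreShell

/-! ### Entire power series -/

theorem contDiff_tsum_of_le_factorial {a : ℕ → ℝ} {M : ℝ}
    (ha : ∀ k, |a k| ≤ M / (k.factorial : ℝ)) : ContDiff ℝ 2 (fun t : ℝ => ∑' k, a k * t ^ k) := by
  have hrad : (FormalMultilinearSeries.ofScalars ℝ a).radius = ⊤ := by
    refine FormalMultilinearSeries.radius_eq_top_of_summable_norm _ fun r => ?_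
    refine Summable.of_nonneg_of_le (fun k => by positivity) (fun k => ?_)
      ((Real.summable_pow_div_factorial r).mul_left M)
    rw [FormalMultilinearSeries.ofScalars_norm, Real.norm_eq_abs]
    calc |a k| * (r : ℝ) ^ k ≤ M / (k.factorial : ℝ) * (r : ℝ) ^ k := by gcongr; exact ha k
      _ = M * ((r : ℝ) ^ k / (k.factorial : ℝ)) := by ring
  have h := (FormalMultilinearSeries.ofScalars ℝ a).hasFPowerSeriesOnBall (by simp [hrad])
  have h2 : AnalyticOnNhd ℝ (FormalMultilinearSeries.ofScalars ℝ a).sum univ := by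
    have := h.analyticOnNhd
    rwa [hrad, Metric.eball_top] at this
  have h3 : (FormalMultilinearSeries.ofScalars ℝ a).sum = fun t : ℝ => ∑' k, a k * t ^ k := by
    funext t
    exact (FormalMultilinearSeries.ofScalars_sum_eq a t).trans (by simp)
  rw [← h3]
  exact h2.contDiff

/-! ### Second order jets -/

/-- `a` is the value, the derivative and the second derivative of `F` at `z`. -/
def HasJet (F : ℝ → ℂ) (z : ℝ) (a : Fin 3 → ℂ) : Prop :=
  F z = a 0 ∧ ∃ F' : ℝ → ℂ, (∀ᶠ y in 𝓝 z, HasDerivAt F (F' y) y) ∧ F' z = a 1 ∧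
    HasDerivAt F' (a 2) z

namespace HasJet

variable {F G : ℝ → ℂ} {z : ℝ} {a b : Fin 3 → ℂ}

theorem congr_jet (h : HasJet F z a) (e : a = b) : HasJet F z b := e ▸ h

theorem congr (h : HasJet F z a) (e : G =ᶠ[𝓝 z] F) : HasJet G z a := by
  obtain ⟨h0, F', h1, h2, h3⟩ := h
  refine ⟨e.eq_of_nhds.trans h0, F', ?_, h2, h3⟩
  filter_upwards [h1, e.eventually_nhds] with y hy hy'
  exact hy.congr_of_eventuallyEq hy'

theorem add (h : HasJet F z a) (h' : HasJet G z b) : HasJet (fun y => F y + G y) z (a + b) := by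
  obtain ⟨h0, F', h1, h2, h3⟩ := h
  obtain ⟨g0, G', g1, g2, g3⟩ := h'
  refine ⟨by simp [h0, g0], fun y => F' y + G' y, ?_, by simp [h2, g2], h3.add g3⟩
  filter_upwards [h1, g1] with y hy hy' using hy.add hy'

theorem const_mul (h : HasJet F z a) (t : ℂ) : HasJet (fun y => t * F y) z (t • a) := by
  obtain ⟨h0, F', h1, h2, h3⟩ := h
  refine ⟨by simp [h0], fun y => t * F' y, ?_, by simp [h2], h3.const_mul t⟩
  filter_upwards [h1] with y hy using hy.const_mul t

theorem mul (h : HasJet F z a) (h' : HasJet G z b) : HasJet (fun y => F y * G y) z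
    ![a 0 * b 0, a 1 * b 0 + a 0 * b 1, a 2 * b 0 + 2 * (a 1 * b 1) + a 0 * b 2] := by
  obtain ⟨h0, F', h1, h2, h3⟩ := h
  obtain ⟨g0, G', g1, g2, g3⟩ := h'
  refine ⟨by simp [h0, g0], fun y => F' y * G y + F y * G' y, ?_, by simp [h0, h2, g0, g2], ?_⟩
  · filter_upwards [h1, g1] with y hy hy' using hy.mul hy'
  · refine ((h3.mul g1.self_of_nhds).add (h1.self_of_nhds.mul g3)).congr_deriv ?_
    simp [h0, h2, g0, g2]
    ring

theorem const (t : ℂ) : HasJet (fun _ => t) z ![t, 0, 0] :=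
  ⟨rfl, fun _ => 0, Eventually.of_forall fun y => hasDerivAt_const y t, rfl, hasDerivAt_const z 0⟩

theorem comp_mul {k : ℝ} (h : HasJet F (k * z) a) :
    HasJet (fun y => F (k * y)) z ![a 0, k * a 1, k ^ 2 * a 2] := by
  obtain ⟨h0, F', h1, h2, h3⟩ := h
  have hk : ∀ y, HasDerivAt (fun y => k * y) k y := fun y => by
    simpa using (hasDerivAt_id y).const_mul k
  have hlim : Tendsto (fun y => k * y) (𝓝 z) (𝓝 (k * z)) := (hk z).continuousAt
  refine ⟨h0, fun y => k * F' (k * y), ?_, by simp [h2], ?_⟩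
  · filter_upwards [hlim.eventually h1] with y hy
    exact (hy.scomp y (hk y)).congr_deriv (by simp)
  · refine ((h3.scomp z (hk z)).const_mul (k : ℂ)).congr_deriv ?_
    simp
    ring

theorem of_contDiff {f : ℝ → ℝ} (hf : ContDiff ℝ 2 f) (z : ℝ) :
    HasJet (fun y => (f y : ℂ)) z ![(f z : ℂ), ((deriv f z : ℝ) : ℂ), ((deriv (deriv f) z : ℝ) : ℂ)] := by
  have h1 : Differentiable ℝ f := hf.differentiable (by norm_num)
  have h2 : ContDiff ℝ 1 (deriv f) := by
    have : ContDiff ℝ (1 + 1) f := by simpa [one_add_one_eq_two] using hf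
    exact (contDiff_succ_iff_deriv.1 this).2.2
  have h3 : Differentiable ℝ (deriv f) := h2.differentiable (by norm_num)
  exact ⟨rfl, fun y => ((deriv f y : ℝ) : ℂ), Eventually.of_forall fun y => (h1 y).hasDerivAt.ofReal_comp,
    rfl, (h3 z).hasDerivAt.ofReal_comp⟩

theorem sq (z : ℝ) : HasJet (fun y => (y : ℂ) ^ 2) z ![(z : ℂ) ^ 2, 2 * z, 2] := by
  refine ⟨rfl, fun y => 2 * y, Eventually.of_forall fun y => ?_, rfl, ?_⟩
  · exact ((hasDerivAt_id y).ofReal_comp.pow 2).congr_deriv (by simp)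
  · exact ((hasDerivAt_id z).ofReal_comp.const_mul (2 : ℂ)).congr_deriv (by simp)

theorem inv_sq (hz : z ≠ 0) : HasJet (fun y => ((y : ℂ) ^ 2)⁻¹) z
    ![((z : ℂ) ^ 2)⁻¹, -2 * ((z : ℂ) ^ 3)⁻¹, 6 * ((z : ℂ) ^ 4)⁻¹] := by
  refine ⟨rfl, fun y => -2 * ((y : ℂ) ^ 3)⁻¹, ?_, rfl, ?_⟩
  · filter_upwards [isOpen_ne.mem_nhds hz] with y hy
    have hy' : (y : ℂ) ≠ 0 := by exact_mod_cast hy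
    refine (((hasDerivAt_id y).ofReal_comp.pow 2).inv (by simpa using hy)).congr_deriv ?_
    simp
    field_simp
  · have hz' : (z : ℂ) ≠ 0 := by exact_mod_cast hz
    refine ((((hasDerivAt_id z).ofReal_comp.pow 3).inv (by simpa using hz)).const_mul
      (-2 : ℂ)).congr_deriv ?_
    simp
    field_simp
    ring

theorem log {k : ℝ} (hk : 0 < k) (hz : 0 < z) : HasJet (fun y => (Real.log (k * y / 2) : ℂ)) z
    ![(Real.log (k * z / 2) : ℂ), (z : ℂ)⁻¹, -((z : ℂ) ^ 2)⁻¹] := by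
  refine ⟨rfl, fun y => (y : ℂ)⁻¹, ?_, rfl, ?_⟩
  · filter_upwards [Ioi_mem_nhds hz] with y hy
    have hy' : 0 < y := hy
    refine (((((hasDerivAt_id y).const_mul k).div_const 2).log
      (by simp only [id]; positivity)).ofReal_comp).congr_deriv ?_
    rw [← Complex.ofReal_inv]
    congr 1
    simp only [id]
    field_simp
  · have hz' : (z : ℂ) ≠ 0 := by exact_mod_cast hz.ne'
    refine ((hasDerivAt_id z).ofReal_comp.inv (by simpa using hz.ne')).congr_deriv ?_
    simp
    field_simp

end HasJet

/-! ### Bessel functions of order `2` near the origin -/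

/-- The factor `k ^ 2` is extracted from the whole jet in `s`, to cancel the `k⁻²` of the incident
potentials; what remains has a limit as `k → 0`. -/
theorem exists_jet_sq_mul {f : ℝ → ℝ} (hf : ContDiff ℝ 2 f) (r : ℝ) :
    ∃ J : ℝ → Fin 3 → ℂ,
      Tendsto J (𝓝[>] 0) (𝓝 ![(r : ℂ) ^ 2 * f 0, 2 * r * f 0, 2 * f 0]) ∧
      ∀ k : ℝ, HasJet (fun s => (((k * s) ^ 2 * f (k * s) : ℝ) : ℂ)) r ((k : ℂ) ^ 2 • J k) := by
  have h1 : ContDiff ℝ 1 (deriv f) := by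
    have : ContDiff ℝ (1 + 1) f := by simpa [one_add_one_eq_two] using hf
    exact (contDiff_succ_iff_deriv.1 this).2.2
  have c0 : Continuous f := hf.continuous
  have c1 : Continuous (deriv f) := h1.continuous
  have c2 : Continuous (deriv (deriv f)) := h1.continuous_deriv (by norm_num)
  set J : ℝ → Fin 3 → ℂ := fun k => ![(r : ℂ) ^ 2 * f (k * r),
    2 * r * f (k * r) + k * r ^ 2 * deriv f (k * r),
    2 * f (k * r) + 4 * k * r * deriv f (k * r) + k ^ 2 * r ^ 2 * deriv (deriv f) (k * r)] with hJ
  have hJc : Continuous J := by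
    refine continuous_pi fun i => ?_
    fin_cases i <;> simp [hJ] <;> fun_prop
  refine ⟨J, ((hJc.tendsto 0).mono_left nhdsWithin_le_nhds).trans_eq (by simp [hJ]), fun k => ?_⟩
  have h := ((HasJet.sq (k * r)).mul (HasJet.of_contDiff hf (k * r))).comp_mul
  have e : (fun s => (((k * s) ^ 2 * f (k * s) : ℝ) : ℂ)) =
      fun s : ℝ => (((k * s : ℝ) : ℂ)) ^ 2 * (f (k * s) : ℂ) := by
    funext s; push_cast; ring
  rw [e]
  refine h.congr_jet ?_
  ext i
  fin_cases i <;> simp [hJ] <;> first | exact Or.inl (by ring) | ring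

/-- The entire function `J₂(z) / z²`. -/
noncomputable def besselJEntire (z : ℝ) : ℝ :=
  (∑' k : ℕ, (-1 : ℝ) ^ k / ((k.factorial : ℝ) * ((2 + k).factorial : ℝ)) * ((z / 2) ^ 2) ^ k) / 4

/-- The entire part of `Y₂(z) / z²`, up to a factor. -/
noncomputable def besselYEntire (z : ℝ) : ℝ :=
  (∑' k : ℕ, (digammaSucc k + digammaSucc (2 + k)) *
    ((-1 : ℝ) ^ k / ((k.factorial : ℝ) * ((2 + k).factorial : ℝ))) * ((z / 2) ^ 2) ^ k) / 4

theorem abs_digammaSucc_le (m : ℕ) : |digammaSucc m| ≤ m + 1 := by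
  have h1 : (harmonic m : ℝ) ≤ m := by
    have : harmonic m ≤ m := by
      unfold harmonic
      calc ∑ i ∈ Finset.range m, (((i + 1 : ℕ) : ℚ))⁻¹ ≤ ∑ i ∈ Finset.range m, (1 : ℚ) :=
            Finset.sum_le_sum fun i _ => inv_le_one_of_one_le₀ (by push_cast; linarith [i.cast_nonneg (α := ℚ)])
        _ = m := by simp
    exact_mod_cast this
  have h2 : (0 : ℝ) ≤ harmonic m := by
    have : 0 ≤ harmonic m := Finset.sum_nonneg fun i _ => by positivity
    exact_mod_cast this
  have h3 := Real.one_half_lt_eulerMascheroniConstant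
  have h4 := Real.eulerMascheroniConstant_lt_two_thirds
  rw [digammaSucc, abs_le]
  constructor <;> linarith

theorem abs_bessel_coeff (k : ℕ) :
    |(-1 : ℝ) ^ k / ((k.factorial : ℝ) * ((2 + k).factorial : ℝ))| =
      1 / ((k.factorial : ℝ) * ((2 + k).factorial : ℝ)) := by
  rw [abs_div, abs_pow, abs_neg, abs_one, one_pow, abs_of_pos (by positivity)]

theorem contDiff_besselJEntire : ContDiff ℝ 2 besselJEntire := by
  have h : ContDiff ℝ 2 (fun t : ℝ => ∑' k : ℕ,
      (-1 : ℝ) ^ k / ((k.factorial : ℝ) * ((2 + k).factorial : ℝ)) * t ^ k) := by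
    refine contDiff_tsum_of_le_factorial (M := 1) fun k => ?_
    rw [abs_bessel_coeff]
    have h1 : (1 : ℝ) ≤ ((2 + k).factorial : ℝ) := by exact_mod_cast Nat.one_le_iff_ne_zero.2 (Nat.factorial_ne_zero _)
    refine one_div_le_one_div_of_le (by positivity) ?_
    exact le_mul_of_one_le_right (by positivity) h1
  have h2 : ContDiff ℝ 2 (fun z : ℝ => (z / 2) ^ 2) := by fun_prop
  exact (h.comp h2).div_const 4

theorem contDiff_besselYEntire : ContDiff ℝ 2 besselYEntire := by
  have h : ContDiff ℝ 2 (fun t : ℝ => ∑' k : ℕ, (digammaSucc k + digammaSucc (2 + k)) *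
      ((-1 : ℝ) ^ k / ((k.factorial : ℝ) * ((2 + k).factorial : ℝ))) * t ^ k) := by
    refine contDiff_tsum_of_le_factorial (M := 2) fun k => ?_
    rw [abs_mul, abs_bessel_coeff]
    have h1 : ((2 + k : ℕ) : ℝ) ≤ ((2 + k).factorial : ℝ) := by exact_mod_cast Nat.self_le_factorial _
    have h2 : |digammaSucc k + digammaSucc (2 + k)| ≤ 2 * ((2 + k : ℕ) : ℝ) := by
      refine (abs_add_le _ _).trans ?_
      have := abs_digammaSucc_le k
      have := abs_digammaSucc_le (2 + k)
      push_cast at *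
      linarith
    have h3 : |digammaSucc k + digammaSucc (2 + k)| ≤ 2 * ((2 + k).factorial : ℝ) :=
      h2.trans (by linarith)
    rw [mul_one_div, div_le_div_iff₀ (by positivity) (by positivity)]
    calc |digammaSucc k + digammaSucc (2 + k)| * (k.factorial : ℝ)
        ≤ 2 * ((2 + k).factorial : ℝ) * (k.factorial : ℝ) := by gcongr
      _ = 2 * ((k.factorial : ℝ) * ((2 + k).factorial : ℝ)) := by ring
  have h2 : ContDiff ℝ 2 (fun z : ℝ => (z / 2) ^ 2) := by fun_prop
  exact (h.comp h2).div_const 4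

theorem besselJEntire_zero : besselJEntire 0 = 1 / 8 := by
  rw [besselJEntire, tsum_eq_single 0 (fun k hk => by simp [hk])]
  norm_num [Nat.factorial]

theorem besselJ_two (z : ℝ) : besselJ 2 z = z ^ 2 * besselJEntire z := by
  rw [besselJ, besselJEntire, mul_div_assoc', ← tsum_mul_left, ← tsum_div_const]
  refine tsum_congr fun k => ?_
  rw [pow_add, pow_mul]
  ring

/-- For order `2` the finite sum has the two terms `4 z⁻²` and `1`. These are the ones that survive
at low frequency, and they produce the `r⁻³` and `r⁻¹` static solutions. -/
theorem besselY_two {z : ℝ} (hz : z ≠ 0) : besselY 2 z =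
    2 / Real.pi * besselJ 2 z * Real.log (z / 2) - 1 / Real.pi * (4 * (z ^ 2)⁻¹ + 1)
      - 1 / Real.pi * (z ^ 2 * besselYEntire z) := by
  have h : ∑' k : ℕ, (digammaSucc k + digammaSucc (2 + k)) *
        ((-1 : ℝ) ^ k / ((k.factorial : ℝ) * ((2 + k).factorial : ℝ)) * (z / 2) ^ (2 * k + 2)) =
      z ^ 2 * besselYEntire z := by
    rw [besselYEntire, mul_div_assoc', ← tsum_mul_left, ← tsum_div_const]
    refine tsum_congr fun k => ?_
    rw [pow_add, pow_mul]
    ring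
  rw [besselY, h]
  simp [Finset.sum_range_succ]
  field_simp
  ring

theorem exists_jet_besselJ (r : ℝ) : ∃ J : ℝ → Fin 3 → ℂ,
    Tendsto J (𝓝[>] 0) (𝓝 ![(r : ℂ) ^ 2 / 8, r / 4, 1 / 4]) ∧
    ∀ k : ℝ, HasJet (fun s => (besselJ 2 (k * s) : ℂ)) r ((k : ℂ) ^ 2 • J k) := by
  obtain ⟨J, h1, h2⟩ := exists_jet_sq_mul contDiff_besselJEntire r
  refine ⟨J, h1.trans_eq ?_, fun k => ?_⟩
  · rw [besselJEntire_zero]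
    congr 1
    ext i
    fin_cases i <;> simp <;> ring
  · simp only [besselJ_two]
    exact h2 k

theorem tendsto_sq_mul_log {r : ℝ} (hr : 0 < r) :
    Tendsto (fun k : ℝ => k ^ 2 * Real.log (k * r / 2)) (𝓝[>] 0) (𝓝 0) := by
  have h : Continuous fun k : ℝ => (2 / r) * k * ((k * r / 2) * Real.log (k * r / 2)) := by
    have := Real.continuous_mul_log.comp (by fun_prop : Continuous fun k : ℝ => k * r / 2)
    exact (by fun_prop : Continuous fun k : ℝ => (2 / r) * k).mul this
  refine (((h.tendsto 0).mono_left nhdsWithin_le_nhds).congr fun k => ?_).trans_eq (by simp)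
  field_simp

/-- The Hankel function of order `2` near the origin. -/
theorem exists_jet_hankel {r : ℝ} (hr : 0 < r) : ∃ E : ℝ → Fin 3 → ℂ,
    Tendsto E (𝓝[>] 0) (𝓝 0) ∧ ∀ k : ℝ, 0 < k → HasJet (fun s => hankel 2 (k * s)) r
      (((k : ℂ) ^ 2)⁻¹ • ((-4 * Complex.I / Real.pi) •
        ![((r : ℂ) ^ 2)⁻¹, -2 * ((r : ℂ) ^ 3)⁻¹, 6 * ((r : ℂ) ^ 4)⁻¹])
        + ![-Complex.I / Real.pi, 0, 0] + E k) := by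
  obtain ⟨J, hJ, hJ'⟩ := exists_jet_besselJ r
  obtain ⟨S, hS, hS'⟩ := exists_jet_sq_mul contDiff_besselYEntire r
  -- The remainder collects `J₂`, the product `J₂ log` and the entire part of `Y₂`. The derivatives
  -- of `log (k s / 2)` in `s` do not involve `k`, so the logarithm occurs only as `k² log`.
  set E : ℝ → Fin 3 → ℂ := fun k => (k : ℂ) ^ 2 • J k + (2 * Complex.I / Real.pi) •
    (((k ^ 2 * Real.log (k * r / 2) : ℝ) : ℂ) • J k + (k : ℂ) ^ 2 •
      ![0, J k 0 * (r : ℂ)⁻¹, 2 * (J k 1 * (r : ℂ)⁻¹) - J k 0 * ((r : ℂ) ^ 2)⁻¹])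
    + (-Complex.I / Real.pi) • ((k : ℂ) ^ 2 • S k) with hE
  refine ⟨E, ?_, fun k hk => ?_⟩
  · have hk2 : Tendsto (fun k : ℝ => (k : ℂ) ^ 2) (𝓝[>] 0) (𝓝 0) := by
      have : Continuous fun k : ℝ => (k : ℂ) ^ 2 := by fun_prop
      exact ((this.tendsto 0).mono_left nhdsWithin_le_nhds).trans_eq (by simp)
    have hl : Tendsto (fun k : ℝ => ((k ^ 2 * Real.log (k * r / 2) : ℝ) : ℂ)) (𝓝[>] 0) (𝓝 0) :=
      ((Complex.continuous_ofReal.tendsto 0).comp (tendsto_sq_mul_log hr)).trans_eq (by simp)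
    have hc : Continuous fun a : Fin 3 → ℂ =>
        ![0, a 0 * (r : ℂ)⁻¹, 2 * (a 1 * (r : ℂ)⁻¹) - a 0 * ((r : ℂ) ^ 2)⁻¹] := by
      refine continuous_pi fun i => ?_
      fin_cases i <;> simp <;> fun_prop
    have hJc := (hc.tendsto _).comp hJ
    exact (((hk2.smul hJ).add (((hl.smul hJ).add (hk2.smul hJc)).const_smul _)).add
      ((hk2.smul hS).const_smul _)).trans_eq (by simp)
  · have hlog := ((hJ' k).mul (HasJet.log hk hr)).const_mul (2 * Complex.I / Real.pi)
    have hinv := (HasJet.inv_sq hr.ne').const_mul (((k : ℂ) ^ 2)⁻¹ * (-4 * Complex.I / Real.pi))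
    have h := ((((hJ' k).add hlog).add hinv).add
      (HasJet.const (z := r) (-Complex.I / Real.pi))).add
      ((hS' k).const_mul (-Complex.I / Real.pi))
    refine (h.congr ?_).congr_jet ?_
    · filter_upwards [Ioi_mem_nhds hr] with s hs
      have hs' : 0 < s := hs
      have hks : k * s ≠ 0 := (mul_pos hk hs').ne'
      have hkc : (k : ℂ) ≠ 0 := by exact_mod_cast hk.ne'
      have hsc : (s : ℂ) ≠ 0 := by exact_mod_cast hs'.ne'
      have hpi : (Real.pi : ℂ) ≠ 0 := by exact_mod_cast Real.pi_ne_zero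
      rw [hankel, besselY_two hks]
      push_cast
      field_simp
      ring
    · have h3 : ∀ a : Fin 3 → ℂ, a = ![a 0, a 1, a 2] := fun a => by
        ext i; fin_cases i <;> rfl
      simp only [hE]
      rw [h3 (J k), h3 (S k)]
      ext i
      fin_cases i <;> simp <;> ring

/-! ### A priori bounds at low frequency -/

namespace CoreShell

variable {c : CoreShell} {n : ℕ} {ω : ℝ} {v w : ℝ → Fin 4 → ℂ} {S : Set ℝ} {R : ℝ}

theorem exists_density_le (c : CoreShell) : ∃ P, 0 ≤ P ∧ ∀ r, (c.material r).ρ ≤ P := by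
  obtain ⟨M, hM⟩ := isCompact_Icc.exists_bound_of_continuousOn c.shell_ρ
  refine ⟨max M (max c.ρ0 c.ρe), c.ρ0_pos.le.trans
    ((le_max_left _ _).trans (le_max_right _ _)), fun r => ?_⟩
  rcases lt_or_ge r c.r0 with h | h
  · rw [c.material_core h]; exact (le_max_left _ _).trans (le_max_right _ _)
  rcases le_or_gt r c.r1 with h' | h'
  · rw [c.material_shell ⟨h, h'⟩]
    exact ((le_abs_self _).trans (hM r ⟨h, h'⟩)).trans (le_max_left _ _)
  · rw [c.material_ext h']; exact (le_max_right _ _).trans (le_max_right _ _)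

theorem norm_pair_deriv_le {ρ r P A B : ℝ} {p z : Fin 4 → ℂ} (hρ0 : 0 ≤ ρ) (hρ : ρ ≤ P)
    (hr0 : 0 ≤ r) (hr : r ≤ R) (hp : ‖p‖ ≤ A) (hz : ‖z‖ ≤ B) :
    ‖-((ρ * ω ^ 2 * r : ℝ) : ℂ) * (p 0 * z 0 + p 1 * z 1)‖ ≤ P * ω ^ 2 * R * (2 * (A * B)) := by
  have hA : 0 ≤ A := (norm_nonneg _).trans hp
  have hB : 0 ≤ B := (norm_nonneg _).trans hz
  have h : ∀ i, ‖p i * z i‖ ≤ A * B := fun i => by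
    rw [norm_mul]
    exact mul_le_mul ((norm_le_pi_norm p i).trans hp) ((norm_le_pi_norm z i).trans hz)
      (norm_nonneg _) hA
  rw [norm_mul, norm_neg, Complex.norm_real, Real.norm_of_nonneg (by positivity)]
  refine mul_le_mul ?_ ((norm_add_le _ _).trans (by linarith [h 0, h 1])) (norm_nonneg _) ?_
  · have : 0 ≤ P := hρ0.trans hρ
    gcongr
  · have := hρ0.trans hρ
    have := hr0.trans hr
    positivity

theorem IsField.norm_pair_zpow_sub_le (hv : c.IsField n ω (Ioc 0 R) v) (hR : c.r0 ≤ R) {k : ℤ}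
    {e : Fin 4 → ℂ} (he : ∀ r : ℝ, (systemMatrix n 0 (.isotropic c.K0 c.μ0 c.ρ0) r).mulVec e
      = (k : ℂ) • e) {a b M B : ℝ} (ha : 0 < a) (hab : a ≤ b) (hb : b ≤ c.r0)
    (hM : ∀ s ∈ Ioo a b, s ^ k ≤ M) (hB : ∀ s ∈ Ioo 0 c.r0, ‖v s‖ ≤ B) :
    ‖pair ((b : ℂ) ^ k • e) (v b) - pair ((a : ℂ) ^ k • e) (v a)‖ ≤
      c.ρ0 * ω ^ 2 * c.r0 * (2 * (M * ‖e‖ * B)) * (b - a) := by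
  have hs : Icc a b ⊆ Ioc 0 R := fun r hr => ⟨ha.trans_le hr.1, (hr.2.trans hb).trans hR⟩
  refine norm_sub_le_of_norm_hasDerivAt_le_off_two
    (f := fun s : ℝ => pair ((s : ℂ) ^ k • e) (v s))
    (f' := fun s : ℝ => -((c.ρ0 * ω ^ 2 * s : ℝ) : ℂ) *
      (((s : ℂ) ^ k • e) 0 * v s 0 + ((s : ℂ) ^ k • e) 1 * v s 1)) (c := c.r0) (d := c.r1) hab
    (continuousOn_pair ((continuousOn_zpow_smul k e).mono fun r hr => (hs hr).1) (hv.1.mono hs))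
    fun s hs' h0 h1 => ?_
  have hs0 : 0 < s := ha.trans hs'.1
  have hsr : s < c.r0 := hs'.2.trans_le hb
  have hS := hv.solvesAt ⟨hs0, hsr.trans_le hR⟩ h0 h1
  rw [c.material_core hsr] at hS
  refine ⟨(solvesAt_zpow k hs0.ne' (he s)).hasDerivAt_pair hs0.ne' hS, ?_⟩
  refine norm_pair_deriv_le c.ρ0_pos.le le_rfl hs0.le hsr.le ?_ (hB s ⟨hs0, hsr⟩)
  rw [norm_zpow_smul hs0]
  exact mul_le_mul_of_nonneg_right (hM s hs') (norm_nonneg _)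

/-- Compare `r` with the interface `r0` if `k < 0`, and with the axis, where the pairing vanishes,
if `k > 0`. Either way `s ^ k ≤ r ^ k` between the two radii, so dividing by `r ^ k` leaves a bound
uniform in `r`. -/
theorem IsField.norm_pair_le_core (hv : c.IsField n ω (Ioc 0 R) v) (hR : c.r0 ≤ R) {k : ℤ}
    (hk : k ≠ 0) {e : Fin 4 → ℂ}
    (he : ∀ r : ℝ, (systemMatrix n 0 (.isotropic c.K0 c.μ0 c.ρ0) r).mulVec e = (k : ℂ) • e)
    {B : ℝ} (hB : ∀ s ∈ Ioo 0 c.r0, ‖v s‖ ≤ B) {r : ℝ} (hr : r ∈ Ioo 0 c.r0) :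
    ‖pair e (v r)‖ ≤ ‖e‖ * (4 * ‖v c.r0‖ + 2 * c.ρ0 * c.r0 ^ 2 * (ω ^ 2 * B)) := by
  have hρ := c.ρ0_pos
  have hr0 := c.r0_pos
  have hB0 : 0 ≤ B := (norm_nonneg _).trans (hB r hr)
  have hrk : 0 < r ^ k := zpow_pos hr.1 k
  have hn : ∀ s : ℝ, 0 < s → ‖pair ((s : ℂ) ^ k • e) (v s)‖ = s ^ k * ‖pair e (v s)‖ := by
    intro s hs
    rw [pair_smul_left, norm_mul, norm_zpow, Complex.norm_real, Real.norm_of_nonneg hs.le]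
  suffices h : r ^ k * ‖pair e (v r)‖ ≤
      r ^ k * (‖e‖ * (4 * ‖v c.r0‖ + 2 * c.ρ0 * c.r0 ^ 2 * (ω ^ 2 * B))) from
    le_of_mul_le_mul_left h hrk
  have hext : ∀ {x d : ℝ}, x ≤ c.ρ0 * ω ^ 2 * c.r0 * (2 * (r ^ k * ‖e‖ * B)) * d → 0 ≤ d →
      d ≤ c.r0 → x ≤ r ^ k * (‖e‖ * (2 * c.ρ0 * c.r0 ^ 2 * (ω ^ 2 * B))) := by
    intro x d hx hd hdr
    refine hx.trans ?_
    calc c.ρ0 * ω ^ 2 * c.r0 * (2 * (r ^ k * ‖e‖ * B)) * d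
        ≤ c.ρ0 * ω ^ 2 * c.r0 * (2 * (r ^ k * ‖e‖ * B)) * c.r0 := by gcongr
      _ = _ := by ring
  rw [← hn r hr.1]
  rcases lt_or_gt_of_ne hk with hk' | hk'
  · have hanti : ∀ s, r ≤ s → s ^ k ≤ r ^ k := fun s hs => by
      rw [← neg_neg k, zpow_neg s, zpow_neg r]
      exact inv_anti₀ (zpow_pos hr.1 _) (zpow_le_zpow_left₀ (n := -k) (by omega) hr.1.le hs)
    have h := hv.norm_pair_zpow_sub_le hR he (M := r ^ k) hr.1 hr.2.le le_rfl
      (fun s hs => hanti s hs.1.le) hB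
    have h1 := hext h (by linarith [hr.2]) (by linarith [hr.1])
    have h2 : ‖pair ((c.r0 : ℂ) ^ k • e) (v c.r0)‖ ≤ r ^ k * (‖e‖ * (4 * ‖v c.r0‖)) := by
      rw [hn _ hr0]
      refine mul_le_mul (hanti _ hr.2.le) ?_ (norm_nonneg _) hrk.le
      exact (norm_pair_le _ _).trans_eq (by ring)
    have h3 := norm_sub_norm_le (pair ((r : ℂ) ^ k • e) (v r)) (pair ((c.r0 : ℂ) ^ k • e) (v c.r0))
    rw [norm_sub_rev] at h3
    nlinarith
  · have hz : Tendsto (fun s : ℝ => pair ((s : ℂ) ^ k • e) (v s)) (𝓝[>] 0) (𝓝 0) := by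
      lift k to ℕ using hk'.le
      have hk0 : k ≠ 0 := by exact_mod_cast hk
      refine squeeze_zero_norm' (a := fun s : ℝ => s ^ k * (4 * (‖e‖ * B))) ?_ ?_
      · filter_upwards [Ioo_mem_nhdsGT hr0] with s hs
        rw [hn s hs.1, zpow_natCast]
        have := hs.1
        gcongr
        exact (norm_pair_le _ _).trans (by gcongr; exact hB s hs)
      · have : Continuous fun s : ℝ => s ^ k * (4 * (‖e‖ * B)) := by fun_prop
        exact ((this.tendsto 0).mono_left nhdsWithin_le_nhds).trans_eq (by simp [hk0])
    have h1 : ‖pair ((r : ℂ) ^ k • e) (v r) - 0‖ ≤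
        r ^ k * (‖e‖ * (2 * c.ρ0 * c.r0 ^ 2 * (ω ^ 2 * B))) := by
      refine le_of_tendsto (tendsto_const_nhds.sub hz).norm ?_
      filter_upwards [Ioo_mem_nhdsGT hr.1] with s hs
      exact hext (hv.norm_pair_zpow_sub_le hR he (M := r ^ k) hs.1 hs.2.le hr.2.le
        (fun t ht => zpow_le_zpow_left₀ hk'.le (hs.1.trans ht.1).le ht.2.le) hB)
        (by linarith [hs.2]) (by linarith [hs.1, hr.2])
    rw [sub_zero] at h1
    refine h1.trans ?_
    gcongr
    linarith [norm_nonneg (v c.r0)]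

/-- Expanding `v r` in the eigenvectors bounds it by the interface value plus `O(ω²)` times any
bound `B` on the core. For small `ω` the second term is at most `B / 2` and can be absorbed. -/
theorem exists_norm_core_le (c : CoreShell) : ∃ C ω₀, 0 ≤ C ∧ 0 < ω₀ ∧ ∀ ω ∈ Icc 0 ω₀, ∀ R,
    c.r0 ≤ R → ∀ v, c.IsField 2 ω (Ioc 0 R) v → ∀ r ∈ Ioo 0 c.r0, ‖v r‖ ≤ C * ‖v c.r0‖ := by
  have hK := c.K0_pos
  have hμ := c.μ0_pos
  have hρ := c.ρ0_pos
  have hKμ : ‖(c.K0 + c.μ0 : ℂ)‖ = c.K0 + c.μ0 := by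
    rw [← Complex.ofReal_add, Complex.norm_real, Real.norm_of_nonneg (by positivity)]
  set N : ℝ := ‖vecNegOne c.K0 c.μ0‖ / 2 * ‖vecOne c.μ0‖
    + ‖vecNegThree c.μ0‖ / (c.K0 + c.μ0) * ‖vecThree c.K0 c.μ0‖
    + ‖vecOne c.μ0‖ / 2 * ‖vecNegOne c.K0 c.μ0‖
    + ‖vecThree c.K0 c.μ0‖ / (c.K0 + c.μ0) * ‖vecNegThree c.μ0‖ with hN
  have hN0 : 0 ≤ N := by positivity
  set A : ℝ := 4 * N * c.ρ0 * c.r0 ^ 2 with hA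
  have hA0 : 0 ≤ A := by positivity
  refine ⟨8 * N, 1 / (A + 1), by positivity, by positivity, fun ω hω R hR v hv => ?_⟩
  have hAω : A * ω ^ 2 ≤ 1 := by
    have h1 : ω * (A + 1) ≤ 1 := (le_div_iff₀ (by positivity)).1 hω.2
    have h2 : ω ≤ 1 := by nlinarith [hω.1, mul_nonneg hω.1 hA0]
    nlinarith [hω.1, mul_nonneg hω.1 hA0]
  have key : ∀ B, (∀ s ∈ Ioo 0 c.r0, ‖v s‖ ≤ B) → ∀ r ∈ Ioo 0 c.r0,
      ‖v r‖ ≤ 4 * N * ‖v c.r0‖ + B / 2 := by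
    intro B hB r hr
    have hB0 : 0 ≤ B := (norm_nonneg _).trans (hB r hr)
    set a := 4 * ‖v c.r0‖ + 2 * c.ρ0 * c.r0 ^ 2 * (ω ^ 2 * B) with ha
    have e1 := hv.norm_pair_le_core hR one_ne_zero (mulVec_vecOne hK hμ c.ρ0) hB hr
    have e2 := hv.norm_pair_le_core hR three_ne_zero (mulVec_vecThree hK hμ c.ρ0) hB hr
    have e3 := hv.norm_pair_le_core hR (by norm_num) (mulVec_vecNegOne hK hμ c.ρ0) hB hr
    have e4 := hv.norm_pair_le_core hR (by norm_num) (mulVec_vecNegThree hK hμ c.ρ0) hB hr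
    have hva : ‖v r‖ ≤ N * a := by
      rw [eq_sum_pair_smul hK hμ (v r)]
      refine (norm_add₄_le).trans ?_
      simp only [norm_smul, norm_div, norm_neg, hKμ, Complex.norm_ofNat]
      calc _ ≤ ‖vecNegOne c.K0 c.μ0‖ * a / 2 * ‖vecOne c.μ0‖
          + ‖vecNegThree c.μ0‖ * a / (c.K0 + c.μ0) * ‖vecThree c.K0 c.μ0‖
          + ‖vecOne c.μ0‖ * a / 2 * ‖vecNegOne c.K0 c.μ0‖
          + ‖vecThree c.K0 c.μ0‖ * a / (c.K0 + c.μ0) * ‖vecNegThree c.μ0‖ := by gcongr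
        _ = N * a := by rw [hN]; ring
    have : A * ω ^ 2 * B ≤ 1 * B := mul_le_mul_of_nonneg_right hAω hB0
    calc ‖v r‖ ≤ N * a := hva
      _ = 4 * N * ‖v c.r0‖ + A * ω ^ 2 * B / 2 := by rw [ha, hA]; ring
      _ ≤ _ := by linarith
  obtain ⟨B, hB⟩ := hv.2.2
  have hbdd : BddAbove ((fun r => ‖v r‖) '' Ioo 0 c.r0) := ⟨B, by rintro _ ⟨r, hr, rfl⟩; exact hB r hr⟩
  -- Absorption needs the best bound, a supremum that is finite because fields are bounded near the
  -- axis by definition.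
  set B' := sSup ((fun r => ‖v r‖) '' Ioo 0 c.r0)
  have hB' : ∀ s ∈ Ioo 0 c.r0, ‖v s‖ ≤ B' := fun s hs => le_csSup hbdd ⟨s, hs, rfl⟩
  have hle : B' ≤ 4 * N * ‖v c.r0‖ + B' / 2 := by
    refine csSup_le ((nonempty_Ioo.2 c.r0_pos).image _) ?_
    rintro _ ⟨r, hr, rfl⟩
    exact key B' hB' r hr
  intro r hr
  linarith [hB' r hr]

/-- At low frequency a field is controlled by its value at the outer end. -/
theorem exists_norm_le_right (c : CoreShell) (hR : c.r0 ≤ R) : ∃ C ω₀, 0 ≤ C ∧ 0 < ω₀ ∧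
    ∀ ω ∈ Icc 0 ω₀, ∀ v, c.IsField 2 ω (Ioc 0 R) v → ∀ r ∈ Ioc 0 R, ‖v r‖ ≤ C * ‖v R‖ := by
  obtain ⟨C, ω₀, hC, hω₀, h⟩ := c.exists_norm_core_le
  obtain ⟨M, hM, h'⟩ := c.exists_norm_le_norm 2 R
  refine ⟨max (C * M) M, min ω₀ 1, by positivity, by positivity, fun ω hω v hv r hr => ?_⟩
  have hω1 : ω ∈ Icc (0 : ℝ) 1 := ⟨hω.1, hω.2.trans (min_le_right _ _)⟩
  have hω2 : ω ∈ Icc 0 ω₀ := ⟨hω.1, hω.2.trans (min_le_left _ _)⟩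
  rcases lt_or_ge r c.r0 with hr0 | hr0
  · calc ‖v r‖ ≤ C * ‖v c.r0‖ := h ω hω2 R hR v hv r ⟨hr.1, hr0⟩
      _ ≤ C * (M * ‖v R‖) := by gcongr; exact (h' ω hω1 v hv c.r0 ⟨le_rfl, hR⟩).2
      _ ≤ max (C * M) M * ‖v R‖ := by rw [← mul_assoc]; gcongr; exact le_max_left _ _
  · exact (h' ω hω1 v hv r ⟨hr0, hr.2⟩).2.trans (by gcongr; exact le_max_right _ _)

/-- At low frequency the pairing with a static field is small. -/
theorem IsField.exists_norm_pair_le {p : ℝ → Fin 4 → ℂ} (hp : c.IsField 2 0 (Ioc 0 R) p)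
    (hR : c.r0 ≤ R) : ∃ C ω₀, 0 ≤ C ∧ 0 < ω₀ ∧ ∀ ω ∈ Icc 0 ω₀, ∀ v,
      c.IsField 2 ω (Ioc 0 R) v → ‖pair (p R) (v R)‖ ≤ C * ω ^ 2 * ‖v R‖ := by
  obtain ⟨C, ω₀, hC, hω₀, h⟩ := c.exists_norm_le_right hR
  obtain ⟨P, hP, hρ⟩ := c.exists_density_le
  have hR0 : 0 < R := c.r0_pos.trans_le hR
  refine ⟨P * R * (2 * (C * ‖p R‖ * C)) * R, ω₀, by positivity, hω₀, fun ω hω v hv => ?_⟩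
  have hpb : ∀ r ∈ Ioc 0 R, ‖p r‖ ≤ C * ‖p R‖ := h 0 ⟨le_rfl, hω₀.le⟩ p hp
  have hvb : ∀ r ∈ Ioc 0 R, ‖v r‖ ≤ C * ‖v R‖ := h ω hω v hv
  have hz : Tendsto (fun s => pair (p s) (v s)) (𝓝[>] 0) (𝓝 0) := by
    refine squeeze_zero_norm' (a := fun s => 4 * (‖p s‖ * (C * ‖v R‖))) ?_ ?_
    · filter_upwards [Ioo_mem_nhdsGT hR0] with s hs
      exact (norm_pair_le _ _).trans (by gcongr; exact hvb s ⟨hs.1, hs.2.le⟩)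
    · simpa using (((hp.tendsto_zero hR).norm.mul_const (C * ‖v R‖)).const_mul 4)
  have h1 : ‖pair (p R) (v R) - 0‖ ≤ P * ω ^ 2 * R * (2 * (C * ‖p R‖ * (C * ‖v R‖))) * R := by
    refine le_of_tendsto (tendsto_const_nhds.sub hz).norm ?_
    filter_upwards [Ioo_mem_nhdsGT hR0] with s hs
    have hsub : Icc s R ⊆ Ioc 0 R := fun t ht => ⟨hs.1.trans_le ht.1, ht.2⟩
    refine (norm_sub_le_of_norm_hasDerivAt_le_off_two (f := fun t => pair (p t) (v t))
      (f' := fun t => -(((c.material t).ρ * ω ^ 2 * t : ℝ) : ℂ) * (p t 0 * v t 0 + p t 1 * v t 1))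
      (c := c.r0) (d := c.r1) hs.2.le (continuousOn_pair (hp.1.mono hsub) (hv.1.mono hsub))
      (M := P * ω ^ 2 * R * (2 * (C * ‖p R‖ * (C * ‖v R‖)))) fun t ht h0 h1 => ?_).trans ?_
    · have ht0 : 0 < t := hs.1.trans ht.1
      have ht' : t ∈ Ioc 0 R := ⟨ht0, ht.2.le⟩
      exact ⟨(hp.solvesAt ⟨ht0, ht.2⟩ h0 h1).hasDerivAt_pair ht0.ne'
        (hv.solvesAt ⟨ht0, ht.2⟩ h0 h1), norm_pair_deriv_le (c.material_positive t).2.2.2.le (hρ t)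
        ht0.le ht.2.le (hpb t ht') (hvb t ht')⟩
    · have := hs.1
      gcongr
      linarith
  rw [sub_zero] at h1
  exact h1.trans_eq (by ring)

end CoreShell

/-! ### Fields given by potentials -/

/-- The state vector at radius `R` of the field of harmonic `2` whose potentials have the second
order jets `a` and `b` there. -/
noncomputable def jetState (K μ R : ℝ) (a b : Fin 3 → ℂ) : Fin 4 → ℂ :=
  ![a 1 - 2 * Complex.I / R * b 0,
    2 / R * a 0 - Complex.I * b 1,
    (K + μ) * (R * (a 2 + 2 * Complex.I / R ^ 2 * b 0 - 2 * Complex.I / R * b 1))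
      + (K - μ) * ((a 1 - 2 * Complex.I / R * b 0) - 2 * (2 / R * a 0 - Complex.I * b 1)),
    μ * (R * (-2 / R ^ 2 * a 0 + 2 / R * a 1 - Complex.I * b 2)
      + 2 * (a 1 - 2 * Complex.I / R * b 0) - (2 / R * a 0 - Complex.I * b 1))]

theorem jetState_add (K μ R : ℝ) (a b a' b' : Fin 3 → ℂ) :
    jetState K μ R (a + a') (b + b') = jetState K μ R a b + jetState K μ R a' b' := by
  ext i
  fin_cases i <;> simp [jetState] <;> ring

theorem jetState_smul (K μ R : ℝ) (t : ℂ) (a b : Fin 3 → ℂ) :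
    jetState K μ R (t • a) (t • b) = t • jetState K μ R a b := by
  ext i
  fin_cases i <;> simp [jetState] <;> ring

theorem continuous_jetState (K μ R : ℝ) :
    Continuous fun x : (Fin 3 → ℂ) × (Fin 3 → ℂ) => jetState K μ R x.1 x.2 := by
  refine continuous_pi fun i => ?_
  fin_cases i <;> simp [jetState] <;> fun_prop

/-- The potentials prescribe only the displacement. The first two field equations recover the
tractions from its derivatives, whence second-order jets of the potentials. -/
theorem SolvesAt.eq_jetState {K μ ρ ω R : ℝ} {v : ℝ → Fin 4 → ℂ} {φ ψ : ℝ → ℂ} {a b : Fin 3 → ℂ}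
    (hK : 0 < K) (hμ : 0 < μ) (hR : 0 < R) (hv : SolvesAt 2 ω (.isotropic K μ ρ) v R)
    (h0 : ∀ᶠ r in 𝓝 R, v r 0 = deriv φ r - 2 * Complex.I / r * ψ r)
    (h1 : ∀ᶠ r in 𝓝 R, v r 1 = -Complex.I * (2 * Complex.I / r * φ r + deriv ψ r))
    (hφ : HasJet φ R a) (hψ : HasJet ψ R b) : v R = jetState K μ R a b := by
  obtain ⟨a0, φ', hφ', a1, a2⟩ := hφ
  obtain ⟨b0, ψ', hψ', b1, b2⟩ := hψ
  have hRc : (R : ℂ) ≠ 0 := by exact_mod_cast hR.ne'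
  have hKμ : (K + μ : ℂ) ≠ 0 := by exact_mod_cast (add_pos hK hμ).ne'
  have hμc : (μ : ℂ) ≠ 0 := by exact_mod_cast hμ.ne'
  have hinv : HasDerivAt (fun r : ℝ => ((r : ℂ))⁻¹) (-((R : ℂ) ^ 2)⁻¹) R :=
    ((hasDerivAt_id R).ofReal_comp.inv (by simpa using hR.ne')).congr_deriv (by simp [div_eq_mul_inv])
  have d0 : HasDerivAt (fun r => v r 0)
      (a 2 + 2 * Complex.I / R ^ 2 * b 0 - 2 * Complex.I / R * b 1) R := by
    refine ((a2.sub ((hinv.const_mul (2 * Complex.I)).mul hψ'.self_of_nhds)).congr_deriv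
      ?_).congr_of_eventuallyEq ?_
    · rw [b1, b0]
      ring
    · filter_upwards [h0, hφ'] with r hr hr'
      simp only [Pi.sub_apply, Pi.mul_apply]
      rw [hr, hr'.deriv]
      ring
  have d1 : HasDerivAt (fun r => v r 1)
      (-2 / R ^ 2 * a 0 + 2 / R * a 1 - Complex.I * b 2) R := by
    refine ((((hinv.const_mul 2).mul hφ'.self_of_nhds).sub (b2.const_mul Complex.I)).congr_deriv
      ?_).congr_of_eventuallyEq ?_
    · rw [a1, a0]
      ring
    · filter_upwards [h1, hψ'] with r hr hr'
      simp only [Pi.sub_apply, Pi.mul_apply]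
      rw [hr, hr'.deriv]
      linear_combination (-2 / r * φ r) * Complex.I_sq
  have v0 : v R 0 = a 1 - 2 * Complex.I / R * b 0 := by
    rw [h0.self_of_nhds, hφ'.self_of_nhds.deriv, a1, b0]
  have v1 : v R 1 = 2 / R * a 0 - Complex.I * b 1 := by
    rw [h1.self_of_nhds, hψ'.self_of_nhds.deriv, b1, a0]
    linear_combination (-2 / R * a 0) * Complex.I_sq
  obtain ⟨s0, s1, -, -⟩ := solvesAt_iff.1 hv
  have e0 := s0.unique d0
  have e1 := s1.unique d1
  rw [v0, v1] at e0 e1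
  have hγ : ((PlaneMaterial.isotropic K μ ρ).γ : ℂ) = 1 + (K - μ) / (K + μ) := by
    simp [PlaneMaterial.γ, PlaneMaterial.isotropic]
  have h11 : ((PlaneMaterial.isotropic K μ ρ).C11 : ℂ) = K + μ := by
    simp [PlaneMaterial.isotropic]
  have h66 : ((PlaneMaterial.isotropic K μ ρ).C66 : ℂ) = μ := rfl
  rw [hγ, h11] at e0
  rw [h66] at e1
  ext i
  fin_cases i
  · exact v0
  · exact v1
  · change v R 2 = (K + μ) * (R * (a 2 + 2 * Complex.I / R ^ 2 * b 0 - 2 * Complex.I / R * b 1))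
      + (K - μ) * ((a 1 - 2 * Complex.I / R * b 0) - 2 * (2 / R * a 0 - Complex.I * b 1))
    rw [← e0]
    field_simp
    push_cast
    ring
  · change v R 3 = μ * (R * (-2 / R ^ 2 * a 0 + 2 / R * a 1 - Complex.I * b 2)
      + 2 * (a 1 - 2 * Complex.I / R * b 0) - (2 / R * a 0 - Complex.I * b 1))
    rw [← e1]
    field_simp
    push_cast
    ring

/-- The errors are relative to the unknowns themselves. Once `e ≤ 1 / 4`, the quantity `m = 1 + ‖f‖
+ ‖g‖` satisfies `m ≤ 1 + ‖x‖ + ‖y‖ + m / 2`, so it is bounded and the errors tend to `0`. -/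
theorem tendsto_of_norm_sub_le {ι : Type*} {l : Filter ι} {f g : ι → ℂ} {e : ι → ℝ} {x y : ℂ}
    (he : Tendsto e l (𝓝 0)) (hf : ∀ᶠ i in l, ‖f i - x‖ ≤ e i * (1 + ‖f i‖ + ‖g i‖))
    (hg : ∀ᶠ i in l, ‖g i - y‖ ≤ e i * (1 + ‖f i‖ + ‖g i‖)) :
    Tendsto f l (𝓝 x) ∧ Tendsto g l (𝓝 y) := by
  set M := 2 * (1 + ‖x‖ + ‖y‖)
  have hM : ∀ᶠ i in l, ‖f i - x‖ ≤ |e i| * M ∧ ‖g i - y‖ ≤ |e i| * M := by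
    filter_upwards [hf, hg, he.eventually_le_const (u := 1 / 4) (by norm_num)] with i h1 h2 h3
    set m := 1 + ‖f i‖ + ‖g i‖ with hm
    have hm0 : 0 ≤ m := by positivity
    have h4 : e i * m ≤ 1 / 4 * m := mul_le_mul_of_nonneg_right h3 hm0
    have h5 := norm_sub_norm_le (f i) x
    have h6 := norm_sub_norm_le (g i) y
    have h7 : m ≤ M := by linarith
    have h8 : e i * m ≤ |e i| * M :=
      mul_le_mul (le_abs_self _) h7 hm0 (abs_nonneg _)
    exact ⟨h1.trans h8, h2.trans h8⟩
  have hz : Tendsto (fun i => |e i| * M) l (𝓝 0) := by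
    simpa using he.abs.mul_const M
  constructor
  · exact tendsto_iff_norm_sub_tendsto_zero.2 (squeeze_zero' (Eventually.of_forall fun _ =>
      norm_nonneg _) (hM.mono fun i hi => hi.1) hz)
  · exact tendsto_iff_norm_sub_tendsto_zero.2 (squeeze_zero' (Eventually.of_forall fun _ =>
      norm_nonneg _) (hM.mono fun i hi => hi.2) hz)

theorem jetState_besselJ (K μ : ℝ) {R : ℝ} (hR : 0 < R) (x y : ℂ) :
    jetState K μ R (x • (![(R : ℂ) ^ 2 / 8, R / 4, 1 / 4] : Fin 3 → ℂ))
      (y • (![(R : ℂ) ^ 2 / 8, R / 4, 1 / 4] : Fin 3 → ℂ)) =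
      isoField K μ ![(x - Complex.I * y) / 4, 0, 0, 0] R := by
  have hRc : (R : ℂ) ≠ 0 := by exact_mod_cast hR.ne'
  ext i
  fin_cases i <;> simp [jetState, isoField, vecOne] <;> field_simp <;> ring

/-- The potentials `φ = t r⁻²` and `ψ = i t r⁻²` have cancelling gradient and curl. Hence the `k⁻²`
singularities of the two scattered waves act only through `BL / kL² - BT / kT²`. -/
theorem jetState_inv_sq_same (K μ : ℝ) {R : ℝ} (hR : 0 < R) (t : ℂ) :
    jetState K μ R (t • ![((R : ℂ) ^ 2)⁻¹, -2 * ((R : ℂ) ^ 3)⁻¹, 6 * ((R : ℂ) ^ 4)⁻¹])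
      (Complex.I • t • ![((R : ℂ) ^ 2)⁻¹, -2 * ((R : ℂ) ^ 3)⁻¹, 6 * ((R : ℂ) ^ 4)⁻¹]) = 0 := by
  have hRc : (R : ℂ) ≠ 0 := by exact_mod_cast hR.ne'
  ext i
  fin_cases i <;> simp [jetState] <;> field_simp <;> ring_nf <;> simp [Complex.I_sq]

theorem jetState_inv_sq (K : ℝ) {μ R : ℝ} (hμ : 0 < μ) (hR : 0 < R) :
    jetState K μ R 0 (-Complex.I • (-4 * Complex.I / Real.pi : ℂ) •
      ![((R : ℂ) ^ 2)⁻¹, -2 * ((R : ℂ) ^ 3)⁻¹, 6 * ((R : ℂ) ^ 4)⁻¹]) =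
      isoField K μ ![0, 0, 0, 96 * Complex.I * μ / Real.pi] R := by
  have hRc : (R : ℂ) ≠ 0 := by exact_mod_cast hR.ne'
  have hμc : (μ : ℂ) ≠ 0 := by exact_mod_cast hμ.ne'
  have hpi : (Real.pi : ℂ) ≠ 0 := by exact_mod_cast Real.pi_ne_zero
  ext i
  fin_cases i <;> simp [jetState, isoField, vecNegThree] <;> field_simp <;> ring_nf <;>
    simp [Complex.I_sq]

/-- The constant terms of the two Hankel functions, weighted in the ratio `(kT / kL)² = (K + μ) /
μ`, combine to the static `r⁻¹` solution. -/
theorem jetState_const {K μ R : ℝ} (hK : 0 < K) (hμ : 0 < μ) (hR : 0 < R) :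
    jetState K μ R ![-Complex.I / Real.pi, 0, 0]
      ((Complex.I * ((K + μ) / μ)) • ![-Complex.I / Real.pi, 0, 0]) =
      isoField K μ ![0, 0, -4 * Complex.I * (K + μ) / Real.pi, 0] R := by
  have hRc : (R : ℂ) ≠ 0 := by exact_mod_cast hR.ne'
  have hμc : (μ : ℂ) ≠ 0 := by exact_mod_cast hμ.ne'
  have hKμ : (K + μ : ℂ) ≠ 0 := by exact_mod_cast (add_pos hK hμ).ne'
  have hpi : (Real.pi : ℂ) ≠ 0 := by exact_mod_cast Real.pi_ne_zero
  ext i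
  fin_cases i <;> simp [jetState, isoField, vecNegOne] <;> field_simp <;> ring_nf <;>
    simp [Complex.I_sq] <;> ring

/-! ### Scattering at low frequency -/

namespace CoreShell

variable {c : CoreShell} {R : ℝ}

theorem cL_pos (c : CoreShell) : 0 < Real.sqrt ((c.Ke + c.μe) / c.ρe) :=
  Real.sqrt_pos.2 (div_pos (add_pos c.Ke_pos c.μe_pos) c.ρe_pos)

theorem cT_pos (c : CoreShell) : 0 < Real.sqrt (c.μe / c.ρe) :=
  Real.sqrt_pos.2 (div_pos c.μe_pos c.ρe_pos)

theorem kL_pos (c : CoreShell) {ω : ℝ} (hω : 0 < ω) : 0 < c.kL ω := div_pos hω c.cL_pos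

theorem kT_pos (c : CoreShell) {ω : ℝ} (hω : 0 < ω) : 0 < c.kT ω := div_pos hω c.cT_pos

theorem kT_sq (c : CoreShell) (ω : ℝ) :
    (c.kT ω : ℂ) ^ 2 = (c.Ke + c.μe) / c.μe * (c.kL ω : ℂ) ^ 2 := by
  have h1 := c.Ke_pos
  have h2 := c.μe_pos
  have h3 := c.ρe_pos
  have : c.kT ω ^ 2 = (c.Ke + c.μe) / c.μe * c.kL ω ^ 2 := by
    rw [kT, kL, div_pow, div_pow, Real.sq_sqrt (by positivity), Real.sq_sqrt (by positivity)]
    field_simp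
  exact_mod_cast this

theorem tendsto_div_nhdsGT_zero {a : ℝ} (ha : 0 < a) :
    Tendsto (fun ω : ℝ => ω / a) (𝓝[>] 0) (𝓝[>] 0) := by
  refine tendsto_nhdsWithin_iff.2 ⟨?_, ?_⟩
  · have : Continuous fun ω : ℝ => ω / a := by fun_prop
    exact ((this.tendsto 0).mono_left nhdsWithin_le_nhds).trans_eq (by simp)
  · filter_upwards [self_mem_nhdsWithin] with ω hω using div_pos hω ha

theorem tendsto_kL (c : CoreShell) : Tendsto c.kL (𝓝[>] 0) (𝓝[>] 0) :=
  tendsto_div_nhdsGT_zero c.cL_pos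

theorem tendsto_kT (c : CoreShell) : Tendsto c.kT (𝓝[>] 0) (𝓝[>] 0) :=
  tendsto_div_nhdsGT_zero c.cT_pos

/-- The exterior part of a scattering solution at low frequency. -/
theorem exists_scattering_state (c : CoreShell) (hR : c.r1 < R) (εL εT : ℂ) :
    ∃ X Y Z : ℝ → Fin 4 → ℂ,
      Tendsto X (𝓝[>] 0) (𝓝 (isoField c.Ke c.μe ![(εL - Complex.I * εT) / 4, 0, 0, 0] R)) ∧
      Tendsto Y (𝓝[>] 0)
        (𝓝 (isoField c.Ke c.μe ![0, 0, 0, 96 * Complex.I * c.μe / Real.pi] R)) ∧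
      Tendsto Z (𝓝[>] 0)
        (𝓝 (isoField c.Ke c.μe ![0, 0, -4 * Complex.I * (c.Ke + c.μe) / Real.pi, 0] R)) ∧
      ∀ ω, 0 < ω → ∀ BL BT, c.Scattering ω εL εT BL BT → ∃ v, c.IsField 2 ω (Ioi 0) v ∧
        v R = X ω + (BL / (c.kL ω : ℂ) ^ 2 - BT / (c.kT ω : ℂ) ^ 2) • Y ω + BL • Z ω := by
  have hR0 : 0 < R := c.r1_pos.trans hR
  have hK := c.Ke_pos
  have hμ := c.μe_pos
  obtain ⟨J, hJ, hJ'⟩ := exists_jet_besselJ R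
  obtain ⟨E, hE, hE'⟩ := exists_jet_hankel hR0
  set h2 : Fin 3 → ℂ := (-4 * Complex.I / Real.pi : ℂ) •
    ![((R : ℂ) ^ 2)⁻¹, -2 * ((R : ℂ) ^ 3)⁻¹, 6 * ((R : ℂ) ^ 4)⁻¹] with hh2
  set h0 : Fin 3 → ℂ := ![-Complex.I / Real.pi, 0, 0] with hh0
  set κ : ℂ := (c.Ke + c.μe) / c.μe with hκ
  have hjet : ∀ {f g : ℝ → Fin 3 → ℂ} {a b : Fin 3 → ℂ}, Tendsto f (𝓝[>] 0) (𝓝 a) →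
      Tendsto g (𝓝[>] 0) (𝓝 b) → Tendsto (fun ω => jetState c.Ke c.μe R (f ω) (g ω)) (𝓝[>] 0)
        (𝓝 (jetState c.Ke c.μe R a b)) := fun hf hg =>
    ((continuous_jetState c.Ke c.μe R).tendsto (_, _)).comp (hf.prodMk_nhds hg)
  have hkT2 : Tendsto (fun ω => (c.kT ω : ℂ) ^ 2) (𝓝[>] 0) (𝓝 0) := by
    have : Continuous fun ω : ℝ => (ω : ℂ) ^ 2 := by fun_prop
    exact (((this.tendsto 0).mono_left nhdsWithin_le_nhds).comp c.tendsto_kT).trans_eq (by simp)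
  -- With `D = BL / kL² - BT / kT²` one has `BT = κ BL - kT² D`. Collecting the terms in `D` gives
  -- `Y`; those in `BL`, without the singular part, give `Z`.
  refine ⟨fun ω => jetState c.Ke c.μe R (εL • J (c.kL ω)) (εT • J (c.kT ω)),
    fun ω => jetState c.Ke c.μe R 0
      (-Complex.I • (h2 + (c.kT ω : ℂ) ^ 2 • (h0 + E (c.kT ω)))),
    fun ω => jetState c.Ke c.μe R (h0 + E (c.kL ω)) ((Complex.I * κ) • (h0 + E (c.kT ω))),
    ?_, ?_, ?_, fun ω hω BL BT hS => ?_⟩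
  · refine (hjet ((hJ.comp c.tendsto_kL).const_smul εL)
      ((hJ.comp c.tendsto_kT).const_smul εT)).trans_eq ?_
    rw [jetState_besselJ _ _ hR0]
  · refine (hjet tendsto_const_nhds ((tendsto_const_nhds.add (hkT2.smul
      (tendsto_const_nhds.add (hE.comp c.tendsto_kT)))).const_smul _)).trans_eq ?_
    rw [← jetState_inv_sq _ hμ hR0, zero_smul, add_zero]
  · refine (hjet (tendsto_const_nhds.add (hE.comp c.tendsto_kL))
      ((tendsto_const_nhds.add (hE.comp c.tendsto_kT)).const_smul _)).trans_eq ?_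
    rw [← jetState_const hK hμ hR0, add_zero]
  · obtain ⟨v, hv, hext⟩ := hS
    have hL : (c.kL ω : ℂ) ≠ 0 := by exact_mod_cast (c.kL_pos hω).ne'
    have hT : (c.kT ω : ℂ) ≠ 0 := by exact_mod_cast (c.kT_pos hω).ne'
    have hφ : HasJet (c.phi ω εL BL) R _ :=
      ((hJ' (c.kL ω)).const_mul (εL / (c.kL ω : ℂ) ^ 2)).add ((hE' _ (c.kL_pos hω)).const_mul BL)
    have hψ : HasJet (c.psi ω εT BT) R _ :=
      ((hJ' (c.kT ω)).const_mul (εT / (c.kT ω : ℂ) ^ 2)).add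
        ((hE' _ (c.kT_pos hω)).const_mul (Complex.I * BT))
    have hs := hv.2.1 R (by rwa [interior_Ioi]) (c.r0_lt_r1.trans hR).ne' hR.ne'
    rw [c.material_ext hR] at hs
    have hκ' : κ = (c.kT ω : ℂ) ^ 2 / (c.kL ω : ℂ) ^ 2 := by
      rw [c.kT_sq ω, mul_div_cancel_right₀ _ (pow_ne_zero 2 hL)]
    have hshift : ∀ (a b : Fin 3 → ℂ) (t : ℂ), jetState c.Ke c.μe R (a + t • h2)
        (b + t • Complex.I • h2) = jetState c.Ke c.μe R a b := fun a b t => by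
      rw [jetState_add, jetState_smul, hh2, jetState_inv_sq_same _ _ hR0, smul_zero, add_zero]
    refine ⟨v, hv, ?_⟩
    rw [SolvesAt.eq_jetState hK hμ hR0 hs
      (by filter_upwards [Ioi_mem_nhds hR] with r hr using (hext r hr).1)
      (by filter_upwards [Ioi_mem_nhds hR] with r hr using (hext r hr).2) hφ hψ,
      ← jetState_smul, ← jetState_smul, ← jetState_add, ← jetState_add]
    -- The singular terms proportional to `BL / kL²` form a pair of potentials with zero field and
    -- are added to the target state, to match the actual jets.
    refine Eq.trans ?_ (hshift _ _ (BL / (c.kL ω : ℂ) ^ 2))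
    congr 1
    · ext i
      simp only [Pi.add_apply, Pi.smul_apply, smul_eq_mul, Pi.zero_apply]
      field_simp
      ring
    · ext i
      simp only [Pi.add_apply, Pi.smul_apply, smul_eq_mul, hκ']
      field_simp
      ring

/-- The leading-order scattered amplitudes. -/
theorem tendsto_scattering (b : c.StaticBasis) {εL εT : ℂ} {BL BT : ℝ → ℂ}
    (h : ∀ᶠ ω in 𝓝[>] (0 : ℝ), c.Scattering ω εL εT (BL ω) (BT ω)) :
    Tendsto BL (𝓝[>] 0) (𝓝 (b.p2 * ((εL - Complex.I * εT) / 4) /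
        (-4 * Complex.I * (c.Ke + c.μe) / Real.pi))) ∧
      Tendsto BT (𝓝[>] 0) (𝓝 ((c.Ke + c.μe) / c.μe * (b.p2 * ((εL - Complex.I * εT) / 4) /
        (-4 * Complex.I * (c.Ke + c.μe) / Real.pi)))) := by
  have hK := c.Ke_pos
  have hμ := c.μe_pos
  have hR : c.r1 < 2 * c.r1 := by linarith [c.r1_pos]
  set R := 2 * c.r1 with hRdef
  have hR0 : R ≠ 0 := (c.r1_pos.trans hR).ne'
  have hRr : c.r0 ≤ R := (c.r0_lt_r1.trans hR).le
  have hKμ : (c.Ke + c.μe : ℂ) ≠ 0 := by exact_mod_cast (add_pos hK hμ).ne'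
  have hμc : (c.μe : ℂ) ≠ 0 := by exact_mod_cast hμ.ne'
  have hpi : (Real.pi : ℂ) ≠ 0 := by exact_mod_cast Real.pi_ne_zero
  set η : ℂ := (εL - Complex.I * εT) / 4
  set c3 : ℂ := -4 * Complex.I * (c.Ke + c.μe) / Real.pi with hc3
  set c4 : ℂ := 96 * Complex.I * c.μe / Real.pi with hc4
  have hc30 : c3 ≠ 0 := by
    simp [hc3, hKμ, hpi]
  have hc40 : c4 ≠ 0 := by
    simp [hc4, hμc, hpi]
  obtain ⟨X, Y, Z, hX, hY, hZ, hst⟩ := c.exists_scattering_state hR εL εT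
  set X₀ := isoField c.Ke c.μe ![η, 0, 0, 0] R
  set Y₀ := isoField c.Ke c.μe ![0, 0, 0, c4] R
  set Z₀ := isoField c.Ke c.μe ![0, 0, c3, 0] R
  have hp : c.IsField 2 0 (Ioc 0 R) b.p := b.hp.mono Ioc_subset_Ioi_self
  have hq : c.IsField 2 0 (Ioc 0 R) b.q := b.hq.mono Ioc_subset_Ioi_self
  obtain ⟨Cp, ωp, hCp, hωp, hpp⟩ := hp.exists_norm_pair_le hRr
  obtain ⟨Cq, ωq, hCq, hωq, hqq⟩ := hq.exists_norm_pair_le hRr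
  set D : ℝ → ℂ := fun ω => BL ω / (c.kL ω : ℂ) ^ 2 - BT ω / (c.kT ω : ℂ) ^ 2 with hD
  set e1 : ℝ → ℝ := fun ω => ‖X ω - X₀‖ + ‖Y ω - Y₀‖ + ‖Z ω - Z₀‖
  set e2 : ℝ → ℝ := fun ω => ω ^ 2 * (‖X ω‖ + ‖Y ω‖ + ‖Z ω‖) with he2
  have te1 : Tendsto e1 (𝓝[>] 0) (𝓝 0) := by
    have := ((tendsto_iff_norm_sub_tendsto_zero.1 hX).add
      (tendsto_iff_norm_sub_tendsto_zero.1 hY)).add (tendsto_iff_norm_sub_tendsto_zero.1 hZ)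
    simpa using this
  have te2 : Tendsto e2 (𝓝[>] 0) (𝓝 0) := by
    have h1 : Tendsto (fun ω : ℝ => ω ^ 2) (𝓝[>] 0) (𝓝 0) :=
      (((continuous_pow 2).tendsto 0).mono_left nhdsWithin_le_nhds).trans_eq (by simp)
    simpa using h1.mul ((hX.norm.add hY.norm).add hZ.norm)
  -- Replacing `X, Y, Z` by their limits costs `e1`, and the inertial drift of the pairing costs
  -- `e2`; both are relative to the unknown size `1 + ‖BL‖ + ‖D‖`.
  have bound : ∀ {C ω₀ : ℝ} {p : Fin 4 → ℂ}, 0 ≤ C → 0 < ω₀ → (∀ ω ∈ Icc 0 ω₀, ∀ v,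
      c.IsField 2 ω (Ioc 0 R) v → ‖pair p (v R)‖ ≤ C * ω ^ 2 * ‖v R‖) →
      ∀ᶠ ω in 𝓝[>] (0 : ℝ), ‖pair p X₀ + D ω * pair p Y₀ + BL ω * pair p Z₀‖ ≤
        (C * e2 ω + 4 * ‖p‖ * e1 ω) * (1 + ‖BL ω‖ + ‖D ω‖) := by
    intro C ω₀ p hC hω₀ hb
    filter_upwards [h, Ioo_mem_nhdsGT hω₀] with ω hω hω'
    obtain ⟨v, hv, hvR⟩ := hst ω hω'.1 _ _ hω
    have hv' := hb ω ⟨hω'.1.le, hω'.2.le⟩ v (hv.mono Ioc_subset_Ioi_self)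
    change v R = X ω + D ω • Y ω + BL ω • Z ω at hvR
    set m := 1 + ‖BL ω‖ + ‖D ω‖ with hm
    have comb : ∀ x y z : Fin 4 → ℂ, ‖x + D ω • y + BL ω • z‖ ≤ (‖x‖ + ‖y‖ + ‖z‖) * m := by
      intro x y z
      refine norm_add₃_le.trans ?_
      rw [norm_smul, norm_smul, hm]
      nlinarith [norm_nonneg x, norm_nonneg y, norm_nonneg z, norm_nonneg (D ω),
        norm_nonneg (BL ω), mul_nonneg (norm_nonneg x) (norm_nonneg (D ω)),
        mul_nonneg (norm_nonneg x) (norm_nonneg (BL ω)),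
        mul_nonneg (norm_nonneg y) (norm_nonneg (BL ω)),
        mul_nonneg (norm_nonneg z) (norm_nonneg (D ω))]
    have e : pair p X₀ + D ω * pair p Y₀ + BL ω * pair p Z₀ = pair p (v R) -
        pair p ((X ω - X₀) + D ω • (Y ω - Y₀) + BL ω • (Z ω - Z₀)) := by
      rw [hvR]
      simp only [pair_add_right, pair_smul_right, pair_sub_right]
      ring
    rw [e]
    refine (norm_sub_le _ _).trans ?_
    have h1 : ‖pair p (v R)‖ ≤ C * e2 ω * m := by
      refine hv'.trans ?_
      calc C * ω ^ 2 * ‖v R‖ ≤ C * ω ^ 2 * ((‖X ω‖ + ‖Y ω‖ + ‖Z ω‖) * m) := by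
            gcongr; rw [hvR]; exact comb _ _ _
        _ = C * e2 ω * m := by rw [he2]; ring
    have h2 : ‖pair p ((X ω - X₀) + D ω • (Y ω - Y₀) + BL ω • (Z ω - Z₀))‖ ≤
        4 * ‖p‖ * e1 ω * m := by
      refine (norm_pair_le _ _).trans ?_
      calc 4 * (‖p‖ * ‖(X ω - X₀) + D ω • (Y ω - Y₀) + BL ω • (Z ω - Z₀)‖)
          ≤ 4 * (‖p‖ * (e1 ω * m)) := by gcongr; exact comb _ _ _
        _ = _ := by ring
    linarith
  have hbp := bound hCp hωp hpp
  have hbq := bound hCq hωq hqq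
  rw [b.p_ext R hR.le] at hbp
  rw [b.q_ext R hR.le] at hbq
  -- The pairing with `p` annihilates the `r⁻³` limit `Y₀` and leaves an equation for `BL`; that
  -- with `q` annihilates the `r⁻¹` limit `Z₀` and leaves one for `D`.
  simp only [X₀, Y₀, Z₀, pair_isoField hK hμ _ _ hR0] at hbp hbq
  simp at hbp hbq
  set ep : ℝ → ℝ := fun ω => Cp * e2 ω + 4 * ‖isoField c.Ke c.μe ![1, 0, b.p2, b.p3] R‖ * e1 ω
  set er : ℝ → ℝ := fun ω => Cq * e2 ω + 4 * ‖isoField c.Ke c.μe ![0, 1, b.q2, b.q3] R‖ * e1 ω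
  have e1_nonneg : ∀ ω, 0 ≤ e1 ω := fun ω => by positivity
  have e2_nonneg : ∀ ω, 0 ≤ e2 ω := fun ω => by positivity
  have hep : ∀ ω, 0 ≤ ep ω := fun ω =>
    add_nonneg (mul_nonneg hCp (e2_nonneg ω)) (mul_nonneg (by positivity) (e1_nonneg ω))
  have her : ∀ ω, 0 ≤ er ω := fun ω =>
    add_nonneg (mul_nonneg hCq (e2_nonneg ω)) (mul_nonneg (by positivity) (e1_nonneg ω))
  have tep : Tendsto ep (𝓝[>] 0) (𝓝 0) := by
    simpa using (te2.const_mul Cp).add (te1.const_mul _)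
  have ter : Tendsto er (𝓝[>] 0) (𝓝 0) := by
    simpa using (te2.const_mul Cq).add (te1.const_mul _)
  have te : Tendsto (fun ω => ep ω / ‖2 * c3‖ + er ω / ‖(c.Ke + c.μe) * c4‖) (𝓝[>] 0) (𝓝 0) := by
    simpa using (tep.div_const _).add (ter.div_const _)
  obtain ⟨hBL, hDl⟩ := tendsto_of_norm_sub_le (f := BL) (g := D) (x := b.p2 * η / c3)
    (y := -(2 * (b.q2 * η)) / ((c.Ke + c.μe) * c4)) te
    (by
      filter_upwards [hbp] with ω hω
      have e : BL ω - b.p2 * η / c3 = -(2 * (b.p2 * η) + -(BL ω * (2 * c3))) / (2 * c3) := by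
        field_simp
        ring
      rw [e, norm_div, norm_neg, add_mul, div_mul_eq_mul_div]
      refine (div_le_div_of_nonneg_right hω (norm_nonneg _)).trans (le_add_of_nonneg_right ?_)
      exact mul_nonneg (div_nonneg (her ω) (norm_nonneg _)) (by positivity))
    (by
      filter_upwards [hbq] with ω hω
      have e : D ω - -(2 * (b.q2 * η)) / ((c.Ke + c.μe) * c4) =
          (2 * (b.q2 * η) + D ω * ((c.Ke + c.μe) * c4)) / ((c.Ke + c.μe) * c4) := by
        field_simp
        ring
      rw [e, norm_div, add_mul (ep ω / _), div_mul_eq_mul_div (er ω)]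
      refine (div_le_div_of_nonneg_right hω (norm_nonneg _)).trans (le_add_of_nonneg_left ?_)
      exact mul_nonneg (div_nonneg (hep ω) (norm_nonneg _)) (by positivity))
  have hkT2 : Tendsto (fun ω => (c.kT ω : ℂ) ^ 2) (𝓝[>] 0) (𝓝 0) := by
    have : Continuous fun ω : ℝ => (ω : ℂ) ^ 2 := by fun_prop
    exact (((this.tendsto 0).mono_left nhdsWithin_le_nhds).comp c.tendsto_kT).trans_eq (by simp)
  refine ⟨hBL, ?_⟩
  -- `BT = (kT / kL)² BL - kT² D`, and `D` is bounded since it converges.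
  refine (((hBL.const_mul ((c.Ke + c.μe : ℂ) / c.μe)).sub (hkT2.mul hDl)).congr' ?_).trans_eq
    (by rw [zero_mul, sub_zero])
  filter_upwards [self_mem_nhdsWithin] with ω hω
  have hL : (c.kL ω : ℂ) ≠ 0 := by exact_mod_cast (c.kL_pos hω).ne'
  have hT : (c.kT ω : ℂ) ≠ 0 := by exact_mod_cast (c.kT_pos hω).ne'
  have e : (c.Ke + c.μe : ℂ) / c.μe = (c.kT ω : ℂ) ^ 2 / (c.kL ω : ℂ) ^ 2 := by
    rw [c.kT_sq ω, mul_div_cancel_right₀ _ (pow_ne_zero 2 hL)]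
  rw [e, hD]
  field_simp
  ring

end CoreShell

/-! ### Assembly of the four statements -/

theorem mainTheorem2 (c : CoreShell) (α₁ α₃ α₄ : ℂ) (hα₁ : α₁ ≠ 0)
    (hα : c.StaticShear α₁ α₃ α₄) :
    (∀ (εL εT : ℂ) (BL BT : ℝ → ℂ), εL - Complex.I * εT ≠ 0 →
      (∀ᶠ ω in 𝓝[>] (0 : ℝ), c.Scattering ω εL εT (BL ω) (BT ω)) →
      ∃ BL0 BT0 : ℂ, Tendsto BL (𝓝[>] 0) (𝓝 BL0) ∧ Tendsto BT (𝓝[>] 0) (𝓝 BT0) ∧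
        (∀ ω : ℝ, 0 < ω → BL0 / (c.kL ω : ℂ) ^ 2 = BT0 / (c.kT ω : ℂ) ^ 2) ∧
        (BL0 = 0 ∧ BT0 = 0 ↔ α₃ = 0)) ∧
    (c.WeakNeutral ↔ c.BulkCondition ∧ α₃ = 0) ∧
    (c.StrongNeutral ↔ c.BulkCondition ∧ α₃ = 0 ∧ α₄ = 0) ∧
    (∀ m : PlaneMaterial, (∀ r ∈ Icc c.r0 c.r1, c.shell r = m) →
      ∀ K μ β : ℝ, K = (Real.sqrt (m.C11 * m.C22) + m.C12) / 2 →
        μ = (Real.sqrt (m.C11 * m.C22) - m.C12) / 2 → β = Real.sqrt (m.C22 / m.C11) →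
        (c.BulkCondition ↔
          c.Ke = (K * (μ + c.K0) - μ * (K - c.K0) * (c.r0 / c.r1) ^ (2 * β)) /
            (μ + c.K0 + (K - c.K0) * (c.r0 / c.r1) ^ (2 * β)))) := by
  obtain ⟨b⟩ := c.nonempty_staticBasis
  obtain ⟨x, y, hs, hf⟩ := CoreShell.exists_hydroShell_isField c
  obtain ⟨h3, h4⟩ := hα.coeff b
  have hr1 : (c.r1 : ℂ) ≠ 0 := by exact_mod_cast c.r1_pos.ne'
  have hα₃ : b.p2 = 0 ↔ α₃ = 0 := by
    constructor
    · intro h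
      rw [h, mul_zero] at h3
      exact (mul_eq_zero.1 h3).resolve_right (pow_ne_zero 2 hr1)
    · intro h
      rw [h, zero_mul] at h3
      exact (mul_eq_zero.1 h3.symm).resolve_left hα₁
  have hα₄ : b.p3 = 0 ↔ α₄ = 0 := by
    constructor
    · intro h
      rw [h, mul_zero] at h4
      exact (mul_eq_zero.1 h4).resolve_right (pow_ne_zero 4 hr1)
    · intro h
      rw [h, zero_mul] at h4
      exact (mul_eq_zero.1 h4.symm).resolve_left hα₁
  refine ⟨fun εL εT BL BT hε hS => ?_, ?_, ?_, fun m hm K μ β hK hμ hβ =>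
    CoreShell.bulkCondition_iff_of_uniform hm hK hμ hβ⟩
  · obtain ⟨hBL, hBT⟩ := CoreShell.tendsto_scattering b hS
    have hKμ : (c.Ke + c.μe : ℂ) ≠ 0 := by exact_mod_cast (add_pos c.Ke_pos c.μe_pos).ne'
    have hμc : (c.μe : ℂ) ≠ 0 := by exact_mod_cast c.μe_pos.ne'
    have hpi : (Real.pi : ℂ) ≠ 0 := by exact_mod_cast Real.pi_ne_zero
    refine ⟨_, _, hBL, hBT, fun ω hω => ?_, ?_⟩
    · have hL : (c.kL ω : ℂ) ≠ 0 := by exact_mod_cast (c.kL_pos hω).ne'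
      rw [c.kT_sq ω, mul_div_mul_left _ _ (div_ne_zero hKμ hμc)]
    -- The limits are nonzero multiples of `p2 (εL - i εT)`, so for nonvanishing `n = 2` loading
    -- they vanish exactly when `p2` does.
    · rw [← hα₃]
      simp [hε, hKμ, hμc, hpi]
  · rw [CoreShell.WeakNeutral, forall_and, CoreShell.forall_energyEquivalent_hydro_iff hs hf,
      CoreShell.forall_energyEquivalent_shear_iff b, hs.bulkCondition_iff, hα₃]
  · rw [CoreShell.StrongNeutral, forall_and, CoreShell.forall_unperturbed_hydro_iff hs hf,
      CoreShell.forall_unperturbed_shear_iff b, hs.bulkCondition_iff, hα₃, hα₄]
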